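/- Let $H\in(0,1)$, $K\in(0,1]$ with $2HK\ge 1$, let $T>0$, and let $B=(B_t)_{t\in[0,T]}$ be a bifractional Brownian motion on a probability space $(\Omega,\mathcal F,P)$, i.e. a centered Gaussian process with $B_0=0$ a.s., with a.s. continuous paths and with covariance $$E(B_tB_s)=R(t,s)=2^{-K}\left((t^{2H}+s^{2H})^K-|t-s|^{2HK}\right).$$ Let $\mathcal H$ be the completion of the step functions on $[0,T]$ with respect to the inner product determined by $\langle 1_{[0,t]},1_{[0,s]}\rangle_{\mathcal H}=R(t,s)$; let $B(\cdot):\mathcal H\to L^2(\Omega)$ be the isometry with $B(1_{[0,t]})=B_t$; a function in $L^2([0,T])$ is regarded as an element of $\mathcal H$ through the extension of the inclusion of the step functions. For $F=g(B(\varphi_1),\dots,B(\varphi_n))$ with $g\in C_b^\infty(\mathbb R^n)$ and $\varphi_i\in\mathcal H$ put $DF=\sum_i\partial_ig(B(\varphi_1),\dots,B(\varphi_n))\varphi_i$. A random element $u\in L^2(\Omega;\mathcal H)$ lies in $\mathrm{Dom}(\delta)$ if $|E\langle DF,u\rangle_{\mathcal H}|\le c\|F\|_{L^2(\Omega)}$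 for all such $F$, with $c$ independent of $F$; then $\delta(u)$ is the square integrable random variable, measurable with respect to the completed $\sigma$-algebra generated by $B$, with $E(F\delta(u))=E\langle DF,u\rangle_{\mathcal H}$ for all such $F$. The space $\mathbb D^{1,2}(\mathcal H)$ is the closure of the finite sums $u=\sum_jF_jh_j$ ($F_j$ as above, $h_j\in\mathcal H$) in the norm $(E\|u\|_{\mathcal H}^2+E\|Du\|_{\mathcal H\otimes\mathcal H}^2)^{1/2}$, where $Du=\sum_jDF_j\otimes h_j$. One says that $\delta(u)=Y$ in the localized sense if there are events $A_n$ increasing to a set of probability one and $v_n\in\mathbb D^{1,2}(\mathcal H)\cap \mathrm{Dom}(\delta)$ such that $u=v_n$ and $Y=\delta(v_n)$ a.s. on $A_n$, for every $n$. Write $\int_0^tu_s\,\delta B_s=\delta(u1_{(0,t]})$. Let $f\in C^2(\mathbb R)$ and $t\in[0,T]$. Then the Skorohod integral $\int_0^tf'(B_s)\,\delta B_s$ exists in the localized sense and, almost surely, $$f(B_t)=f(0)+\int_0^tf'(B_s)\,\delta B_s+HK\int_0^tf''(B_s)\,s^{2HK-1}\,ds.$$ If moreover $|f'(x)|+|f''(x)|\le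 Ce^{c|x|}$ for all $x\in\mathbb R$ and some constants $C,c$ (in particular if $f'$ and $f''$ are bounded), then $f'(B_\cdot)1_{(0,t]}\in\mathrm{Dom}(\delta)$, and the integral in the formula is its divergence in the strict sense. -/

import Mathlib

open Set Filter Topology MeasureTheory ProbabilityTheory
open scoped TensorProduct ENNReal InnerProductSpace

/-! ## Bifractional Brownian motion -/

/-- The covariance function `R(t,s) = 2^{-K} ((t^{2H} + s^{2H})^K - |t - s|^{2HK})`. -/
noncomputable def bifCov (H K t s : ℝ) : ℝ :=
  1 / (2 : ℝ) ^ K * ((t ^ (2 * H) + s ^ (2 * H)) ^ K - |t - s| ^ (2 * H * K))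

/-- `B` restricted to `[0,T]` is a bifractional Brownian motion with parameters `H`, `K`: a centered
Gaussian process, starting from zero, with covariance `bifCov H K` and almost surely continuous
paths. Values of `B` outside `[0,T]` are irrelevant. -/
structure IsBifractionalBM {Ω : Type*} [MeasurableSpace Ω] (H K T : ℝ) (B : ℝ → Ω → ℝ)
    (P : Measure Ω) : Prop where
  measurable : ∀ t ∈ Icc 0 T, Measurable (B t)
  gaussian : IsGaussianProcess (fun t : Icc (0 : ℝ) T => B t) P
  centered : ∀ t ∈ Icc 0 T, ∫ ω, B t ω ∂P = 0
  cov : ∀ t ∈ Icc 0 T, ∀ s ∈ Icc 0 T, ∫ ω, B t ω * B s ω ∂P = bifCov H K t s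
  start : ∀ᵐ ω ∂P, B 0 ω = 0
  continuous : ∀ᵐ ω ∂P, ContinuousOn (fun t => B t ω) (Icc 0 T)

/-- The covariance function as a matrix indexed by `[0,T]`. -/
noncomputable def bifKernel (H K T : ℝ) : Matrix (Icc (0 : ℝ) T) (Icc (0 : ℝ) T) ℝ :=
  Matrix.of fun t s => bifCov H K t s

/-! ## The canonical Hilbert space of a covariance kernel on `[0,T]` -/

/-- The space of step functions on `[0,T]`: the finitely supported family `c` stands for
the function `∑ₜ c t • 1_{[0,t]}`. It carries the inner product for which
`⟨1_{[0,t]}, 1_{[0,s]}⟩ = R t s`. -/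
@[nolint unusedArguments]
def StepSpace {T : ℝ} {R : Matrix (Icc (0 : ℝ) T) (Icc (0 : ℝ) T) ℝ}
    (_hR : R.PosSemidef) : Type :=
  Icc (0 : ℝ) T →₀ ℝ

namespace StepSpace

variable {T : ℝ} {R : Matrix (Icc (0 : ℝ) T) (Icc (0 : ℝ) T) ℝ} (hR : R.PosSemidef)

noncomputable instance : AddCommGroup (StepSpace hR) :=
  inferInstanceAs (AddCommGroup (Icc (0 : ℝ) T →₀ ℝ))

noncomputable instance : Module ℝ (StepSpace hR) :=
  inferInstanceAs (Module ℝ (Icc (0 : ℝ) T →₀ ℝ))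

/-- The bilinear form `⟨∑ₜ c t 1_{[0,t]}, ∑ₛ d s 1_{[0,s]}⟩ = ∑ₜ ∑ₛ c t * R t s * d s`. -/
noncomputable def form {T : ℝ} (R : Matrix (Icc (0 : ℝ) T) (Icc (0 : ℝ) T) ℝ)
    (c d : Icc (0 : ℝ) T →₀ ℝ) : ℝ :=
  c.sum fun t a => d.sum fun s b => a * R t s * b

theorem form_symm {R : Matrix (Icc (0 : ℝ) T) (Icc (0 : ℝ) T) ℝ} (hR : R.PosSemidef)
    (c d : Icc (0 : ℝ) T →₀ ℝ) : form R d c = form R c d := by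
  have hsymm : ∀ t s, R t s = R s t := fun t s => by
    have := hR.1.apply s t
    simpa using this
  unfold form
  rw [Finsupp.sum_comm]
  refine Finsupp.sum_congr fun t _ => Finsupp.sum_congr fun s _ => ?_
  rw [hsymm s t]; ring

theorem form_add_left (R : Matrix (Icc (0 : ℝ) T) (Icc (0 : ℝ) T) ℝ)
    (c d e : Icc (0 : ℝ) T →₀ ℝ) : form R (c + d) e = form R c e + form R d e := by
  unfold form
  rw [Finsupp.sum_add_index']
  · intro t; simp
  · intro t a b; simp [add_mul, Finsupp.sum_add]

theorem form_smul_left (R : Matrix (Icc (0 : ℝ) T) (Icc (0 : ℝ) T) ℝ)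
    (c d : Icc (0 : ℝ) T →₀ ℝ) (r : ℝ) : form R (r • c) d = r * form R c d := by
  unfold form
  rw [Finsupp.sum_smul_index (by intro t; simp), Finsupp.mul_sum]
  refine Finsupp.sum_congr fun t _ => ?_
  rw [Finsupp.mul_sum]
  refine Finsupp.sum_congr fun s _ => ?_
  ring

noncomputable instance core : PreInnerProductSpace.Core ℝ (StepSpace hR) where
  inner c d := form R c d
  conj_inner_symm c d := form_symm hR c d
  re_inner_nonneg c := by
    have := hR.2 c
    simpa [form] using this
  add_left c d e := form_add_left R c d e
  smul_left c d r := form_smul_left R c d r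

noncomputable instance : SeminormedAddCommGroup (StepSpace hR) :=
  InnerProductSpace.Core.toSeminormedAddCommGroup (𝕜 := ℝ)

noncomputable instance : InnerProductSpace ℝ (StepSpace hR) :=
  InnerProductSpace.ofCore (core hR)

theorem inner_eq (c d : StepSpace hR) : ⟪c, d⟫_ℝ = form R c d := rfl

/-- The indicator function `1_{[0,t]}`. -/
noncomputable def ind (t : Icc (0 : ℝ) T) : StepSpace hR :=
  (Finsupp.single t 1 : Icc (0 : ℝ) T →₀ ℝ)

theorem inner_ind (t s : Icc (0 : ℝ) T) : ⟪ind hR t, ind hR s⟫_ℝ = R t s := by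
  rw [inner_eq]
  simp [form, ind]

/-- The step function `∑ₜ c t • 1_{[0,t]}` represented by `c`. -/
noncomputable def toFun {hR : R.PosSemidef} (c : StepSpace hR) : ℝ → ℝ := fun u =>
  Finsupp.sum (M := ℝ) c fun t a => a * (Icc (0 : ℝ) t).indicator (fun _ => (1 : ℝ)) u

end StepSpace

/-- The canonical Hilbert space: the completion of the step functions. -/
abbrev CanonicalHilbert {T : ℝ} {R : Matrix (Icc (0 : ℝ) T) (Icc (0 : ℝ) T) ℝ}
    (hR : R.PosSemidef) : Type :=
  UniformSpace.Completion (StepSpace hR)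

/-- The element `h` of the canonical Hilbert space is the function `φ` on `[0,T]`, under the
extension to `L²([0,T])` of the inclusion of the step functions: there are step functions that
converge to `φ` in `L²([0,T])` and to `h` in the canonical Hilbert space. -/
def Represents {T : ℝ} {R : Matrix (Icc (0 : ℝ) T) (Icc (0 : ℝ) T) ℝ} {hR : R.PosSemidef}
    (h : CanonicalHilbert hR) (φ : ℝ → ℝ) : Prop :=
  ∃ c : ℕ → StepSpace hR,
    Tendsto (fun n => eLpNorm (fun s => (c n).toFun s - φ s) 2 (volume.restrict (Icc 0 T)))
      atTop (𝓝 0) ∧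
    Tendsto (fun n => (c n : CanonicalHilbert hR)) atTop (𝓝 h)

/-! ## Malliavin calculus over a Gaussian isometry `W : E → L²(Ω)` -/

section Malliavin

variable {Ω : Type*} [MeasurableSpace Ω] {P : Measure Ω}
variable {E : Type*} [NormedAddCommGroup E] [InnerProductSpace ℝ E]

/-- Data of a smooth functional `g(W(h 1), …, W(h n))` with `g ∈ C_b^∞(ℝⁿ)`. -/
structure SmoothFunctional (E : Type*) where
  n : ℕ
  g : (Fin n → ℝ) → ℝ
  h : Fin n → E
  smooth : ContDiff ℝ (⊤ : ℕ∞) g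
  bounded : ∀ k : ℕ, ∃ C : ℝ, ∀ x, ‖iteratedFDeriv ℝ k g x‖ ≤ C

/-- The random variable `F = g(W(h 1), …, W(h n))`. -/
noncomputable def SmoothFunctional.val (W : E →L[ℝ] Lp ℝ 2 P) (F : SmoothFunctional E)
    (ω : Ω) : ℝ :=
  F.g fun i => W (F.h i) ω

/-- The Malliavin derivative `DF = ∑ᵢ ∂ᵢg(W(h 1), …, W(h n)) h i`. -/
noncomputable def SmoothFunctional.D (W : E →L[ℝ] Lp ℝ 2 P) (F : SmoothFunctional E)
    (ω : Ω) : E :=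
  ∑ i, fderiv ℝ F.g (fun j => W (F.h j) ω) (Pi.single i 1) • F.h i

/-- Data of a smooth `E`-valued random variable `∑ⱼ Fⱼ hⱼ` with `Fⱼ` smooth functionals. -/
structure SmoothVector (E : Type*) where
  m : ℕ
  F : Fin m → SmoothFunctional E
  h : Fin m → E

/-- The random vector `∑ⱼ Fⱼ hⱼ`. -/
noncomputable def SmoothVector.val (W : E →L[ℝ] Lp ℝ 2 P) (V : SmoothVector E) (ω : Ω) : E :=
  ∑ j, (V.F j).val W ω • V.h j

/-- The Malliavin derivative `∑ⱼ DFⱼ ⊗ hⱼ`, with values in `E ⊗ E` (with the Hilbert tensor norm). -/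
noncomputable def SmoothVector.D (W : E →L[ℝ] Lp ℝ 2 P) (V : SmoothVector E) (ω : Ω) :
    E ⊗[ℝ] E :=
  ∑ j, (V.F j).D W ω ⊗ₜ[ℝ] V.h j

/-- `u ∈ 𝔻^{1,2}(E)`: `u` belongs to the closure of the smooth `E`-valued random variables with
respect to the norm `(E‖u‖² + E‖Du‖²)^{1/2}`. -/
def MemD12 (W : E →L[ℝ] Lp ℝ 2 P) (u : Ω → E) : Prop :=
  MemLp u 2 P ∧ ∃ V : ℕ → SmoothVector E,
    Tendsto (fun k => eLpNorm (fun ω => (V k).val W ω - u ω) 2 P) atTop (𝓝 0) ∧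
    Tendsto (fun p : ℕ × ℕ => eLpNorm (fun ω => (V p.1).D W ω - (V p.2).D W ω) 2 P)
      (atTop ×ˢ atTop) (𝓝 0)

/-- `u ∈ Dom(δ)`: `u ∈ L²(Ω; E)` and `|E⟨DF, u⟩| ≤ c ‖F‖_{L²}` for all smooth functionals `F`. -/
def MemDomDivergence (W : E →L[ℝ] Lp ℝ 2 P) (u : Ω → E) : Prop :=
  MemLp u 2 P ∧ ∃ c : ℝ, ∀ F : SmoothFunctional E,
    |∫ ω, ⟪F.D W ω, u ω⟫_ℝ ∂P| ≤ c * (eLpNorm (F.val W) 2 P).toReal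

end Malliavin

/-- `u ∈ Dom(δ)` and `δ(u) = Y`: `Y` is the square integrable random variable, measurable with
respect to the completion of the `σ`-algebra `m` generated by the process, such that
`E(F Y) = E⟨DF, u⟩` for all smooth functionals `F`. -/
def IsDivergence {Ω : Type*} (m : MeasurableSpace Ω) {mΩ : MeasurableSpace Ω} {P : Measure Ω}
    {E : Type*} [NormedAddCommGroup E] [InnerProductSpace ℝ E]
    (W : E →L[ℝ] Lp ℝ 2 P) (u : Ω → E) (Y : Ω → ℝ) : Prop :=
  MemDomDivergence W u ∧ MemLp Y 2 P ∧ AEStronglyMeasurable[m] Y P ∧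
    ∀ F : SmoothFunctional E, ∫ ω, F.val W ω * Y ω ∂P = ∫ ω, ⟪F.D W ω, u ω⟫_ℝ ∂P

/-- `u ∈ 𝔻^{1,2}_{loc}(E)` and `δ(u) = Y`: there are events `A n` increasing to a set of full
measure and `v n ∈ 𝔻^{1,2}(E)` such that `u = v n` and `Y = δ(v n)` almost surely on `A n`. -/
def IsLocalDivergence {Ω : Type*} (m : MeasurableSpace Ω) {mΩ : MeasurableSpace Ω} {P : Measure Ω}
    {E : Type*} [NormedAddCommGroup E] [InnerProductSpace ℝ E]
    (W : E →L[ℝ] Lp ℝ 2 P) (u : Ω → E)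
    (Y : Ω → ℝ) : Prop :=
  ∃ (A : ℕ → Set Ω) (v : ℕ → Ω → E) (Z : ℕ → Ω → ℝ),
    (∀ n, MeasurableSet (A n)) ∧ Monotone A ∧ (∀ᵐ ω ∂P, ∃ n, ω ∈ A n) ∧
    ∀ n, MemD12 W (v n) ∧ IsDivergence m W (v n) (Z n) ∧
      ∀ᵐ ω ∂P, ω ∈ A n → u ω = v n ω ∧ Y ω = Z n ω


/-! ## The Skorohod integral with respect to bifractional Brownian motion -/

namespace IsBifractionalBM

variable {Ω : Type*} [MeasurableSpace Ω] {H K T : ℝ} {B : ℝ → Ω → ℝ} {P : Measure Ω}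

theorem memLp (hB : IsBifractionalBM H K T B P) (t : Icc (0 : ℝ) T) : MemLp (B t) 2 P :=
  (hB.gaussian.hasGaussianLaw_eval t).memLp_two

/-- The linear map `∑ₜ c t 1_{[0,t]} ↦ ∑ₜ c t B_t` from step functions to `L²(Ω)`. -/
noncomputable def wienerFinsupp (hB : IsBifractionalBM H K T B P) :
    (Icc (0 : ℝ) T →₀ ℝ) →ₗ[ℝ] Lp ℝ 2 P :=
  Finsupp.linearCombination ℝ fun t => (hB.memLp t).toLp (B t)

theorem inner_wienerFinsupp (hB : IsBifractionalBM H K T B P) (c d : Icc (0 : ℝ) T →₀ ℝ) :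
    ⟪hB.wienerFinsupp c, hB.wienerFinsupp d⟫_ℝ = StepSpace.form (bifKernel H K T) c d := by
  have key : ∀ t s : Icc (0 : ℝ) T,
      ⟪(hB.memLp t).toLp (B t), (hB.memLp s).toLp (B s)⟫_ℝ = bifKernel H K T t s := by
    intro t s
    rw [MeasureTheory.L2.inner_def, bifKernel, Matrix.of_apply, ← hB.cov t t.2 s s.2]
    refine integral_congr_ae ?_
    filter_upwards [(hB.memLp t).coeFn_toLp, (hB.memLp s).coeFn_toLp] with ω h1 h2
    rw [h1, h2]
    simp [mul_comm]
  unfold wienerFinsupp StepSpace.form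
  rw [Finsupp.linearCombination_apply, Finsupp.linearCombination_apply, Finsupp.sum_inner]
  refine Finsupp.sum_congr fun t _ => ?_
  rw [Finsupp.inner_sum]
  refine Finsupp.sum_congr fun s _ => ?_
  rw [real_inner_smul_left, real_inner_smul_right, key]
  ring

/-- The covariance kernel of an existing process is positive semidefinite. -/
theorem posSemidef (hB : IsBifractionalBM H K T B P) : (bifKernel H K T).PosSemidef := by
  refine ⟨?_, fun c => ?_⟩
  · ext t s
    simp only [bifKernel, bifCov, Matrix.conjTranspose_apply, Matrix.of_apply, star_trivial]
    rw [add_comm, abs_sub_comm]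
  · have h : 0 ≤ ⟪hB.wienerFinsupp c, hB.wienerFinsupp c⟫_ℝ := real_inner_self_nonneg
    rw [hB.inner_wienerFinsupp] at h
    simpa [StepSpace.form] using h

/-- The isometry `φ ↦ B(φ)` on step functions, with `B(1_{[0,t]}) = B_t`. -/
noncomputable def wienerStep (hB : IsBifractionalBM H K T B P) :
    StepSpace hB.posSemidef →ₗᵢ[ℝ] Lp ℝ 2 P :=
  LinearMap.isometryOfInner
    { toFun := fun c => hB.wienerFinsupp c
      map_add' := fun c d => hB.wienerFinsupp.map_add c d
      map_smul' := fun r c => hB.wienerFinsupp.map_smul r c }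
    fun c d => hB.inner_wienerFinsupp c d

/-- The isometry `φ ↦ B(φ)` extended by continuity to the canonical Hilbert space. -/
noncomputable def wiener (hB : IsBifractionalBM H K T B P) :
    CanonicalHilbert hB.posSemidef →L[ℝ] Lp ℝ 2 P :=
  hB.wienerStep.toContinuousLinearMap.extend UniformSpace.Completion.toComplL

theorem wiener_coe (hB : IsBifractionalBM H K T B P) (c : StepSpace hB.posSemidef) :
    hB.wiener (c : CanonicalHilbert hB.posSemidef) = hB.wienerFinsupp c :=
  ContinuousLinearMap.extend_eq _ UniformSpace.Completion.denseRange_coe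
    (UniformSpace.Completion.isUniformInducing_coe _) c

theorem wiener_ind (hB : IsBifractionalBM H K T B P) (t : Icc (0 : ℝ) T) :
    hB.wiener (StepSpace.ind hB.posSemidef t : CanonicalHilbert hB.posSemidef) =ᵐ[P] B t := by
  rw [hB.wiener_coe]
  simp only [wienerFinsupp, StepSpace.ind, Finsupp.linearCombination_single, one_smul]
  exact (hB.memLp t).coeFn_toLp

/-- The `σ`-algebra generated by the process on `[0,T]`. -/
@[nolint unusedArguments]
abbrev sigma (_hB : IsBifractionalBM H K T B P) : MeasurableSpace Ω :=
  ⨆ t : Icc (0 : ℝ) T, MeasurableSpace.comap (B t) inferInstance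

/-- `I = ∫₀ᵀ φ_s δB_s` in the strict sense: almost every path of `φ` lies in the canonical Hilbert
space, the resulting random element is in `Dom(δ)`, and its divergence is `I`. -/
def HasSkorohodIntegral (hB : IsBifractionalBM H K T B P) (φ : Ω → ℝ → ℝ) (I : Ω → ℝ) : Prop :=
  ∃ u : Ω → CanonicalHilbert hB.posSemidef,
    (∀ᵐ ω ∂P, Represents (u ω) (φ ω)) ∧ IsDivergence hB.sigma hB.wiener u I

/-- `I = ∫₀ᵀ φ_s δB_s` in the localized sense. -/
def HasLocalSkorohodIntegral (hB : IsBifractionalBM H K T B P) (φ : Ω → ℝ → ℝ)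
    (I : Ω → ℝ) : Prop :=
  ∃ u : Ω → CanonicalHilbert hB.posSemidef,
    (∀ᵐ ω ∂P, Represents (u ω) (φ ω)) ∧ IsLocalDivergence hB.sigma hB.wiener u I

end IsBifractionalBM

/-! ## Gaussian integration by parts -/

/-! The integral is identified by duality. Put Y = f(B_t) - f(0) - HK ∫₀ᵗ f''(B_s) s^{2HK-1} ds and
u = f'(B) 1_{(0,t]}. If u and Y are square integrable, Y is measurable with respect to B and E(F Y)
= E⟨DF, u⟩ for all smooth F, then u ∈ Dom(δ) and δ(u) = Y (`isDivergence_of_duality`). Itô's formula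
then holds by the definition of Y.

The geometric input is that the canonical norm is dominated by the L² norm. The Gram matrix of the
intervals of a partition consists of rectangular increments of R. Both (t^{2H} + s^{2H})^K and |t -
s|^{2HK} have nonpositive rectangular increments, because x^K is concave for K ≤ 1 and |x|^{2HK} is
convex for 2HK ≥ 1. Absolute row sums therefore telescope and are at most a constant times the
length of the interval (`sum_abs_rectIncr_bifCov_le`). Schur's test gives ‖∑ xᵢ 1_{Iᵢ}‖² ≤ C (t/n) ∑
‖xᵢ‖² (`norm_stepSum_sq_le`), so the step functions that sample a continuous path converge in the
canonical space, path by path, and this defines u.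

Duality for bounded f, f', f'' (`integral_val_mul_itoDiv_of_bounded`): on one interval let a =
1_{[0,tᵢ]} and d = 1_{(tᵢ,tᵢ₊₁]}. Gaussian integration by parts expresses the θ-derivative of E[F
f(W(a + θd))] by E[⟨DF, d⟩ f'] and E[F f''] ⟨a + θd, d⟩. Subtracting E[F f''(W a)] ‖a + θd‖²/2 and
applying the mean value theorem leaves an error of the form (oscillation of f'') times ⟨a + θd, d⟩,
and the inner product is O(t/n) by the same row sums. Thus continuity of f'' suffices. Since
‖1_{[0,s]}‖² = s^{2HK}, summation over the partition gives Riemann–Stieltjes sums for the correction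
term, and the first-order terms converge to E⟨DF, u⟩.

For exponential growth, f' is multiplied by a cut-off; Gaussian exponential moments give L²
convergence, and the divergence is closed (`duality_of_tendsto`). For arbitrary f ∈ C², the
truncated and the original objects agree on {sup |B| ≤ N}, and the truncated integrand lies in
𝔻^{1,2} by mollification (`memD12_compElem`). -/

theorem hasDerivAt_gaussianPDFReal_zero {v : NNReal} (x : ℝ) :
    HasDerivAt (gaussianPDFReal 0 v) (-(x / v) * gaussianPDFReal 0 v x) x := by
  have h1 : HasDerivAt (fun y : ℝ => -(y - 0) ^ 2 / (2 * v)) (-(x / v)) x := by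
    have := ((((hasDerivAt_id x).sub_const 0).pow 2).neg).div_const (2 * (v : ℝ))
    refine this.congr_deriv ?_
    rcases eq_or_ne (v : ℝ) 0 with h | h
    · simp [h]
    · simp; field_simp
  have h2 := (h1.exp.const_mul (√(2 * Real.pi * v))⁻¹)
  refine h2.congr_deriv ?_
  rw [gaussianPDFReal]; ring

/-- Stein's identity for the centered normal law. -/
theorem integral_mul_gaussianReal_zero {v : NNReal} {u u' : ℝ → ℝ} {M M' : ℝ}
    (hu : ∀ x, HasDerivAt u (u' x) x) (hu' : Measurable u') (hM : ∀ x, |u x| ≤ M)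
    (hM' : ∀ x, |u' x| ≤ M') :
    ∫ z, z * u z ∂gaussianReal 0 v = v * ∫ z, u' z ∂gaussianReal 0 v := by
  rcases eq_or_ne v 0 with rfl | hv
  · simp
  have hv' : (v : ℝ) ≠ 0 := by exact_mod_cast hv
  have hucont : Continuous u := continuous_iff_continuousAt.2 fun x => (hu x).continuousAt
  have hid : Integrable (fun z : ℝ => z * gaussianPDFReal 0 v z) := by
    have h1 : Integrable (fun z : ℝ => z) (gaussianReal 0 v) :=
      (memLp_id_gaussianReal (μ := 0) (v := v) 1).integrable (by simp)
    rw [gaussianReal_of_var_ne_zero _ hv] at h1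
    rw [integrable_withDensity_iff (measurable_gaussianPDF 0 v)
      (ae_of_all _ fun x => gaussianPDF_lt_top)] at h1
    simpa using h1
  have hp := integrable_gaussianPDFReal 0 v
  -- Integration by parts on the line against the density p, using p'(x) = -(x/v) p(x).
  have key := integral_mul_deriv_eq_deriv_mul_of_integrable (A := ℝ) (u := u) (u' := u')
    (v := gaussianPDFReal 0 v) (v' := fun x => -(x / v) * gaussianPDFReal 0 v x)
    (fun x _ => hu x) (fun x _ => hasDerivAt_gaussianPDFReal_zero x) ?_ ?_ ?_
  · rw [integral_gaussianReal_eq_integral_smul hv, integral_gaussianReal_eq_integral_smul hv]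
    simp only [smul_eq_mul]
    have e1 : ∫ x, u x * (-(x / v) * gaussianPDFReal 0 v x)
        = -(v : ℝ)⁻¹ * ∫ x, gaussianPDFReal 0 v x * (x * u x) := by
      rw [← integral_const_mul]; congr 1; ext x; field_simp
    have e2 : ∫ x, u' x * gaussianPDFReal 0 v x = ∫ x, gaussianPDFReal 0 v x * u' x := by
      congr 1; ext x; ring
    rw [e1, e2] at key
    have : (v : ℝ) * ((v : ℝ)⁻¹ * ∫ x, gaussianPDFReal 0 v x * (x * u x))
        = v * ∫ x, gaussianPDFReal 0 v x * u' x := by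
      congr 1; linarith
    rw [← this]; field_simp
  · refine ((hid.const_mul (-(v : ℝ)⁻¹)).bdd_mul (c := M)
      hucont.aestronglyMeasurable (ae_of_all _ hM)).congr
      (ae_of_all _ fun x => ?_)
    simp only [Pi.mul_apply]; ring
  · exact hp.bdd_mul (c := M') hu'.aestronglyMeasurable (ae_of_all _ hM')
  · exact hp.bdd_mul (c := M) hucont.aestronglyMeasurable (ae_of_all _ hM)

/-! ### Isonormal families: joint normality, independence, integration by parts -/

section Isonormal

variable {Ω : Type*} [MeasurableSpace Ω] {P : Measure Ω}
variable {E : Type*} [NormedAddCommGroup E] [InnerProductSpace ℝ E]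

/-- `W` is an isonormal Gaussian family: an isometry with centered normal values. -/
structure IsIsonormal (W : E →L[ℝ] Lp ℝ 2 P) : Prop where
  inner_map : ∀ h k, ⟪W h, W k⟫_ℝ = ⟪h, k⟫_ℝ
  map_eq : ∀ h, P.map (W h) = gaussianReal 0 (‖h‖₊ ^ 2)

namespace IsIsonormal

variable {W : E →L[ℝ] Lp ℝ 2 P}

theorem aemeasurable (W : E →L[ℝ] Lp ℝ 2 P) (h : E) : AEMeasurable (W h) P :=
  (Lp.aestronglyMeasurable _).aemeasurable

theorem measurable (W : E →L[ℝ] Lp ℝ 2 P) (h : E) : Measurable (W h) :=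
  (Lp.stronglyMeasurable _).measurable

theorem isProbabilityMeasure (hW : IsIsonormal W) : IsProbabilityMeasure P := by
  have h := hW.map_eq 0
  have : IsProbabilityMeasure (P.map (W 0)) := by rw [h]; infer_instance
  exact Measure.isProbabilityMeasure_of_map (W 0)

theorem coeFn_lincomb (W : E →L[ℝ] Lp ℝ 2 P) {ι : Type*} (s : Finset ι) (c : ι → ℝ) (k : ι → E) :
    W (∑ i ∈ s, c i • k i) =ᵐ[P] fun ω => ∑ i ∈ s, c i * W (k i) ω := by
  classical
  induction s using Finset.induction_on with
  | empty =>
    simp only [Finset.sum_empty, map_zero]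
    exact Lp.coeFn_zero _ _ _
  | insert a s ha ih =>
    rw [Finset.sum_insert ha, map_add, map_smul]
    filter_upwards [Lp.coeFn_add (c a • W (k a)) (W (∑ i ∈ s, c i • k i)), ih,
      Lp.coeFn_smul (c a) (W (k a))] with ω h1 h2 h3
    rw [h1, Pi.add_apply, h2, h3, Finset.sum_insert ha]
    simp

/-- A linear functional of the vector (W k_i) is, almost surely, W of the corresponding linear
combination of the k_i, hence normal; a law all of whose one-dimensional projections are normal is
Gaussian. -/
theorem hasGaussianLaw (hW : IsIsonormal W) {ι : Type*} [Fintype ι] (k : ι → E) :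
    HasGaussianLaw (fun ω i => W (k i) ω) P := by
  classical
  have hm : Measurable (fun ω i => W (k i) ω) :=
    measurable_pi_lambda _ fun i => measurable W (k i)
  refine ⟨isGaussian_of_map_eq_gaussianReal fun L =>
    ⟨0, ‖∑ i, L (Pi.single i 1) • k i‖₊ ^ 2, ?_⟩⟩
  · rw [← hW.map_eq (∑ i, L (Pi.single i 1) • k i), Measure.map_map L.measurable hm]
    refine Measure.map_congr ?_
    filter_upwards [coeFn_lincomb W Finset.univ (fun i => L (Pi.single i 1)) k] with ω hω
    rw [hω, Function.comp_apply]
    conv_lhs => rw [← Finset.univ_sum_single (fun i => W (k i) ω)]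
    rw [map_sum]
    refine Finset.sum_congr rfl fun i _ => ?_
    have : (Pi.single i (W (k i) ω) : ι → ℝ) = W (k i) ω • Pi.single i 1 := by
      rw [← Pi.single_smul]; simp
    rw [this, map_smul, smul_eq_mul, mul_comm]

theorem memLp (W : E →L[ℝ] Lp ℝ 2 P) (h : E) : MemLp (W h) 2 P := Lp.memLp _

theorem integral_mul (hW : IsIsonormal W) (h k : E) : ∫ ω, W h ω * W k ω ∂P = ⟪h, k⟫_ℝ := by
  rw [← hW.inner_map, MeasureTheory.L2.inner_def]
  congr 1; ext ω; simp [mul_comm]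

theorem integral_eq_zero (hW : IsIsonormal W) (h : E) : ∫ ω, W h ω ∂P = 0 := by
  have := integral_map (μ := P) (f := fun x : ℝ => x) (aemeasurable W h) (by fun_prop)
  rw [← this, hW.map_eq]
  exact integral_id_gaussianReal

/-- The joint vector is Gaussian, so vanishing covariances imply independence. `W h` is treated as a
vector indexed by `Unit` because the criterion compares two Gaussian vectors. -/
theorem indepFun (hW : IsIsonormal W) {m : ℕ} (h : E) (k : Fin m → E)
    (hk : ∀ i, ⟪h, k i⟫_ℝ = 0) : IndepFun (W h) (fun ω i => W (k i) ω) P := by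
  have := hW.isProbabilityMeasure
  have h1 := (hW.hasGaussianLaw (Sum.elim (fun _ : Unit => h) k)).map_fun
    ((ContinuousLinearMap.pi fun _ : Unit =>
      ContinuousLinearMap.proj (R := ℝ) (φ := fun _ : Unit ⊕ Fin m => ℝ) (Sum.inl ())).prod
    (ContinuousLinearMap.pi fun j : Fin m =>
      ContinuousLinearMap.proj (R := ℝ) (φ := fun _ : Unit ⊕ Fin m => ℝ) (Sum.inr j)))
  have h2 : IndepFun (fun ω (_ : Unit) => W h ω) (fun ω i => W (k i) ω) P := by
    refine HasGaussianLaw.indepFun_of_covariance_eval (X := fun _ => W h)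
      (Y := fun i => W (k i)) h1 fun _ i => ?_
    rw [covariance_eq_sub (memLp W h) (memLp W (k i)), hW.integral_eq_zero, zero_mul, sub_zero]
    exact (hW.integral_mul h (k i)).trans (hk i)
  exact h2.comp (φ := fun x : Unit → ℝ => x ()) (measurable_pi_apply _) measurable_id

/-- Gaussian integration by parts. -/
theorem integral_mul_comp (hW : IsIsonormal W) {m : ℕ} (h : E) (k : Fin m → E)
    {G : (Fin m → ℝ) → ℝ} (hG : ContDiff ℝ 1 G) {M M' : ℝ} (hM : ∀ x, |G x| ≤ M)
    (hM' : ∀ x, ‖fderiv ℝ G x‖ ≤ M') :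
    ∫ ω, W h ω * G (fun i => W (k i) ω) ∂P
      = ∫ ω, fderiv ℝ G (fun i => W (k i) ω) (fun i => ⟪k i, h⟫_ℝ) ∂P := by
  have := hW.isProbabilityMeasure
  rcases eq_or_ne h 0 with rfl | hh
  · have e : W 0 =ᵐ[P] 0 := by rw [map_zero]; exact Lp.coeFn_zero _ _ _
    rw [integral_congr_ae (g := fun _ => (0 : ℝ)) (e.mono fun ω hω => by rw [hω]; simp)]
    have : (fun i => ⟪k i, (0 : E)⟫_ℝ) = 0 := by ext i; simp
    rw [this]; simp
  have hn : ‖h‖ ^ 2 ≠ 0 := by simpa using hh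
  -- Gaussian regression on W h: `c i` are the regression coefficients, and the residuals `k' i` are
  -- orthogonal to h, so their images are independent of W h. With the residuals frozen, the
  -- identity reduces to the one-dimensional Stein identity.
  set c : Fin m → ℝ := fun i => ⟪k i, h⟫_ℝ / ‖h‖ ^ 2 with hc
  set k' : Fin m → E := fun i => k i - c i • h with hk'
  have horth : ∀ i, ⟪h, k' i⟫_ℝ = 0 := fun i => by
    simp only [hk', hc, inner_sub_right, inner_smul_right, real_inner_self_eq_norm_sq]
    rw [div_mul_cancel₀ _ hn, real_inner_comm, sub_self]
  have hind := hW.indepFun h k' horth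
  have hdec : ∀ᵐ ω ∂P, (fun i => W (k i) ω) = fun i => c i * W h ω + W (k' i) ω := by
    have : ∀ᵐ ω ∂P, ∀ i, W (k i) ω = c i * W h ω + W (k' i) ω := by
      rw [ae_all_iff]
      intro i
      have e : W (k i) = c i • W h + W (k' i) := by
        rw [← map_smul, ← map_add]; simp [hk']
      rw [e]
      filter_upwards [Lp.coeFn_add (c i • W h) (W (k' i)), Lp.coeFn_smul (c i) (W h)]
        with ω h1 h2
      rw [h1, Pi.add_apply, h2]; simp
    filter_upwards [this] with ω hω
    ext i; exact hω i
  have hYm : Measurable (fun ω i => W (k' i) ω) :=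
    measurable_pi_lambda _ fun i => measurable W (k' i)
  have hXm : Measurable (W h) := measurable W h
  have hlaw := (indepFun_iff_map_prod_eq_prod_map_map hXm.aemeasurable hYm.aemeasurable).1 hind
  rw [hW.map_eq] at hlaw
  set ν := P.map (fun ω i => W (k' i) ω)
  have : IsProbabilityMeasure ν := Measure.isProbabilityMeasure_map hYm.aemeasurable
  set μ := gaussianReal 0 (‖h‖₊ ^ 2)
  have hGc := hG.continuous
  have hGd : Continuous (fderiv ℝ G) := hG.continuous_fderiv (by simp)
  have hpair : Measurable (fun ω => (W h ω, fun i => W (k' i) ω)) := hXm.prodMk hYm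
  have hcm : Continuous (fun z : ℝ × (Fin m → ℝ) => fun i => c i * z.1 + z.2 i) := by fun_prop
  have e1 : ∫ ω, W h ω * G (fun i => W (k i) ω) ∂P
      = ∫ z, z.1 * G (fun i => c i * z.1 + z.2 i) ∂μ.prod ν := by
    have hc1 : Continuous (fun z : ℝ × (Fin m → ℝ) => z.1 * G (fun i => c i * z.1 + z.2 i)) :=
      continuous_fst.mul (hGc.comp hcm)
    rw [← hlaw, integral_map hpair.aemeasurable hc1.aestronglyMeasurable]
    refine integral_congr_ae (hdec.mono fun ω hω => ?_)
    simp only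
    rw [hω]
  have e2 : ∫ ω, fderiv ℝ G (fun i => W (k i) ω) (fun i => ⟪k i, h⟫_ℝ) ∂P
      = ∫ z, fderiv ℝ G (fun i => c i * z.1 + z.2 i) (fun i => ⟪k i, h⟫_ℝ) ∂μ.prod ν := by
    have hc1 : Continuous (fun z : ℝ × (Fin m → ℝ) =>
        fderiv ℝ G (fun i => c i * z.1 + z.2 i) (fun i => ⟪k i, h⟫_ℝ)) :=
      (hGd.comp hcm).clm_apply continuous_const
    rw [← hlaw, integral_map hpair.aemeasurable hc1.aestronglyMeasurable]
    refine integral_congr_ae (hdec.mono fun ω hω => ?_)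
    simp only
    rw [hω]
  have hid : Integrable (fun z : ℝ => z) μ :=
    (memLp_id_gaussianReal (μ := 0) (v := ‖h‖₊ ^ 2) 1).integrable (by simp)
  -- The order of integration is chosen so that the inner integral runs over the value of W h.
  rw [e1, e2, integral_prod_symm, integral_prod_symm]
  · congr 1
    ext y
    have hd : ∀ z : ℝ, HasDerivAt (fun z : ℝ => G (fun i => c i * z + y i))
        (fderiv ℝ G (fun i => c i * z + y i) c) z := fun z => by
      have h1 : HasDerivAt (fun z : ℝ => (fun i => c i * z + y i : Fin m → ℝ)) c z := by
        rw [hasDerivAt_pi]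
        intro i
        simpa using ((hasDerivAt_id z).const_mul (c i)).add_const (y i)
      exact ((hG.differentiable (by simp)).differentiableAt.hasFDerivAt).comp_hasDerivAt z h1
    rw [integral_mul_gaussianReal_zero (M := M) (M' := M' * ‖c‖) hd ?_ (fun x => hM _) ?_]
    · rw [← integral_const_mul]
      congr 1
      ext z
      -- The variance ‖h‖² from Stein's identity cancels the denominator in the regression
      -- coefficients.
      have : (fun i => ⟪k i, h⟫_ℝ) = (‖h‖ ^ 2) • c := by
        ext i; simp only [hc, Pi.smul_apply, smul_eq_mul]; field_simp
      rw [this, map_smul]; simp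
    · have : Continuous fun z : ℝ => (fun i => c i * z + y i : Fin m → ℝ) := by fun_prop
      exact ((hGd.comp this).clm_apply continuous_const).measurable
    · intro x
      refine ((fderiv ℝ G _).le_opNorm c).trans ?_
      gcongr
      exact hM' _
  · refine Integrable.of_bound (C := M' * ‖fun i => ⟪k i, h⟫_ℝ‖)
      ((hGd.comp hcm).clm_apply continuous_const).aestronglyMeasurable (ae_of_all _ fun z => ?_)
    refine ((fderiv ℝ G _).le_opNorm _).trans ?_
    gcongr
    exact hM' _
  · exact (hid.comp_fst ν).mul_bdd (c := M) (hGc.comp hcm).aestronglyMeasurable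
      (ae_of_all _ fun z => hM _)

end IsIsonormal

end Isonormal

/-! ### Smooth functionals and the second-order expansion -/

theorem SmoothFunctional.exists_abs_g_le {E : Type*} (F : SmoothFunctional E) :
    ∃ C, 0 ≤ C ∧ ∀ x, |F.g x| ≤ C := by
  obtain ⟨C, hC⟩ := F.bounded 0
  have h : ∀ x, |F.g x| ≤ C := fun x => by simpa using hC x
  exact ⟨C, (abs_nonneg _).trans (h 0), h⟩

theorem SmoothFunctional.exists_norm_fderiv_le {E : Type*} (F : SmoothFunctional E) :
    ∃ C, 0 ≤ C ∧ ∀ x, ‖fderiv ℝ F.g x‖ ≤ C := by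
  obtain ⟨C, hC⟩ := F.bounded 1
  have h : ∀ x, ‖fderiv ℝ F.g x‖ ≤ C := fun x => by
    have := hC x
    rwa [← norm_iteratedFDeriv_fderiv, norm_iteratedFDeriv_zero] at this
  exact ⟨C, (norm_nonneg _).trans (h 0), h⟩

section SmoothFunctionals

variable {Ω : Type*} [MeasurableSpace Ω] {P : Measure Ω}
variable {E : Type*} [NormedAddCommGroup E] [InnerProductSpace ℝ E]

namespace SmoothFunctional

theorem measurable_val (W : E →L[ℝ] Lp ℝ 2 P) (F : SmoothFunctional E) :
    Measurable (F.val W) :=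
  F.smooth.continuous.measurable.comp
    (measurable_pi_lambda _ fun i => IsIsonormal.measurable W (F.h i))

theorem stronglyMeasurable_D (W : E →L[ℝ] Lp ℝ 2 P) (F : SmoothFunctional E) :
    StronglyMeasurable (F.D W) := by
  unfold D
  refine Finset.stronglyMeasurable_fun_sum _ fun i _ => ?_
  have h1 : Continuous fun x => fderiv ℝ F.g x (Pi.single i 1) :=
    (F.smooth.continuous_fderiv (by simp)).clm_apply continuous_const
  have h2 : Measurable fun ω => fderiv ℝ F.g (fun j => W (F.h j) ω) (Pi.single i 1) :=
    h1.measurable.comp (measurable_pi_lambda _ fun i => IsIsonormal.measurable W (F.h i))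
  exact h2.stronglyMeasurable.smul_const _

theorem exists_norm_D_le (W : E →L[ℝ] Lp ℝ 2 P) (F : SmoothFunctional E) :
    ∃ C, 0 ≤ C ∧ ∀ ω, ‖F.D W ω‖ ≤ C := by
  obtain ⟨C, hC0, hC⟩ := F.exists_norm_fderiv_le
  refine ⟨∑ i, C * ‖(Pi.single i 1 : Fin F.n → ℝ)‖ * ‖F.h i‖,
    Finset.sum_nonneg fun i _ => by positivity, fun ω => ?_⟩
  refine (norm_sum_le _ _).trans (Finset.sum_le_sum fun i _ => ?_)
  rw [norm_smul]
  gcongr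
  refine ((fderiv ℝ F.g _).le_opNorm _).trans ?_
  gcongr
  exact hC _

/-- Brings ⟨DF, h⟩ into the form in which Gaussian integration by parts delivers it: a derivative of
g in the direction of the covariances with W h. -/
theorem inner_D (W : E →L[ℝ] Lp ℝ 2 P) (F : SmoothFunctional E) (h : E) (ω : Ω) :
    ⟪F.D W ω, h⟫_ℝ
      = fderiv ℝ F.g (fun j => W (F.h j) ω) (fun i => ⟪F.h i, h⟫_ℝ) := by
  unfold D
  rw [sum_inner]
  conv_rhs => rw [← Finset.univ_sum_single (fun i => ⟪F.h i, h⟫_ℝ), map_sum]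
  refine Finset.sum_congr rfl fun i _ => ?_
  have : (Pi.single i ⟪F.h i, h⟫_ℝ : Fin F.n → ℝ) = ⟪F.h i, h⟫_ℝ • Pi.single i 1 := by
    rw [← Pi.single_smul]; simp
  rw [real_inner_smul_left, this, map_smul, smul_eq_mul, mul_comm]

end SmoothFunctional

namespace IsIsonormal

variable {W : E →L[ℝ] Lp ℝ 2 P}

/-- Integration by parts against the product of a smooth functional and a function of one
Gaussian variable. -/
theorem integral_mul_val_mul (hW : IsIsonormal W) (F : SmoothFunctional E) {φ φ' : ℝ → ℝ}
    (hφ : ∀ x, HasDerivAt φ (φ' x) x) (hφ' : Continuous φ') {M : ℝ} (hM : ∀ x, |φ x| ≤ M)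
    (hM' : ∀ x, |φ' x| ≤ M) (b h : E) :
    ∫ ω, W h ω * (F.val W ω * φ (W b ω)) ∂P
      = ∫ ω, ⟪F.D W ω, h⟫_ℝ * φ (W b ω) ∂P
        + (∫ ω, F.val W ω * φ' (W b ω) ∂P) * ⟪b, h⟫_ℝ := by
  have := hW.isProbabilityMeasure
  obtain ⟨C₀, hC₀, hC₀'⟩ := F.exists_abs_g_le
  obtain ⟨C₁, hC₁, hC₁'⟩ := F.exists_norm_fderiv_le
  obtain ⟨C₂, hC₂, hC₂'⟩ := F.exists_norm_D_le W
  have hM0 : 0 ≤ M := (abs_nonneg _).trans (hM 0)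
  have hφc : ContDiff ℝ 1 φ := by
    rw [contDiff_one_iff_deriv]
    refine ⟨fun x => (hφ x).differentiableAt, ?_⟩
    rwa [show deriv φ = φ' from funext fun x => (hφ x).deriv]
  -- The variable W b is prepended to those of F, so that F φ(W b) becomes one C¹ function G of n +
  -- 1 Gaussian variables: `π` reads off W b and `τ` the arguments of F.
  let τ : (Fin (F.n + 1) → ℝ) →L[ℝ] (Fin F.n → ℝ) :=
    ContinuousLinearMap.pi fun i => ContinuousLinearMap.proj i.succ
  let π : (Fin (F.n + 1) → ℝ) →L[ℝ] ℝ := ContinuousLinearMap.proj 0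
  let G : (Fin (F.n + 1) → ℝ) → ℝ := fun x => F.g (τ x) * φ (π x)
  have hG : ContDiff ℝ 1 G :=
    ((F.smooth.of_le (by simp)).comp τ.contDiff).mul (hφc.comp π.contDiff)
  have hfd : ∀ x v, fderiv ℝ G x v
      = fderiv ℝ F.g (τ x) (τ v) * φ (π x) + F.g (τ x) * (φ' (π x) * v 0) := fun x v => by
    have h1 : HasFDerivAt (fun x => F.g (τ x)) ((fderiv ℝ F.g (τ x)).comp τ) x :=
      ((F.smooth.differentiable (by simp)).differentiableAt.hasFDerivAt).comp x τ.hasFDerivAt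
    have h2 : HasFDerivAt (fun x => φ (π x)) (φ' (π x) • π) x :=
      (hφ (π x)).comp_hasFDerivAt x π.hasFDerivAt
    have h3 : HasFDerivAt G _ x := h1.mul h2
    rw [h3.fderiv]
    simp [π]; ring
  have hτ : ∀ v, ‖τ v‖ ≤ ‖v‖ := fun v =>
    (pi_norm_le_iff_of_nonneg (norm_nonneg _)).2 fun i => norm_le_pi_norm v _
  have key := hW.integral_mul_comp h (Fin.cons b F.h : Fin (F.n + 1) → E) hG
    (M := C₀ * M) (M' := C₁ * M + C₀ * M) ?_ ?_
  · have e1 : ∀ ω, G (fun i => W ((Fin.cons b F.h : Fin (F.n + 1) → E) i) ω)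
        = F.val W ω * φ (W b ω) := fun ω => rfl
    have e2 : ∀ ω, fderiv ℝ G (fun i => W ((Fin.cons b F.h : Fin (F.n + 1) → E) i) ω)
        (fun i => ⟪(Fin.cons b F.h : Fin (F.n + 1) → E) i, h⟫_ℝ)
        = ⟪F.D W ω, h⟫_ℝ * φ (W b ω) + F.val W ω * φ' (W b ω) * ⟪b, h⟫_ℝ := fun ω => by
      rw [hfd, F.inner_D, ← mul_assoc]; rfl
    simp only [e1, e2] at key
    rw [key, integral_add, integral_mul_const]
    · refine Integrable.of_bound (C := C₂ * ‖h‖ * M)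
        (((F.stronglyMeasurable_D W).inner stronglyMeasurable_const).aestronglyMeasurable.mul
        (hφc.continuous.measurable.comp (measurable W b)).aestronglyMeasurable)
        (ae_of_all _ fun ω => ?_)
      rw [norm_mul]
      refine mul_le_mul ((norm_inner_le_norm _ _).trans ?_) (hM _) (norm_nonneg _) (by positivity)
      gcongr; exact hC₂' _
    · refine Integrable.mul_const (Integrable.of_bound (C := C₀ * M)
        ((F.measurable_val W).mul
        (hφ'.measurable.comp (measurable W b))).aestronglyMeasurable
        (ae_of_all _ fun ω => ?_)) _
      rw [Pi.mul_apply, norm_mul]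
      exact mul_le_mul (hC₀' _) (hM' _) (norm_nonneg _) hC₀
  · intro x
    rw [abs_mul]
    exact mul_le_mul (hC₀' _) (hM _) (abs_nonneg _) hC₀
  · intro x
    refine ContinuousLinearMap.opNorm_le_bound _ (by positivity) fun v => ?_
    rw [hfd, add_mul]
    refine (norm_add_le _ _).trans (add_le_add ?_ ?_)
    · rw [norm_mul, mul_right_comm]
      refine mul_le_mul (((fderiv ℝ F.g _).le_opNorm _).trans ?_) (hM _) (norm_nonneg _)
        (by positivity)
      exact mul_le_mul (hC₁' _) (hτ v) (norm_nonneg _) hC₁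
    · rw [norm_mul, norm_mul, mul_assoc]
      exact mul_le_mul (hC₀' _) (mul_le_mul (hM' _) (norm_le_pi_norm v 0) (norm_nonneg _) hM0)
        (by positivity) hC₀

theorem coeFn_add_smul (W : E →L[ℝ] Lp ℝ 2 P) (a d : E) (θ : ℝ) :
    W (a + θ • d) =ᵐ[P] fun ω => W a ω + θ * W d ω := by
  rw [map_add, map_smul]
  filter_upwards [Lp.coeFn_add (W a) (θ • W d), Lp.coeFn_smul θ (W d)] with ω h1 h2
  rw [h1, Pi.add_apply, h2]; simp

/-- Second order expansion of `E[F f(W(a + d))]` with an intermediate point. -/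
theorem exists_integral_val_mul_sub_eq (hW : IsIsonormal W) (F : SmoothFunctional E)
    {f f₁ f₂ : ℝ → ℝ} (hf : ∀ x, HasDerivAt f (f₁ x) x) (hf₁ : ∀ x, HasDerivAt f₁ (f₂ x) x)
    (hf₂ : Continuous f₂) {M : ℝ} (hM : ∀ x, |f x| ≤ M) (hM₁ : ∀ x, |f₁ x| ≤ M)
    (hM₂ : ∀ x, |f₂ x| ≤ M) (a d : E) :
    ∃ θ ∈ Ioo (0 : ℝ) 1,
      ∫ ω, F.val W ω * f (W (a + d) ω) ∂P - ∫ ω, F.val W ω * f (W a ω) ∂P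
        - (∫ ω, F.val W ω * f₂ (W a ω) ∂P) * ((‖a + d‖ ^ 2 - ‖a‖ ^ 2) / 2)
      = ∫ ω, ⟪F.D W ω, d⟫_ℝ * f₁ (W (a + θ • d) ω) ∂P
        + (∫ ω, F.val W ω * f₂ (W (a + θ • d) ω) ∂P - ∫ ω, F.val W ω * f₂ (W a ω) ∂P)
          * ⟪a + θ • d, d⟫_ℝ := by
  have := hW.isProbabilityMeasure
  obtain ⟨C₀, hC₀, hC₀'⟩ := F.exists_abs_g_le
  have hfc : Continuous f := continuous_iff_continuousAt.2 fun x => (hf x).continuousAt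
  have hf₁c : Continuous f₁ := continuous_iff_continuousAt.2 fun x => (hf₁ x).continuousAt
  set c := ∫ ω, F.val W ω * f₂ (W a ω) ∂P with hc
  -- Interpolation along the segment from a to a + d. It is differentiated in this form, since W a ω
  -- + θ W d ω depends smoothly on θ for every ω, whereas W(a + θd) is only given almost surely for
  -- each θ.
  set q : ℝ → ℝ := fun θ => ∫ ω, F.val W ω * f (W a ω + θ * W d ω) ∂P with hq
  have hq_eq : ∀ θ, q θ = ∫ ω, F.val W ω * f (W (a + θ • d) ω) ∂P := fun θ =>
    integral_congr_ae ((coeFn_add_smul W a d θ).mono fun ω hω => by simp only [hω])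
  have hFm := (F.measurable_val W)
  have hWd : Integrable (W d) P := (memLp W d).integrable (by simp)
  have hlin : ∀ θ : ℝ, Measurable fun ω => W a ω + θ * W d ω := fun θ =>
    (measurable W a).add ((measurable W d).const_mul θ)
  have hqd : ∀ θ, HasDerivAt q
      (∫ ω, W d ω * (F.val W ω * f₁ (W (a + θ • d) ω)) ∂P) θ := fun θ => by
    have h := (hasDerivAt_integral_of_dominated_loc_of_deriv_le (μ := P) (𝕜 := ℝ)
      (F := fun θ ω => F.val W ω * f (W a ω + θ * W d ω))
      (F' := fun θ ω => W d ω * (F.val W ω * f₁ (W a ω + θ * W d ω)))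
      (x₀ := θ) (s := univ) (bound := fun ω => |W d ω| * (C₀ * M)) univ_mem ?_ ?_ ?_ ?_ ?_ ?_).2
    · refine h.congr_deriv (integral_congr_ae ((coeFn_add_smul W a d θ).mono fun ω hω => ?_))
      simp only [hω]
    · exact Eventually.of_forall fun θ =>
        (hFm.mul (hfc.measurable.comp (hlin θ))).aestronglyMeasurable
    · refine Integrable.of_bound (C := C₀ * M)
        (hFm.mul (hfc.measurable.comp (hlin θ))).aestronglyMeasurable (ae_of_all _ fun ω => ?_)
      rw [norm_mul]
      exact mul_le_mul (hC₀' _) (hM _) (norm_nonneg _) hC₀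
    · exact ((measurable W d).mul
        (hFm.mul (hf₁c.measurable.comp (hlin θ)))).aestronglyMeasurable
    · refine ae_of_all _ fun ω x _ => ?_
      rw [norm_mul, norm_mul]
      refine mul_le_mul le_rfl ?_ (by positivity) (abs_nonneg _)
      exact mul_le_mul (hC₀' _) (hM₁ _) (norm_nonneg _) hC₀
    · exact hWd.abs.mul_const _
    · refine ae_of_all _ fun ω x _ => ?_
      have h1 : HasDerivAt (fun θ : ℝ => W a ω + θ * W d ω) (W d ω) x := by
        simpa using ((hasDerivAt_id x).mul_const (W d ω)).const_add (W a ω)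
      refine (((hf _).comp x h1).const_mul (F.val W ω)).congr_deriv ?_
      ring
  have hnd : ∀ θ : ℝ, HasDerivAt (fun θ : ℝ => ‖a + θ • d‖ ^ 2 / 2) ⟪a + θ • d, d⟫_ℝ θ :=
    fun θ => by
    have h1 : HasDerivAt (fun θ : ℝ => a + θ • d) d θ := by
      simpa using ((hasDerivAt_id θ).smul_const d).const_add a
    refine (h1.norm_sq.div_const 2).congr_deriv ?_
    ring
  -- The subtracted multiple of ‖a + θd‖²/2 has derivative c⟨a + θd, d⟩. It compensates the
  -- second-order term of q' up to the variation of f₂ between W a and W(a + θd).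
  have hr : ∀ θ, HasDerivAt (fun θ => q θ - c * (‖a + θ • d‖ ^ 2 / 2)) _ θ := fun θ =>
    (hqd θ).sub ((hnd θ).const_mul c)
  obtain ⟨θ, hθ, h⟩ := exists_hasDerivAt_eq_slope _ _ (zero_lt_one' ℝ)
    (fun θ _ => (hr θ).continuousAt.continuousWithinAt) (fun θ _ => hr θ)
  refine ⟨θ, hθ, ?_⟩
  -- Integration by parts removes the factor W d from q', leaving the pairing with DF and the
  -- second-order term.
  rw [hW.integral_mul_val_mul F hf₁ hf₂ hM₁ hM₂] at h
  rw [hq_eq, hq_eq] at h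
  simp only [one_smul, zero_smul, add_zero, sub_zero, div_one] at h
  linear_combination -h

end IsIsonormal

end SmoothFunctionals

/-! ## The Wiener integral of a bifractional Brownian motion is isonormal -/

theorem integral_abs_le_norm_Lp {Ω : Type*} [MeasurableSpace Ω] {P : Measure Ω}
    [IsProbabilityMeasure P] (X : Lp ℝ 2 P) : ∫ ω, |X ω| ∂P ≤ ‖X‖ := by
  have h1 : ∫ ω, |X ω| ∂P = (eLpNorm X 1 P).toReal := by
    rw [eLpNorm_one_eq_lintegral_enorm,
      ← integral_norm_eq_lintegral_enorm (Lp.aestronglyMeasurable X)]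
    rfl
  rw [h1, Lp.norm_def]
  exact ENNReal.toReal_mono (Lp.eLpNorm_ne_top X)
    (eLpNorm_le_eLpNorm_of_exponent_le (by norm_num) (Lp.aestronglyMeasurable X))

/-- The characteristic function of an element of `L²` depends continuously on it. -/
theorem continuous_charFun_map_Lp {Ω : Type*} [MeasurableSpace Ω] {P : Measure Ω}
    [IsProbabilityMeasure P] (r : ℝ) :
    Continuous fun X : Lp ℝ 2 P => charFun (P.map X) r := by
  have hint : ∀ X : Lp ℝ 2 P, Integrable (fun ω => Complex.exp (r * X ω * Complex.I)) P :=
    fun X => Integrable.of_bound (C := 1)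
      (by have := (Lp.stronglyMeasurable X).measurable; fun_prop)
      (ae_of_all _ fun ω => by
        rw [← Complex.ofReal_mul, Complex.norm_exp_ofReal_mul_I])
  have heq : ∀ X : Lp ℝ 2 P,
      charFun (P.map X) r = ∫ ω, Complex.exp (r * X ω * Complex.I) ∂P := fun X => by
    rw [charFun_apply_real, integral_map (Lp.stronglyMeasurable X).measurable.aemeasurable
      (by fun_prop)]
  refine LipschitzWith.continuous (K := ‖r‖₊) (LipschitzWith.of_dist_le_mul fun X Y => ?_)
  rw [heq, heq, dist_eq_norm, dist_eq_norm, ← integral_sub (hint X) (hint Y)]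
  refine (norm_integral_le_integral_norm _).trans ?_
  have h2 : Integrable (fun ω => |r| * |(X - Y) ω|) P :=
    (((Lp.memLp (X - Y)).integrable (by norm_num)).abs).const_mul _
  refine (integral_mono_ae ((hint X).sub (hint Y)).norm h2 ?_).trans ?_
  · filter_upwards [Lp.coeFn_sub X Y] with ω hω
    rw [hω]
    -- A factor of modulus one is taken out, so that |e^{iy} - 1| ≤ |y| gives the Lipschitz bound.
    have e : Complex.exp (r * X ω * Complex.I) - Complex.exp (r * Y ω * Complex.I)
        = Complex.exp (Complex.I * ↑(r * Y ω)) * (Complex.exp (Complex.I * ↑(r * (X ω - Y ω))) - 1)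
        := by
      rw [mul_sub, ← Complex.exp_add]; push_cast; ring_nf
    change ‖Complex.exp (r * X ω * Complex.I) - Complex.exp (r * Y ω * Complex.I)‖ ≤ _
    rw [e, norm_mul, Complex.norm_exp_I_mul_ofReal, one_mul]
    exact (Real.norm_exp_I_mul_ofReal_sub_one_le).trans (le_of_eq (by
      rw [Real.norm_eq_abs, abs_mul, Pi.sub_apply]))
  · rw [integral_const_mul]
    exact mul_le_mul_of_nonneg_left (integral_abs_le_norm_Lp _) (abs_nonneg r)

namespace IsBifractionalBM

variable {Ω : Type*} [MeasurableSpace Ω] {H K T : ℝ} {B : ℝ → Ω → ℝ} {P : Measure Ω}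

theorem wiener_coe_eq_wienerStep (hB : IsBifractionalBM H K T B P)
    (c : StepSpace hB.posSemidef) : hB.wiener (c : CanonicalHilbert hB.posSemidef)
      = hB.wienerStep c :=
  hB.wiener_coe c

theorem inner_wiener (hB : IsBifractionalBM H K T B P) (h k : CanonicalHilbert hB.posSemidef) :
    ⟪hB.wiener h, hB.wiener k⟫_ℝ = ⟪h, k⟫_ℝ := by
  refine UniformSpace.Completion.induction_on₂ h k
    (isClosed_eq (by fun_prop) (by fun_prop)) fun c d => ?_
  rw [wiener_coe_eq_wienerStep, wiener_coe_eq_wienerStep, LinearIsometry.inner_map_map,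
    UniformSpace.Completion.inner_coe]

theorem wienerFinsupp_coeFn (hB : IsBifractionalBM H K T B P) (c : Icc (0 : ℝ) T →₀ ℝ) :
    hB.wienerFinsupp c =ᵐ[P] fun ω => ∑ t ∈ c.support, c t * B t ω := by
  classical
  unfold wienerFinsupp
  rw [Finsupp.linearCombination_apply, Finsupp.sum]
  induction c.support using Finset.induction_on with
  | empty =>
    simp only [Finset.sum_empty]
    exact Lp.coeFn_zero _ _ _
  | insert a s ha ih =>
    rw [Finset.sum_insert ha]
    filter_upwards [Lp.coeFn_add (c a • (hB.memLp a).toLp (B a))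
      (∑ i ∈ s, c i • (hB.memLp i).toLp (B i)), ih,
      Lp.coeFn_smul (c a) ((hB.memLp a).toLp (B a)), (hB.memLp a).coeFn_toLp] with ω h1 h2 h3 h4
    rw [h1, Pi.add_apply, h2, h3, Finset.sum_insert ha, Pi.smul_apply, h4]
    simp

theorem map_wienerStep (hB : IsBifractionalBM H K T B P) (c : StepSpace hB.posSemidef) :
    P.map (hB.wienerStep c) = gaussianReal 0 (‖c‖₊ ^ 2) := by
  have := hB.gaussian.isProbabilityMeasure
  let c' : Icc (0 : ℝ) T →₀ ℝ := c
  have hcoe : hB.wienerStep c =ᵐ[P] fun ω => ∑ t ∈ c'.support, c' t * B t ω :=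
    hB.wienerFinsupp_coeFn c'
  have hg : HasGaussianLaw (hB.wienerStep c) P := by
    refine HasGaussianLaw.congr ?_ hcoe.symm
    have h1 := (hB.gaussian.hasGaussianLaw c'.support).map_fun
      (∑ i : c'.support, c' i • ContinuousLinearMap.proj (R := ℝ)
        (φ := fun _ : c'.support => ℝ) i)
    refine h1.congr (ae_of_all _ fun ω => ?_)
    simp only [_root_.sum_apply, _root_.smul_apply,
      ContinuousLinearMap.proj_apply, Finset.restrict, smul_eq_mul]
    exact Finset.sum_coe_sort c'.support (fun i => c' i * B i ω)
  have hmean : P[hB.wienerStep c] = 0 := by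
    rw [integral_congr_ae hcoe, integral_finsetSum]
    · refine Finset.sum_eq_zero fun t _ => ?_
      rw [integral_const_mul, hB.centered t t.2, mul_zero]
    · exact fun t _ => ((hB.memLp t).integrable (by norm_num)).const_mul _
  rw [hg.map_eq_gaussianReal, hmean]
  congr 1
  rw [variance_of_integral_eq_zero (Lp.aestronglyMeasurable _).aemeasurable hmean]
  have h2 : ∫ ω, (hB.wienerStep c ω) ^ 2 ∂P = ‖c‖ ^ 2 := by
    rw [← real_inner_self_eq_norm_sq, ← LinearIsometry.inner_map_map hB.wienerStep,
      MeasureTheory.L2.inner_def]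
    congr 1; ext ω; simp [pow_two]
  rw [h2, Real.toNNReal_pow (norm_nonneg _), norm_toNNReal]

/-- On step functions the law is normal because B is a Gaussian process. Both characteristic
functions depend continuously on h, so the equality of laws passes from the dense set of step
functions to the completion. -/
theorem isIsonormal_wiener (hB : IsBifractionalBM H K T B P) : IsIsonormal hB.wiener where
  inner_map := hB.inner_wiener
  map_eq h := by
    have := hB.gaussian.isProbabilityMeasure
    have : IsProbabilityMeasure (P.map (hB.wiener h)) :=
      Measure.isProbabilityMeasure_map (IsIsonormal.aemeasurable _ _)
    refine Measure.ext_of_charFun (funext fun r => ?_)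
    refine UniformSpace.Completion.induction_on h (isClosed_eq
      ((continuous_charFun_map_Lp r).comp hB.wiener.continuous) ?_) fun c => ?_
    · simp only [charFun_gaussianReal]
      push_cast
      fun_prop
    · rw [hB.wiener_coe_eq_wienerStep, hB.map_wienerStep]
      congr 3
      ext
      simp

end IsBifractionalBM

/-! ## Rectangular increments of the covariance -/

/-- The points v and w are convex combinations of u and z with the same two weights interchanged;
the two convexity inequalities are added. -/
theorem ConvexOn.add_le_add_of_add_eq {s : Set ℝ} {g : ℝ → ℝ} (hg : ConvexOn ℝ s g)
    {u v w z : ℝ} (hu : u ∈ s) (hz : z ∈ s) (huv : u ≤ v) (hvz : v ≤ z) (h : v + w = u + z) :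
    g v + g w ≤ g u + g z := by
  rcases eq_or_lt_of_le (huv.trans hvz) with rfl | huz
  · have h1 : v = u := le_antisymm hvz huv
    have h2 : w = u := by linarith
    rw [h1, h2]
  have hd : 0 < z - u := sub_pos.2 huz
  set l := (z - v) / (z - u) with hl
  have hl0 : 0 ≤ l := div_nonneg (by linarith) hd.le
  have hl1 : 0 ≤ 1 - l := by
    rw [hl, sub_nonneg, div_le_one hd]; linarith
  have hlm : l * (z - u) = z - v := div_mul_cancel₀ _ hd.ne'
  have h1 := hg.2 hu hz hl0 hl1 (by ring)
  have h2 := hg.2 hu hz hl1 hl0 (by ring)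
  simp only [smul_eq_mul] at h1 h2
  rw [show l * u + (1 - l) * z = v by linarith] at h1
  rw [show (1 - l) * u + l * z = w by linarith] at h2
  linarith

theorem convexOn_abs_rpow {p : ℝ} (hp : 1 ≤ p) : ConvexOn ℝ univ fun x : ℝ => |x| ^ p := by
  refine ConvexOn.comp (g := fun x : ℝ => x ^ p) (f := fun x : ℝ => |x|) ?_ convexOn_univ_norm ?_
  · refine (convexOn_rpow hp).subset ?_ ?_
    · rintro _ ⟨x, -, rfl⟩; exact abs_nonneg x
    · rw [show (fun x : ℝ => |x|) '' univ = Ici 0 from ?_]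
      · exact convex_Ici 0
      · ext y; constructor
        · rintro ⟨x, -, rfl⟩; exact abs_nonneg x
        · intro hy; exact ⟨y, trivial, abs_of_nonneg hy⟩
  · rintro _ ⟨x, -, rfl⟩ _ ⟨y, -, rfl⟩ hxy
    exact Real.rpow_le_rpow (abs_nonneg _) hxy (by linarith)

/-- Mean value inequality. Since p ≥ 1, the derivative p x^{p-1} stays bounded down to zero; this is
one of the places where 2HK ≥ 1 matters. -/
theorem rpow_sub_rpow_le {p T a b : ℝ} (hp : 1 ≤ p) (ha : 0 ≤ a) (hab : a ≤ b) (hb : b ≤ T) :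
    b ^ p - a ^ p ≤ p * T ^ (p - 1) * (b - a) := by
  refine Convex.image_sub_le_mul_sub_of_deriv_le (convex_Icc 0 T)
    (Real.continuous_rpow_const (by linarith)).continuousOn ?_ ?_ a ⟨ha, hab.trans hb⟩ b
    ⟨ha.trans hab, hb⟩ hab
  · exact fun x hx => (Real.differentiable_rpow_const hp).differentiableAt.differentiableWithinAt
  · intro x hx
    rw [interior_Icc] at hx
    rw [(Real.hasDerivAt_rpow_const (Or.inl hx.1.ne')).deriv]
    have := Real.rpow_le_rpow hx.1.le hx.2.le (by linarith : (0 : ℝ) ≤ p - 1)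
    have hp0 : 0 ≤ p := by linarith
    gcongr

/-- The increment of a kernel over the rectangle `(a, b] × (c, d]`. -/
def rectIncr (R : ℝ → ℝ → ℝ) (a b c d : ℝ) : ℝ := R b d - R b c - R a d + R a c

theorem sum_rectIncr (R : ℝ → ℝ → ℝ) (a b : ℝ) (x : ℕ → ℝ) (n : ℕ) :
    ∑ j ∈ Finset.range n, rectIncr R a b (x j) (x (j + 1)) = rectIncr R a b (x 0) (x n) := by
  induction n with
  | zero => simp [rectIncr]
  | succ n ih => rw [Finset.sum_range_succ, ih]; simp only [rectIncr]; ring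

section

variable {H K T : ℝ}

/-- The rectangular increment is a second difference of the concave function x^K at the sums of the
increasing quantities t^{2H} and s^{2H}; the corner sums with both smaller or both larger
coordinates are the extreme points. -/
theorem rectIncr_rpow_nonpos (hH : 0 < H) (hK : K ∈ Ioc (0 : ℝ) 1) {a b c d : ℝ} (ha : 0 ≤ a)
    (hab : a ≤ b) (hc : 0 ≤ c) (hcd : c ≤ d) :
    rectIncr (fun t s => (t ^ (2 * H) + s ^ (2 * H)) ^ K) a b c d ≤ 0 := by
  have hconv : ConvexOn ℝ (Ici 0) fun x : ℝ => -(x ^ K) :=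
    (Real.concaveOn_rpow hK.1.le hK.2).neg
  have hA : 0 ≤ a ^ (2 * H) := Real.rpow_nonneg ha _
  have hC : 0 ≤ c ^ (2 * H) := Real.rpow_nonneg hc _
  have hAB : a ^ (2 * H) ≤ b ^ (2 * H) := Real.rpow_le_rpow ha hab (by linarith)
  have hCD : c ^ (2 * H) ≤ d ^ (2 * H) := Real.rpow_le_rpow hc hcd (by linarith)
  have := hconv.add_le_add_of_add_eq (u := a ^ (2 * H) + c ^ (2 * H))
    (v := a ^ (2 * H) + d ^ (2 * H)) (w := b ^ (2 * H) + c ^ (2 * H))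
    (z := b ^ (2 * H) + d ^ (2 * H)) (mem_Ici.2 (by linarith)) (mem_Ici.2 (by linarith))
    (by linarith) (by linarith) (by ring)
  simp only [rectIncr]
  linarith

/-- Here the extreme values of t - s occur at the mixed corners a - d and b - c, so convexity of
|x|^p yields the same sign as concavity did for the other part of the kernel. -/
theorem rectIncr_abs_sub_nonpos {p : ℝ} (hp : 1 ≤ p) {a b c d : ℝ} (hab : a ≤ b) (hcd : c ≤ d) :
    rectIncr (fun t s => |t - s| ^ p) a b c d ≤ 0 := by
  have := (convexOn_abs_rpow hp).add_le_add_of_add_eq (u := a - d) (v := a - c) (w := b - d)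
    (z := b - c) trivial trivial (by linarith) (by linarith) (by ring)
  simp only [rectIncr]
  linarith

theorem rectIncr_bifCov (a b c d : ℝ) : rectIncr (bifCov H K) a b c d
    = 1 / (2 : ℝ) ^ K * (rectIncr (fun t s => (t ^ (2 * H) + s ^ (2 * H)) ^ K) a b c d
      - rectIncr (fun t s => |t - s| ^ (2 * H * K)) a b c d) := by
  simp only [rectIncr, bifCov]; ring

/-- The absolute rectangular increments of the covariance along a partition of `[0,t]` are summable
with a bound proportional to the length of the other side. -/
theorem sum_abs_rectIncr_bifCov_le (hH : 0 < H) (hK : K ∈ Ioc (0 : ℝ) 1) (hHK : 1 ≤ 2 * H * K)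
    {a b t : ℝ} (ha : 0 ≤ a) (hab : a ≤ b) (hbt : b ≤ t) (htT : t ≤ T) {x : ℕ → ℝ}
    (hx : Monotone x) (hx0 : x 0 = 0) {n : ℕ} (hxn : x n = t) :
    ∑ j ∈ Finset.range n, |rectIncr (bifCov H K) a b (x j) (x (j + 1))|
      ≤ 3 * (2 * H * K * T ^ (2 * H * K - 1)) * (b - a) := by
  set p := 2 * H * K with hp
  have hxnn : ∀ j, 0 ≤ x j := fun j => hx0 ▸ hx (Nat.zero_le j)
  have h2 : 1 / (2 : ℝ) ^ K ≤ 1 := by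
    rw [div_le_one (by positivity)]
    exact Real.one_le_rpow (by norm_num) hK.1.le
  have h20 : 0 ≤ 1 / (2 : ℝ) ^ K := by positivity
  have hstep : ∀ j, |rectIncr (bifCov H K) a b (x j) (x (j + 1))|
      ≤ -rectIncr (fun t s => (t ^ (2 * H) + s ^ (2 * H)) ^ K) a b (x j) (x (j + 1))
        - rectIncr (fun t s => |t - s| ^ p) a b (x j) (x (j + 1)) := fun j => by
    have h1 := rectIncr_rpow_nonpos hH hK ha hab (hxnn j) (hx j.le_succ)
    have h3 := rectIncr_abs_sub_nonpos hHK hab (hx j.le_succ)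
    rw [rectIncr_bifCov, abs_mul, abs_of_nonneg h20]
    -- The factor 2^{-K} ≤ 1 is dropped, and a difference of two nonpositive numbers is bounded in
    -- absolute value by minus their sum. No absolute values remain, so the sum over j telescopes.
    refine (mul_le_of_le_one_left (abs_nonneg _) h2).trans ?_
    rw [abs_le]
    constructor <;> linarith
  refine (Finset.sum_le_sum fun j _ => hstep j).trans ?_
  rw [Finset.sum_sub_distrib, Finset.sum_neg_distrib, sum_rectIncr, sum_rectIncr, hx0, hxn]
  have hp0 : p ≠ 0 := by linarith
  have hz : (0 : ℝ) ^ (2 * H) = 0 := Real.zero_rpow (by linarith)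
  have hb : 0 ≤ b := ha.trans hab
  have hpow : ∀ y : ℝ, 0 ≤ y → (y ^ (2 * H)) ^ K = y ^ p := fun y hy => by
    rw [← Real.rpow_mul hy]
  have hAB : a ^ (2 * H) ≤ b ^ (2 * H) := Real.rpow_le_rpow ha hab (by linarith)
  -- This difference has the favourable sign and is discarded. What remains is twice b^p - a^p and
  -- once (t-a)^p - (t-b)^p, each at most p T^{p-1} (b - a); hence the factor 3.
  have hmono : (a ^ (2 * H) + t ^ (2 * H)) ^ K ≤ (b ^ (2 * H) + t ^ (2 * H)) ^ K :=
    Real.rpow_le_rpow (add_nonneg (Real.rpow_nonneg ha _)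
      (Real.rpow_nonneg (hb.trans hbt) _)) (by linarith) hK.1.le
  have l1 := rpow_sub_rpow_le hHK ha hab (hbt.trans htT)
  have l2 := rpow_sub_rpow_le (T := T) hHK (sub_nonneg.2 hbt) (sub_le_sub_left hab t)
    (by linarith)
  simp only [rectIncr, hz, add_zero, hpow a ha, hpow b hb, sub_zero, abs_of_nonneg ha,
    abs_of_nonneg hb]
  rw [abs_sub_comm b t, abs_sub_comm a t, abs_of_nonneg (sub_nonneg.2 hbt),
    abs_of_nonneg (sub_nonneg.2 (hab.trans hbt))]
  linarith

end

/-! ## Sums over a partition -/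

/-- Schur's bound for a sum of vectors with a prescribed Gram matrix. -/
theorem norm_sum_sq_le_of_gram {ι V X : Type*} [NormedAddCommGroup X] [InnerProductSpace ℝ X]
    [SeminormedAddCommGroup V] [InnerProductSpace ℝ V] (s : Finset ι) (v : ι → V) (x : ι → X)
    (G : ι → ι → ℝ) (hG : ∀ i j, ⟪v i, v j⟫_ℝ = ⟪x i, x j⟫_ℝ * G i j)
    (hsymm : ∀ i j, G i j = G j i) {δ : ℝ} (hδ : ∀ i ∈ s, ∑ j ∈ s, |G i j| ≤ δ) :
    ‖∑ i ∈ s, v i‖ ^ 2 ≤ δ * ∑ i ∈ s, ‖x i‖ ^ 2 := by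
  have h1 : ‖∑ i ∈ s, v i‖ ^ 2 = ∑ i ∈ s, ∑ j ∈ s, ⟪x i, x j⟫_ℝ * G i j := by
    rw [← real_inner_self_eq_norm_sq, sum_inner]
    simp_rw [inner_sum, hG]
  -- Cauchy–Schwarz and xy ≤ (x² + y²)/2. By the symmetry of |G| the two halves have equal double
  -- sums, each controlled by the row sums.
  have h2 : ∀ i j, ⟪x i, x j⟫_ℝ * G i j ≤ ‖x i‖ ^ 2 * |G i j| / 2 + ‖x j‖ ^ 2 * |G i j| / 2 :=
    fun i j => by
    have e1 : |⟪x i, x j⟫_ℝ * G i j| ≤ ‖x i‖ * ‖x j‖ * |G i j| := by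
      rw [abs_mul]
      exact mul_le_mul_of_nonneg_right (abs_real_inner_le_norm _ _) (abs_nonneg _)
    have e2 : ‖x i‖ * ‖x j‖ * |G i j| ≤ (‖x i‖ ^ 2 + ‖x j‖ ^ 2) / 2 * |G i j| :=
      mul_le_mul_of_nonneg_right (by nlinarith [sq_nonneg (‖x i‖ - ‖x j‖)]) (abs_nonneg _)
    linarith [le_abs_self (⟪x i, x j⟫_ℝ * G i j)]
  have h3 : ∑ i ∈ s, ∑ j ∈ s, ‖x i‖ ^ 2 * |G i j| ≤ δ * ∑ i ∈ s, ‖x i‖ ^ 2 := by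
    rw [Finset.mul_sum]
    refine Finset.sum_le_sum fun i hi => ?_
    rw [← Finset.mul_sum, mul_comm]
    exact mul_le_mul_of_nonneg_right (hδ i hi) (sq_nonneg _)
  have h4 : ∑ i ∈ s, ∑ j ∈ s, ‖x j‖ ^ 2 * |G i j| = ∑ i ∈ s, ∑ j ∈ s, ‖x i‖ ^ 2 * |G i j| := by
    rw [Finset.sum_comm]
    refine Finset.sum_congr rfl fun i _ => Finset.sum_congr rfl fun j _ => ?_
    rw [hsymm]
  rw [h1]
  refine (Finset.sum_le_sum fun i _ => Finset.sum_le_sum fun j _ => h2 i j).trans ?_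
  simp_rw [Finset.sum_add_distrib, ← Finset.sum_div]
  rw [h4]; linarith

/-- Passing from a partition to a finer one. -/
theorem sum_range_eq_sum_refine {M N : Type*} [AddCommGroup M] [AddCommGroup N] (y : ℕ → M →+ N)
    (w : ℕ → M) (n m : ℕ) :
    ∑ i ∈ Finset.range n, y i (w ((i + 1) * m) - w (i * m))
      = ∑ j ∈ Finset.range (n * m), y (j / m) (w (j + 1) - w j) := by
  induction n with
  | zero => simp
  | succ n ih =>
    rw [Finset.sum_range_succ, ih, Nat.succ_mul, Finset.sum_range_add]
    congr 1
    -- All fine indices n·m + j with j < m have the coarse index n, so the coefficient is constant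
    -- there and the increments of `w` telescope.
    have h1 : ∀ j ∈ Finset.range m, y ((n * m + j) / m) (w (n * m + j + 1) - w (n * m + j))
        = y n (w (n * m + j + 1) - w (n * m + j)) := fun j hj => by
      have hj := Finset.mem_range.1 hj
      rw [mul_comm n m, Nat.mul_add_div (by omega), Nat.div_eq_of_lt hj, add_zero]
    rw [Finset.sum_congr rfl h1, ← map_sum]
    congr 1
    exact (Finset.sum_range_sub (fun j => w (n * m + j)) m).symm

/-! ### Gram matrix of the intervals of a uniform partition -/

namespace IsBifractionalBM

variable {Ω : Type*} [MeasurableSpace Ω] {H K T : ℝ} {B : ℝ → Ω → ℝ} {P : Measure Ω}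

/-- The step function `1_{[0,s]}`, with `s` projected to `[0,T]`. -/
noncomputable def pt (hB : IsBifractionalBM H K T B P) (hT : 0 ≤ T) (s : ℝ) :
    StepSpace hB.posSemidef :=
  StepSpace.ind hB.posSemidef (projIcc 0 T hT s)

theorem inner_pt (hB : IsBifractionalBM H K T B P) (hT : 0 ≤ T) {s r : ℝ} (hs : s ∈ Icc 0 T)
    (hr : r ∈ Icc 0 T) : ⟪hB.pt hT s, hB.pt hT r⟫_ℝ = bifCov H K s r := by
  unfold pt
  rw [StepSpace.inner_ind, projIcc_of_mem hT hs, projIcc_of_mem hT hr]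
  rfl

/-- The step function `1_{(a,b]}` for the `i`-th interval of the partition of `[0,t]` into `n`
intervals. -/
noncomputable def incr (hB : IsBifractionalBM H K T B P) (hT : 0 ≤ T) (t : ℝ) (n i : ℕ) :
    StepSpace hB.posSemidef :=
  hB.pt hT (t * (i + 1 : ℕ) / n) - hB.pt hT (t * i / n)

theorem node_mem {t : ℝ} (ht : 0 ≤ t) {n i : ℕ} (hn : 0 < n) (hi : i ≤ n) :
    t * i / n ∈ Icc 0 t := by
  have hn' : (0 : ℝ) < n := by exact_mod_cast hn
  have hi' : (i : ℝ) ≤ n := by exact_mod_cast hi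
  refine ⟨by positivity, ?_⟩
  rw [div_le_iff₀ hn']
  gcongr

theorem inner_incr (hB : IsBifractionalBM H K T B P) (hT : 0 ≤ T) {t : ℝ} (ht : t ∈ Icc 0 T)
    {n i j : ℕ} (hi : i < n) (hj : j < n) :
    ⟪hB.incr hT t n i, hB.incr hT t n j⟫_ℝ
      = rectIncr (bifCov H K) (t * i / n) (t * (i + 1 : ℕ) / n) (t * j / n)
          (t * (j + 1 : ℕ) / n) := by
  have hn : 0 < n := by omega
  have hmem : ∀ k ≤ n, t * (k : ℕ) / n ∈ Icc 0 T := fun k hk =>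
    ⟨(node_mem ht.1 hn hk).1, (node_mem ht.1 hn hk).2.trans ht.2⟩
  have h1 := hmem i hi.le
  have h2 := hmem (i + 1) hi
  have h3 := hmem j hj.le
  have h4 := hmem (j + 1) hj
  simp only [incr, inner_sub_left, inner_sub_right, rectIncr, hB.inner_pt hT h1 h3,
    hB.inner_pt hT h1 h4, hB.inner_pt hT h2 h3, hB.inner_pt hT h2 h4]
  ring

/-- The constant in the bound of the canonical norm of a step function by its `L²` norm. -/
noncomputable def normConst (H K T : ℝ) : ℝ := 3 * (2 * H * K * T ^ (2 * H * K - 1))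

theorem sum_abs_inner_incr_le (hB : IsBifractionalBM H K T B P) (hH : 0 < H)
    (hK : K ∈ Ioc (0 : ℝ) 1) (hHK : 1 ≤ 2 * H * K) (hT : 0 ≤ T) {t : ℝ} (ht : t ∈ Icc 0 T)
    {n i : ℕ} (hi : i < n) :
    ∑ j ∈ Finset.range n, |⟪hB.incr hT t n i, hB.incr hT t n j⟫_ℝ|
      ≤ normConst H K T * (t / n) := by
  have hn : 0 < n := by omega
  have hn' : (0 : ℝ) < n := by exact_mod_cast hn
  have hmono : Monotone fun j : ℕ => t * j / n := fun a b hab => by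
    have : (a : ℝ) ≤ b := by exact_mod_cast hab
    have := ht.1
    simp only
    gcongr
  have := sum_abs_rectIncr_bifCov_le (T := T) hH hK hHK (a := t * i / n)
    (b := t * (i + 1 : ℕ) / n) (t := t) (node_mem ht.1 hn hi.le).1 (hmono i.le_succ)
    (node_mem ht.1 hn hi).2 ht.2 hmono (by simp) (n := n) (by field_simp)
  rw [Finset.sum_congr rfl fun j hj => by rw [hB.inner_incr hT ht hi (Finset.mem_range.1 hj)]]
  refine this.trans (le_of_eq ?_)
  rw [normConst]; push_cast; ring

end IsBifractionalBM

/-- The coarse node of index j / m lies to the left of the fine node of index j; the distance is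
(t/n) times the remainder of j modulo m, divided by m. -/
theorem abs_node_sub_node_le {t : ℝ} (ht : 0 ≤ t) {n m j : ℕ} (hn : 0 < n) (hm : 0 < m) :
    |t * (j / m : ℕ) / n - t * j / (n * m : ℕ)| ≤ t / n := by
  have hn' : (0 : ℝ) < n := by exact_mod_cast hn
  have hm' : (0 : ℝ) < m := by exact_mod_cast hm
  have h1 : ((j / m : ℕ) : ℝ) * m ≤ j := by exact_mod_cast Nat.div_mul_le_self j m
  have h2 : (j : ℝ) ≤ ((j / m : ℕ) : ℝ) * m + m := by
    have := Nat.lt_div_mul_add (a := j) hm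
    exact_mod_cast this.le
  have e : t * (j / m : ℕ) / n - t * j / (n * m : ℕ)
      = -(t / n * ((j - (j / m : ℕ) * m) / m)) := by
    push_cast; field_simp; ring
  rw [e, abs_neg, abs_of_nonneg (mul_nonneg (by positivity) (div_nonneg (by linarith) hm'.le))]
  refine mul_le_of_le_one_right (by positivity) ?_
  rw [div_le_one hm']; linarith

/-! ### Step functions as functions on the line -/

namespace StepSpace

variable {T : ℝ} {R : Matrix (Icc (0 : ℝ) T) (Icc (0 : ℝ) T) ℝ} {hR : R.PosSemidef}

theorem toFun_add (c d : StepSpace hR) (u : ℝ) : (c + d).toFun u = c.toFun u + d.toFun u :=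
  Finsupp.sum_add_index' (M := ℝ) (f := c) (g := d) (fun t => by simp) fun t a b => by ring

theorem toFun_smul (r : ℝ) (c : StepSpace hR) (u : ℝ) : (r • c).toFun u = r * c.toFun u := by
  have h := Finsupp.sum_smul_index (M := ℝ) (R := ℝ) (b := r) (g := c)
    (h := fun t a => a * (Icc (0 : ℝ) t).indicator (fun _ => (1 : ℝ)) u) (fun t => by simp)
  refine h.trans ((Finset.sum_congr rfl fun t _ => mul_assoc _ _ _).trans ?_)
  exact (Finset.mul_sum _ _ _).symm

theorem toFun_sub (c d : StepSpace hR) (u : ℝ) : (c - d).toFun u = c.toFun u - d.toFun u := by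
  have h : c - d = c + (-1 : ℝ) • d := by rw [neg_one_smul, sub_eq_add_neg]
  rw [h, toFun_add, toFun_smul]; ring

theorem toFun_sum {ι : Type*} (s : Finset ι) (c : ι → StepSpace hR) (u : ℝ) :
    (∑ i ∈ s, c i).toFun u = ∑ i ∈ s, (c i).toFun u := by
  classical
  induction s using Finset.induction_on with
  | empty =>
    rw [Finset.sum_empty, Finset.sum_empty]
    exact Finsupp.sum_zero_index
  | insert a s ha ih => rw [Finset.sum_insert ha, Finset.sum_insert ha, toFun_add, ih]

theorem toFun_ind (t : Icc (0 : ℝ) T) (u : ℝ) :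
    (ind hR t).toFun u = (Icc (0 : ℝ) t).indicator (fun _ => (1 : ℝ)) u :=
  (Finsupp.sum_single_index (M := ℝ) (by simp)).trans (one_mul _)

end StepSpace

/-! ### Step sums along a path and their limits -/

namespace IsBifractionalBM

variable {Ω : Type*} [MeasurableSpace Ω] {H K T : ℝ} {B : ℝ → Ω → ℝ} {P : Measure Ω}

theorem continuous_bifCov (hH : 0 < H) (hK : 0 < K) :
    Continuous fun z : ℝ × ℝ => bifCov H K z.1 z.2 := by
  have h1 : Continuous fun x : ℝ => x ^ (2 * H) := Real.continuous_rpow_const (by positivity)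
  have h2 : Continuous fun x : ℝ => x ^ K := Real.continuous_rpow_const hK.le
  have h3 : Continuous fun x : ℝ => x ^ (2 * H * K) := Real.continuous_rpow_const (by positivity)
  unfold bifCov
  exact continuous_const.mul ((h2.comp ((h1.comp continuous_fst).add
    (h1.comp continuous_snd))).sub (h3.comp (continuous_fst.sub continuous_snd).abs))

theorem bifCov_self {s : ℝ} (hs : 0 ≤ s) (hHK : 1 ≤ 2 * H * K) :
    bifCov H K s s = s ^ (2 * H * K) := by
  have h : 2 * H * K ≠ 0 := by linarith
  unfold bifCov
  rw [sub_self, abs_zero, Real.zero_rpow h, sub_zero, ← two_mul,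
    Real.mul_rpow (by norm_num) (Real.rpow_nonneg hs _), ← Real.rpow_mul hs]
  field_simp

theorem bifCov_zero_left (hH : 0 < H) {s : ℝ} (hs : 0 ≤ s) : bifCov H K 0 s = 0 := by
  unfold bifCov
  rw [zero_sub, abs_neg, abs_of_nonneg hs, Real.zero_rpow (by positivity), zero_add,
    ← Real.rpow_mul hs, sub_self, mul_zero]

/-- By polarization the distance is an expression in R, which is continuous. This is needed for the
Malliavin derivative, whose integrand contains 1_{[0,s]}. -/
theorem continuousOn_pt (hB : IsBifractionalBM H K T B P) (hH : 0 < H) (hK : 0 < K)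
    (hT : 0 ≤ T) : ContinuousOn (hB.pt hT) (Icc 0 T) := by
  intro r hr
  rw [ContinuousWithinAt, tendsto_iff_norm_sub_tendsto_zero]
  have h1 : ∀ s ∈ Icc 0 T, ‖hB.pt hT s - hB.pt hT r‖
      = √(bifCov H K s s - 2 * bifCov H K s r + bifCov H K r r) := fun s hs => by
    rw [← hB.inner_pt hT hs hs, ← hB.inner_pt hT hs hr, ← hB.inner_pt hT hr hr,
      real_inner_self_eq_norm_sq, real_inner_self_eq_norm_sq, ← norm_sub_sq_real,
      Real.sqrt_sq (norm_nonneg _)]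
  have hc := continuous_bifCov hH hK
  have h2 : Continuous fun s => √(bifCov H K s s - 2 * bifCov H K s r + bifCov H K r r) :=
    (((hc.comp (continuous_id.prodMk continuous_id)).sub
      ((hc.comp (continuous_id.prodMk continuous_const)).const_mul 2)).add continuous_const).sqrt
  have h3 := (h2.tendsto r).mono_left (nhdsWithin_le_nhds (s := Icc 0 T))
  rw [show bifCov H K r r - 2 * bifCov H K r r + bifCov H K r r = 0 by ring, Real.sqrt_zero] at h3
  exact h3.congr' (eventually_nhdsWithin_of_forall fun s hs => (h1 s hs).symm)

section StepSum

variable {X V : Type*} [NormedAddCommGroup X] [SeminormedAddCommGroup V]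

/-- The sum `∑ᵢ xᵢ ⊗ 1_{(tᵢ, tᵢ₊₁]}` over the partition of `[0,t]` into `n` intervals, for a given
product `τ` of coefficients and step functions. -/
noncomputable def stepSum (hB : IsBifractionalBM H K T B P) (hT : 0 ≤ T)
    (τ : X →+ StepSpace hB.posSemidef →+ V) (t : ℝ) (n : ℕ) (x : ℕ → X) : V :=
  ∑ i ∈ Finset.range n, τ (x i) (hB.incr hT t n i)

/-- The sum `∑ᵢ φ(tᵢ) ⊗ 1_{(tᵢ, tᵢ₊₁]}`. -/
noncomputable def pathSum (hB : IsBifractionalBM H K T B P) (hT : 0 ≤ T)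
    (τ : X →+ StepSpace hB.posSemidef →+ V) (t : ℝ) (n : ℕ) (φ : ℝ → X) : V :=
  hB.stepSum hT τ t n fun i => φ (t * i / n)

/-- Lets partitions into n and into m intervals be compared on their common refinement into n·m
intervals. -/
theorem stepSum_refine (hB : IsBifractionalBM H K T B P) (hT : 0 ≤ T)
    (τ : X →+ StepSpace hB.posSemidef →+ V) (t : ℝ) (n : ℕ) {m : ℕ} (hm : 0 < m) (x : ℕ → X) :
    hB.stepSum hT τ t n x = hB.stepSum hT τ t (n * m) fun j => x (j / m) := by
  unfold stepSum incr
  have h := sum_range_eq_sum_refine (fun i => τ (x i))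
    (fun j => hB.pt hT (t * j / (n * m : ℕ))) n m
  rw [← h]
  have hm' : (m : ℝ) ≠ 0 := by exact_mod_cast hm.ne'
  have e : ∀ i : ℕ, t * (i : ℝ) / n = t * (i * m : ℕ) / (n * m : ℕ) := fun i => by
    push_cast; rw [← mul_assoc, mul_div_mul_right _ _ hm']
  refine Finset.sum_congr rfl fun i _ => ?_
  rw [e i, e (i + 1)]

variable [InnerProductSpace ℝ X] [InnerProductSpace ℝ V]

/-- Schur's test with the row sums of the Gram matrix: the canonical norm is bounded by a discrete
L² norm. Only the multiplicativity `hτ` of inner products is used, so the estimate serves both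
scalar coefficients and coefficients in the canonical space, with values in the tensor product. -/
theorem norm_stepSum_sq_le (hB : IsBifractionalBM H K T B P) (hH : 0 < H)
    (hK : K ∈ Ioc (0 : ℝ) 1) (hHK : 1 ≤ 2 * H * K) (hT : 0 ≤ T) {t : ℝ} (ht : t ∈ Icc 0 T)
    {τ : X →+ StepSpace hB.posSemidef →+ V}
    (hτ : ∀ x y u v, ⟪τ x u, τ y v⟫_ℝ = ⟪x, y⟫_ℝ * ⟪u, v⟫_ℝ) (n : ℕ) (x : ℕ → X) :
    ‖hB.stepSum hT τ t n x‖ ^ 2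
      ≤ normConst H K T * (t / n) * ∑ i ∈ Finset.range n, ‖x i‖ ^ 2 :=
  norm_sum_sq_le_of_gram _ _ x (fun i j => ⟪hB.incr hT t n i, hB.incr hT t n j⟫_ℝ)
    (fun _ _ => hτ _ _ _ _) (fun _ _ => real_inner_comm _ _) fun _ hi =>
    hB.sum_abs_inner_incr_le hH hK hHK hT ht (Finset.mem_range.1 hi)

theorem normConst_nonneg (hHK : 1 ≤ 2 * H * K) (hT : 0 ≤ T) : 0 ≤ normConst H K T := by
  unfold normConst
  have := Real.rpow_nonneg hT (2 * H * K - 1)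
  have : 0 ≤ 2 * H * K := by linarith
  positivity

theorem norm_stepSum_sq_le_of_le (hB : IsBifractionalBM H K T B P) (hH : 0 < H)
    (hK : K ∈ Ioc (0 : ℝ) 1) (hHK : 1 ≤ 2 * H * K) (hT : 0 ≤ T) {t : ℝ} (ht : t ∈ Icc 0 T)
    {τ : X →+ StepSpace hB.posSemidef →+ V}
    (hτ : ∀ x y u v, ⟪τ x u, τ y v⟫_ℝ = ⟪x, y⟫_ℝ * ⟪u, v⟫_ℝ) {n : ℕ} {x : ℕ → X} {ε : ℝ}
    (hx : ∀ i < n, ‖x i‖ ≤ ε) :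
    ‖hB.stepSum hT τ t n x‖ ^ 2 ≤ normConst H K T * t * ε ^ 2 := by
  refine (hB.norm_stepSum_sq_le hH hK hHK hT ht hτ n x).trans ?_
  rcases Nat.eq_zero_or_pos n with rfl | hn
  · simp only [Finset.range_zero, Finset.sum_empty, mul_zero]
    exact mul_nonneg (mul_nonneg (normConst_nonneg hHK hT) ht.1) (sq_nonneg _)
  have hn' : (0 : ℝ) < n := by exact_mod_cast hn
  have h1 : ∑ i ∈ Finset.range n, ‖x i‖ ^ 2 ≤ n * ε ^ 2 := by
    refine (Finset.sum_le_card_nsmul _ _ (ε ^ 2) fun i hi => ?_).trans (by simp)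
    exact pow_le_pow_left₀ (norm_nonneg _) (hx i (Finset.mem_range.1 hi)) 2
  calc normConst H K T * (t / n) * ∑ i ∈ Finset.range n, ‖x i‖ ^ 2
      ≤ normConst H K T * (t / n) * (n * ε ^ 2) :=
        mul_le_mul_of_nonneg_left h1 (mul_nonneg (normConst_nonneg hHK hT)
          (div_nonneg ht.1 hn'.le))
    _ = _ := by field_simp

theorem norm_stepSum_sub_sq_le (hB : IsBifractionalBM H K T B P) (hH : 0 < H)
    (hK : K ∈ Ioc (0 : ℝ) 1) (hHK : 1 ≤ 2 * H * K) (hT : 0 ≤ T) {t : ℝ} (ht : t ∈ Icc 0 T)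
    {τ : X →+ StepSpace hB.posSemidef →+ V}
    (hτ : ∀ x y u v, ⟪τ x u, τ y v⟫_ℝ = ⟪x, y⟫_ℝ * ⟪u, v⟫_ℝ) {n m : ℕ} (hn : 0 < n) (hm : 0 < m)
    {x y : ℕ → X} {ε : ℝ} (hxy : ∀ j < n * m, ‖x (j / m) - y (j / n)‖ ≤ ε) :
    ‖hB.stepSum hT τ t n x - hB.stepSum hT τ t m y‖ ^ 2 ≤ normConst H K T * t * ε ^ 2 := by
  rw [hB.stepSum_refine hT τ t n hm x, hB.stepSum_refine hT τ t m hn y, mul_comm m n]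
  have : hB.stepSum hT τ t (n * m) (fun j => x (j / m))
      - hB.stepSum hT τ t (n * m) (fun j => y (j / n))
      = hB.stepSum hT τ t (n * m) (fun j => x (j / m) - y (j / n)) := by
    simp only [stepSum, map_sub, AddMonoidHom.sub_apply, Finset.sum_sub_distrib]
  rw [this]
  exact hB.norm_stepSum_sq_le_of_le hH hK hHK hT ht hτ hxy

/-- The sampled path may vary with n, as long as it converges uniformly. This is used for
derivatives of mollified functions, where mesh and mollifier change together. Only the Cauchy
property is claimed, since V need not be complete. -/
theorem cauchySeq_pathSum (hB : IsBifractionalBM H K T B P) (hH : 0 < H)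
    (hK : K ∈ Ioc (0 : ℝ) 1) (hHK : 1 ≤ 2 * H * K) (hT : 0 ≤ T) {t : ℝ} (ht : t ∈ Icc 0 T)
    {τ : X →+ StepSpace hB.posSemidef →+ V}
    (hτ : ∀ x y u v, ⟪τ x u, τ y v⟫_ℝ = ⟪x, y⟫_ℝ * ⟪u, v⟫_ℝ) {φ : ℕ → ℝ → X} {ψ : ℝ → X}
    (hφ : TendstoUniformlyOn φ ψ atTop (Icc 0 t)) (hψ : ContinuousOn ψ (Icc 0 t)) :
    CauchySeq fun n => hB.pathSum hT τ t n (φ n) := by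
  rw [Metric.cauchySeq_iff]
  intro ε hε
  set C := normConst H K T * t with hC
  have hC0 : 0 ≤ C := mul_nonneg (normConst_nonneg hHK hT) ht.1
  -- Dividing by C + 1 rather than C covers the case C = 0.
  obtain ⟨η, hη, hηε⟩ : ∃ η > 0, C * η ^ 2 < ε ^ 2 := by
    refine ⟨ε / (C + 1), by positivity, ?_⟩
    rw [div_pow, mul_div_assoc', div_lt_iff₀ (by positivity)]
    nlinarith [sq_nonneg C, pow_pos hε 2]
  have huc := (isCompact_Icc.uniformContinuousOn_of_continuous hψ)
  rw [Metric.uniformContinuousOn_iff] at huc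
  obtain ⟨d, hd, hdψ⟩ := huc (η / 3) (by positivity)
  have h1 := (Metric.tendstoUniformlyOn_iff.1 hφ) (η / 3) (by positivity)
  have h2 : ∀ᶠ n : ℕ in atTop, t / n < d / 2 :=
    (tendsto_const_div_atTop_nhds_zero_nat t).eventually_lt_const (by positivity)
  obtain ⟨N, hN⟩ := eventually_atTop.1 ((h1.and h2).and (eventually_gt_atTop 0))
  refine ⟨N, fun n hn m hm => ?_⟩
  obtain ⟨⟨hn1, hn2⟩, hn0⟩ := hN n hn
  obtain ⟨⟨hm1, hm2⟩, hm0⟩ := hN m hm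
  have key := hB.norm_stepSum_sub_sq_le hH hK hHK hT ht hτ hn0 hm0
    (x := fun i => φ n (t * i / n)) (y := fun i => φ m (t * i / m)) (ε := η) fun j hj => by
    have hs := node_mem ht.1 hn0 (i := j / m) (Nat.div_le_of_le_mul (by rw [mul_comm]; exact hj.le))
    have hr := node_mem ht.1 hm0 (i := j / n) (Nat.div_le_of_le_mul hj.le)
    have d1 := abs_node_sub_node_le ht.1 hn0 hm0 (j := j)
    have d2 := abs_node_sub_node_le ht.1 hm0 hn0 (j := j)
    rw [mul_comm m n] at d2
    have d3 : dist (t * (j / m : ℕ) / n) (t * (j / n : ℕ) / m) < d := by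
      rw [Real.dist_eq]
      -- Both coarse nodes are compared with the fine node of index j: the distances are at most t/n
      -- and t/m, each less than d/2.
      have := abs_sub_le (t * (j / m : ℕ) / n) (t * j / (n * m : ℕ)) (t * (j / n : ℕ) / m)
      rw [abs_sub_comm (t * j / (n * m : ℕ))] at this
      linarith
    have e1 := hn1 _ hs
    have e2 := hm1 _ hr
    have e3 := hdψ _ hs _ hr d3
    rw [← dist_eq_norm]
    have e4 := dist_triangle4 (φ n (t * (j / m : ℕ) / n)) (ψ (t * (j / m : ℕ) / n))
      (ψ (t * (j / n : ℕ) / m)) (φ m (t * (j / n : ℕ) / m))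
    rw [dist_comm (φ n (t * (j / m : ℕ) / n)) (ψ _)] at e4
    linarith
  rw [dist_eq_norm]
  exact lt_of_pow_lt_pow_left₀ 2 hε.le (key.trans_lt hηε)

end StepSum

/-- The product of scalars and step functions, in the canonical Hilbert space. -/
noncomputable def smulHom (hB : IsBifractionalBM H K T B P) :
    ℝ →+ StepSpace hB.posSemidef →+ StepSpace hB.posSemidef :=
  smulAddHom ℝ (StepSpace hB.posSemidef)

theorem inner_smulHom (hB : IsBifractionalBM H K T B P) (x y : ℝ)
    (u v : StepSpace hB.posSemidef) :
    ⟪hB.smulHom x u, hB.smulHom y v⟫_ℝ = ⟪x, y⟫_ℝ * ⟪u, v⟫_ℝ := by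
  change ⟪x • u, y • v⟫_ℝ = _
  rw [real_inner_smul_left, real_inner_smul_right, ← mul_assoc]
  congr 1
  simp [mul_comm]

/-- The tensor product of vectors and step functions. -/
noncomputable def tmulHom (hB : IsBifractionalBM H K T B P) :
    CanonicalHilbert hB.posSemidef →+ StepSpace hB.posSemidef →+
      CanonicalHilbert hB.posSemidef ⊗[ℝ] CanonicalHilbert hB.posSemidef where
  toFun x :=
    { toFun := fun u => x ⊗ₜ (u : CanonicalHilbert hB.posSemidef)
      map_zero' := by rw [UniformSpace.Completion.coe_zero, TensorProduct.tmul_zero]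
      map_add' := fun u v => by rw [UniformSpace.Completion.coe_add, TensorProduct.tmul_add] }
  map_zero' := by ext u; simp
  map_add' x y := by ext u; simp [TensorProduct.add_tmul]

theorem inner_tmulHom (hB : IsBifractionalBM H K T B P) (x y : CanonicalHilbert hB.posSemidef)
    (u v : StepSpace hB.posSemidef) :
    ⟪hB.tmulHom x u, hB.tmulHom y v⟫_ℝ = ⟪x, y⟫_ℝ * ⟪u, v⟫_ℝ := by
  change ⟪x ⊗ₜ[ℝ] (u : CanonicalHilbert hB.posSemidef),
    y ⊗ₜ[ℝ] (v : CanonicalHilbert hB.posSemidef)⟫_ℝ = _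
  rw [TensorProduct.inner_tmul, UniformSpace.Completion.inner_coe]

/-- The element of the canonical Hilbert space represented by `φ 1_{(0,t]}`, as the limit of
step functions. -/
noncomputable def pathElem (hB : IsBifractionalBM H K T B P) (hT : 0 ≤ T) (t : ℝ) (φ : ℝ → ℝ) :
    CanonicalHilbert hB.posSemidef :=
  limUnder atTop fun n =>
    ((hB.pathSum hT hB.smulHom t n φ : StepSpace hB.posSemidef) : CanonicalHilbert hB.posSemidef)

theorem tendsto_pathSum (hB : IsBifractionalBM H K T B P) (hH : 0 < H)
    (hK : K ∈ Ioc (0 : ℝ) 1) (hHK : 1 ≤ 2 * H * K) (hT : 0 ≤ T) {t : ℝ} (ht : t ∈ Icc 0 T)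
    {φ : ℝ → ℝ} (hφ : ContinuousOn φ (Icc 0 t)) :
    Tendsto (fun n => ((hB.pathSum hT hB.smulHom t n φ : StepSpace hB.posSemidef) :
        CanonicalHilbert hB.posSemidef)) atTop
      (𝓝 (hB.pathElem hT t φ)) := by
  have h := hB.cauchySeq_pathSum hH hK hHK hT ht hB.inner_smulHom
    (φ := fun _ => φ) (ψ := φ) (by
      rw [Metric.tendstoUniformlyOn_iff]
      exact fun ε hε => Eventually.of_forall fun _ x _ => by simpa using hε) hφ
  have h2 : CauchySeq fun n =>
      ((hB.pathSum hT hB.smulHom t n φ : StepSpace hB.posSemidef) :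
        CanonicalHilbert hB.posSemidef) :=
    h.map (UniformSpace.Completion.uniformContinuous_coe _)
  exact h2.tendsto_limUnder

theorem toFun_pt (hB : IsBifractionalBM H K T B P) (hT : 0 ≤ T) {s : ℝ} (hs : s ∈ Icc 0 T)
    (u : ℝ) : (hB.pt hT s).toFun u = (Icc (0 : ℝ) s).indicator (fun _ => (1 : ℝ)) u := by
  rw [pt, StepSpace.toFun_ind, projIcc_of_mem hT hs]

theorem toFun_incr (hB : IsBifractionalBM H K T B P) (hT : 0 ≤ T) {t : ℝ} (ht : t ∈ Icc 0 T)
    {n i : ℕ} (hi : i < n) (u : ℝ) : (hB.incr hT t n i).toFun u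
      = (Ioc (t * i / n) (t * (i + 1 : ℕ) / n)).indicator (fun _ => (1 : ℝ)) u := by
  have hn : 0 < n := by omega
  have hmem : ∀ k ≤ n, t * (k : ℕ) / n ∈ Icc 0 T := fun k hk =>
    ⟨(node_mem ht.1 hn hk).1, (node_mem ht.1 hn hk).2.trans ht.2⟩
  have hle : t * i / n ≤ t * (i + 1 : ℕ) / n := by
    have := ht.1
    push_cast; gcongr; linarith
  have h0 := (hmem i hi.le).1
  rw [incr, StepSpace.toFun_sub, hB.toFun_pt hT (hmem i hi.le), hB.toFun_pt hT (hmem (i + 1) hi)]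
  simp only [indicator_apply, mem_Icc, mem_Ioc]
  split_ifs <;> grind

/-- At u ∈ (0,t] only the interval containing u contributes, and its left endpoint is within t/n of
u; elsewhere both functions vanish. -/
theorem abs_toFun_pathSum_sub_le (hB : IsBifractionalBM H K T B P) (hT : 0 ≤ T) {t : ℝ}
    (ht : t ∈ Icc 0 T) {n : ℕ} (hn : 0 < n) {φ : ℝ → ℝ} {ε : ℝ}
    (hφ : ∀ s ∈ Icc 0 t, ∀ r ∈ Icc 0 t, |s - r| ≤ t / n → |φ s - φ r| ≤ ε) (u : ℝ) :
    |(hB.pathSum hT hB.smulHom t n φ).toFun u - (Ioc 0 t).indicator φ u| ≤ ε := by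
  have hn' : (0 : ℝ) < n := by exact_mod_cast hn
  have hε : 0 ≤ ε := by
    have := hφ 0 ⟨le_rfl, ht.1⟩ 0 ⟨le_rfl, ht.1⟩ (by
      rw [sub_self, abs_zero]; exact div_nonneg ht.1 hn'.le)
    simpa using this
  have hmem : ∀ k ≤ n, t * (k : ℕ) / n ∈ Icc 0 T := fun k hk =>
    ⟨(node_mem ht.1 hn hk).1, (node_mem ht.1 hn hk).2.trans ht.2⟩
  have htel : ∑ i ∈ Finset.range n, (hB.incr hT t n i).toFun u
      = (Ioc 0 t).indicator (fun _ => (1 : ℝ)) u := by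
    rw [← StepSpace.toFun_sum]
    unfold incr
    rw [Finset.sum_range_sub (fun i : ℕ => hB.pt hT (t * i / n)), StepSpace.toFun_sub,
      hB.toFun_pt hT (hmem n le_rfl), hB.toFun_pt hT (hmem 0 hn.le)]
    rw [mul_div_cancel_right₀ _ hn'.ne']
    have := ht.1
    simp only [indicator_apply, mem_Icc, mem_Ioc, Nat.cast_zero, mul_zero, zero_div]
    split_ifs <;> grind
  have h1 : (hB.pathSum hT hB.smulHom t n φ).toFun u
      = ∑ i ∈ Finset.range n, φ (t * i / n) * (hB.incr hT t n i).toFun u := by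
    unfold pathSum stepSum
    rw [StepSpace.toFun_sum]
    exact Finset.sum_congr rfl fun i _ => StepSpace.toFun_smul _ _ _
  -- The intervals partition (0,t], so φ(u) can be distributed over them and compared with the step
  -- function term by term.
  have h2 : (Ioc 0 t).indicator φ u
      = ∑ i ∈ Finset.range n, φ u * (hB.incr hT t n i).toFun u := by
    rw [← Finset.mul_sum, htel]
    simp [indicator_apply]
  rw [h1, h2, ← Finset.sum_sub_distrib]
  calc |∑ i ∈ Finset.range n, (φ (t * i / n) * (hB.incr hT t n i).toFun u
          - φ u * (hB.incr hT t n i).toFun u)|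
      ≤ ∑ i ∈ Finset.range n, ε * (hB.incr hT t n i).toFun u := by
        refine (Finset.abs_sum_le_sum_abs _ _).trans (Finset.sum_le_sum fun i hi => ?_)
        have hi' := Finset.mem_range.1 hi
        rw [hB.toFun_incr hT ht hi']
        by_cases hu : u ∈ Ioc (t * i / n) (t * (i + 1 : ℕ) / n)
        · simp only [indicator_of_mem hu, mul_one]
          have m1 := node_mem ht.1 hn hi'.le
          have m2 := node_mem ht.1 hn (i := i + 1) hi'
          refine hφ _ m1 _ ⟨m1.1.trans hu.1.le, hu.2.trans m2.2⟩ ?_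
          rw [abs_sub_comm, abs_of_nonneg (by linarith [hu.1])]
          have : t * (i + 1 : ℕ) / n = t * i / n + t / n := by push_cast; ring
          linarith [hu.2]
        · rw [indicator_of_notMem hu]; simp
    _ = ε * (Ioc 0 t).indicator (fun _ => (1 : ℝ)) u := by rw [← Finset.mul_sum, htel]
    _ ≤ ε := by
        refine mul_le_of_le_one_right hε ?_
        simp only [indicator_apply]
        split_ifs <;> norm_num

/-- The step functions whose limit defines the element converge uniformly, hence in L²([0,T]), to φ
1_{(0,t]}. -/
theorem represents_pathElem (hB : IsBifractionalBM H K T B P) (hH : 0 < H)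
    (hK : K ∈ Ioc (0 : ℝ) 1) (hHK : 1 ≤ 2 * H * K) (hT : 0 ≤ T) {t : ℝ} (ht : t ∈ Icc 0 T)
    {φ : ℝ → ℝ} (hφ : ContinuousOn φ (Icc 0 t)) :
    Represents (hB.pathElem hT t φ) ((Ioc 0 t).indicator φ) := by
  refine ⟨fun n => hB.pathSum hT hB.smulHom t n φ, ?_,
    hB.tendsto_pathSum hH hK hHK hT ht hφ⟩
  rw [ENNReal.tendsto_nhds_zero]
  intro ε hε
  obtain ⟨η, hη, hηε⟩ : ∃ η : NNReal, 0 < η ∧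
      (volume.restrict (Icc 0 T)) univ ^ (2 : ℝ≥0∞).toReal⁻¹ * η ≤ ε := by
    have hfin : (volume.restrict (Icc 0 T)) univ ^ (2 : ℝ≥0∞).toReal⁻¹ ≠ ∞ :=
      ENNReal.rpow_ne_top_of_nonneg (by positivity) (measure_ne_top _ _)
    have := ENNReal.Tendsto.const_mul (a := (volume.restrict (Icc 0 T)) univ ^ (2 : ℝ≥0∞).toReal⁻¹)
      (f := 𝓝[>] (0 : NNReal)) (m := fun x => (x : ℝ≥0∞)) (b := 0)
      ((ENNReal.continuous_coe.tendsto 0).mono_left nhdsWithin_le_nhds) (Or.inr hfin)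
    rw [mul_zero] at this
    obtain ⟨η, h1, h2⟩ := ((this.eventually_le_const hε).and self_mem_nhdsWithin).exists
    exact ⟨η, h2, h1⟩
  have huc := (isCompact_Icc.uniformContinuousOn_of_continuous hφ)
  rw [Metric.uniformContinuousOn_iff] at huc
  obtain ⟨d, hd, hdφ⟩ := huc η hη
  have h2 : ∀ᶠ n : ℕ in atTop, t / n < d :=
    (tendsto_const_div_atTop_nhds_zero_nat t).eventually_lt_const hd
  filter_upwards [h2, eventually_gt_atTop 0] with n hn hn0
  refine (eLpNorm_le_of_ae_bound (C := η) (ae_of_all _ fun u => ?_)).trans ?_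
  · exact hB.abs_toFun_pathSum_sub_le hT ht hn0 (fun s hs r hr hsr =>
      (hdφ s hs r hr (hsr.trans_lt hn)).le) u
  · simpa using hηε

end IsBifractionalBM

/-! ## Riemann sums along a continuous path -/

/-- On a uniform partition of mesh tending to zero, a continuous function of a continuous path
oscillates little on each interval. -/
theorem eventually_abs_comp_sub_le {t : ℝ} (ht : 0 ≤ t) {b g : ℝ → ℝ}
    (hb : ContinuousOn b (Icc 0 t)) (hg : Continuous g) {ε : ℝ} (hε : 0 < ε) :
    ∀ᶠ n : ℕ in atTop, 0 < n ∧ ∀ θ ∈ Icc (0 : ℝ) 1, ∀ i < n,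
      |g (b (t * i / n) + θ * (b (t * (i + 1 : ℕ) / n) - b (t * i / n))) - g (b (t * i / n))|
        ≤ ε := by
  obtain ⟨R, hR⟩ := (isCompact_Icc.image_of_continuousOn hb).isBounded.subset_closedBall 0
  have hbR : ∀ s ∈ Icc 0 t, |b s| ≤ R := fun s hs => by
    simpa using hR (mem_image_of_mem b hs)
  have hg' := (isCompact_Icc (a := -R) (b := R)).uniformContinuousOn_of_continuous hg.continuousOn
  rw [Metric.uniformContinuousOn_iff] at hg'
  obtain ⟨d, hd, hdg⟩ := hg' ε hε
  have hb' := isCompact_Icc.uniformContinuousOn_of_continuous hb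
  rw [Metric.uniformContinuousOn_iff] at hb'
  obtain ⟨e, he, heb⟩ := hb' d hd
  have h2 : ∀ᶠ n : ℕ in atTop, t / n < e :=
    (tendsto_const_div_atTop_nhds_zero_nat t).eventually_lt_const he
  filter_upwards [h2, eventually_gt_atTop 0] with n hn hn0
  refine ⟨hn0, fun θ hθ i hi => ?_⟩
  have m1 := IsBifractionalBM.node_mem ht hn0 hi.le
  have m2 := IsBifractionalBM.node_mem ht hn0 (i := i + 1) hi
  have e1 : t * (i + 1 : ℕ) / n - t * i / n = t / n := by push_cast; ring
  have e2 := heb _ m2 _ m1 (by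
    rw [Real.dist_eq, e1, abs_of_nonneg (div_nonneg ht (Nat.cast_nonneg n))]; exact hn)
  rw [Real.dist_eq] at e2
  set x := b (t * i / n)
  set y := b (t * (i + 1 : ℕ) / n)
  have hx := abs_le.1 (hbR _ m1)
  have hy := abs_le.1 (hbR _ m2)
  refine (hdg (x + θ * (y - x)) ⟨?_, ?_⟩ x hx ?_).le
  · nlinarith [hθ.1, hθ.2, mul_le_mul_of_nonneg_left hy.1 hθ.1,
      mul_le_mul_of_nonneg_left hx.1 (sub_nonneg.2 hθ.2)]
  · nlinarith [hθ.1, hθ.2, mul_le_mul_of_nonneg_left hy.2 hθ.1,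
      mul_le_mul_of_nonneg_left hx.2 (sub_nonneg.2 hθ.2)]
  · rw [Real.dist_eq, add_sub_cancel_left, abs_mul, abs_of_nonneg hθ.1]
    exact (mul_le_of_le_one_left (abs_nonneg _) hθ.2).trans_lt e2

/-- Riemann–Stieltjes sums with respect to `s ^ p`. -/
theorem tendsto_sum_mul_rpow_sub {t p : ℝ} (ht : 0 ≤ t) (hp : 1 ≤ p) {φ : ℝ → ℝ}
    (hφ : ContinuousOn φ (Icc 0 t)) :
    Tendsto (fun n : ℕ => ∑ i ∈ Finset.range n,
      φ (t * i / n) * ((t * (i + 1 : ℕ) / n) ^ p - (t * i / n) ^ p)) atTop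
      (𝓝 (p * ∫ s in (0 : ℝ)..t, φ s * s ^ (p - 1))) := by
  have hpc : Continuous fun s : ℝ => s ^ (p - 1) := Real.continuous_rpow_const (by linarith)
  rw [Metric.tendsto_atTop']
  intro ε hε
  set η := ε / (t ^ p + 1) with hη
  have htp : 0 ≤ t ^ p := Real.rpow_nonneg ht _
  have hη0 : 0 < η := by positivity
  have huc := isCompact_Icc.uniformContinuousOn_of_continuous hφ
  rw [Metric.uniformContinuousOn_iff] at huc
  obtain ⟨d, hd, hdφ⟩ := huc η hη0
  have h2 : ∀ᶠ n : ℕ in atTop, t / n < d :=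
    (tendsto_const_div_atTop_nhds_zero_nat t).eventually_lt_const hd
  obtain ⟨N, hN⟩ := eventually_atTop.1 (h2.and (eventually_gt_atTop 0))
  refine ⟨N, fun n hn => ?_⟩
  obtain ⟨hn1, hn0⟩ := hN n hn.le
  have hn' : (0 : ℝ) < n := by exact_mod_cast hn0
  have hnode : ∀ i : ℕ, t * i / n ≤ t * (i + 1 : ℕ) / n := fun i => by
    push_cast; gcongr; linarith
  have hsub : ∀ i < n, Icc (t * i / n) (t * (i + 1 : ℕ) / n) ⊆ Icc 0 t := fun i hi =>
    Icc_subset_Icc (IsBifractionalBM.node_mem ht hn0 hi.le).1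
      (IsBifractionalBM.node_mem ht hn0 (i := i + 1) hi).2
  have hint : ∀ i < n, IntervalIntegrable (fun s => φ s * s ^ (p - 1)) volume (t * i / n)
      (t * (i + 1 : ℕ) / n) := fun i hi => by
    refine ContinuousOn.intervalIntegrable ?_
    rw [uIcc_of_le (hnode i)]
    exact (hφ.mono (hsub i hi)).mul hpc.continuousOn
  have hpow : ∀ a b : ℝ, ∫ s in a..b, s ^ (p - 1) = (b ^ p - a ^ p) / p := fun a b => by
    rw [integral_rpow (Or.inl (by linarith)), sub_add_cancel]
  have htotal : ∫ s in (0 : ℝ)..t, φ s * s ^ (p - 1)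
      = ∑ i ∈ Finset.range n, ∫ s in (t * i / n)..(t * (i + 1 : ℕ) / n), φ s * s ^ (p - 1) := by
    rw [intervalIntegral.sum_integral_adjacent_intervals (a := fun i : ℕ => t * i / n) hint]
    simp [mul_div_cancel_right₀ _ hn'.ne']
  have hp0 : 0 < p := by linarith
  have hstep : ∀ i ∈ Finset.range n,
      |φ (t * i / n) * ((t * (i + 1 : ℕ) / n) ^ p - (t * i / n) ^ p)
        - p * ∫ s in (t * i / n)..(t * (i + 1 : ℕ) / n), φ s * s ^ (p - 1)|
      ≤ η * ((t * (i + 1 : ℕ) / n) ^ p - (t * i / n) ^ p) := fun i hi => by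
    have hi := Finset.mem_range.1 hi
    -- The weight of the Stieltjes sum is itself the integral of p s^{p-1} over the interval, so the
    -- error is the integral of an oscillation of φ against a nonnegative density of total mass t^p.
    have e1 : (t * (i + 1 : ℕ) / n) ^ p - (t * i / n) ^ p
        = p * ∫ s in (t * i / n)..(t * (i + 1 : ℕ) / n), s ^ (p - 1) := by
      rw [hpow]; field_simp
    have hi1 : IntervalIntegrable (fun s : ℝ => s ^ (p - 1)) volume (t * i / n)
      (t * (i + 1 : ℕ) / n) := hpc.intervalIntegrable _ _
    have e2 : φ (t * i / n) * ((t * (i + 1 : ℕ) / n) ^ p - (t * i / n) ^ p)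
        - p * ∫ s in (t * i / n)..(t * (i + 1 : ℕ) / n), φ s * s ^ (p - 1)
        = p * ∫ s in (t * i / n)..(t * (i + 1 : ℕ) / n), (φ (t * i / n) - φ s) * s ^ (p - 1) := by
      rw [e1]
      simp_rw [sub_mul]
      rw [intervalIntegral.integral_sub (hi1.const_mul _) (hint i hi),
        intervalIntegral.integral_const_mul]
      ring
    rw [e2, e1, abs_mul, abs_of_pos hp0, ← mul_assoc, mul_comm η p, mul_assoc,
      ← intervalIntegral.integral_const_mul]
    refine mul_le_mul_of_nonneg_left ?_ hp0.le
    rw [← Real.norm_eq_abs]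
    refine intervalIntegral.norm_integral_le_of_norm_le (g := fun s => η * s ^ (p - 1)) (hnode i)
      (ae_of_all _ fun s hs => ?_) (hi1.const_mul _)
    have m1 := hsub i hi ⟨le_rfl, hnode i⟩
    have m2 := hsub i hi ⟨hs.1.le, hs.2⟩
    rw [norm_mul, Real.norm_of_nonneg (Real.rpow_nonneg m2.1 _)]
    refine mul_le_mul_of_nonneg_right ?_ (Real.rpow_nonneg m2.1 _)
    rw [← dist_eq_norm]
    refine (hdφ _ m1 _ m2 ?_).le
    rw [Real.dist_eq, abs_sub_comm, abs_of_nonneg (by linarith [hs.1])]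
    have : t * (i + 1 : ℕ) / n = t * i / n + t / n := by push_cast; ring
    linarith [hs.2]
  rw [Real.dist_eq, htotal, Finset.mul_sum, ← Finset.sum_sub_distrib]
  calc _ ≤ ∑ i ∈ Finset.range n, η * ((t * (i + 1 : ℕ) / n) ^ p - (t * i / n) ^ p) :=
        (Finset.abs_sum_le_sum_abs _ _).trans (Finset.sum_le_sum hstep)
    _ = η * t ^ p := by
        rw [← Finset.mul_sum, Finset.sum_range_sub (fun i : ℕ => (t * i / n) ^ p)]
        rw [mul_div_cancel_right₀ _ hn'.ne']
        simp [Real.zero_rpow hp0.ne']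
    _ < ε := by
        rw [hη, div_mul_eq_mul_div, div_lt_iff₀ (by positivity)]
        nlinarith

/-! ### The expansion over one interval of the partition -/

namespace IsBifractionalBM

variable {Ω : Type*} [MeasurableSpace Ω] {H K T : ℝ} {B : ℝ → Ω → ℝ} {P : Measure Ω}

/-- Up to 1_{[0,0]}, the vector 1_{[0,tᵢ]} is the sum of the earlier increments. The inner product
is thus dominated by a partial row sum of the Gram matrix, the factor θ ≤ 1 affecting only the
diagonal entry. -/
theorem abs_inner_pt_add_smul_incr_le (hB : IsBifractionalBM H K T B P) (hH : 0 < H)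
    (hK : K ∈ Ioc (0 : ℝ) 1) (hHK : 1 ≤ 2 * H * K) (hT : 0 ≤ T) {t : ℝ} (ht : t ∈ Icc 0 T)
    {n i : ℕ} (hi : i < n) {θ : ℝ} (hθ : θ ∈ Icc (0 : ℝ) 1) :
    |⟪hB.pt hT (t * i / n) + θ • hB.incr hT t n i, hB.incr hT t n i⟫_ℝ|
      ≤ normConst H K T * (t / n) := by
  have hn : 0 < n := by omega
  have hmem : ∀ k ≤ n, t * (k : ℕ) / n ∈ Icc 0 T := fun k hk =>
    ⟨(node_mem ht.1 hn hk).1, (node_mem ht.1 hn hk).2.trans ht.2⟩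
  -- The generator 1_{[0,0]} is a formal basis vector, not zero in the step space, but it is
  -- orthogonal to everything because R(0,s) = 0.
  have h0 : ⟪hB.pt hT 0, hB.incr hT t n i⟫_ℝ = 0 := by
    have m := hmem 0 hn.le
    rw [Nat.cast_zero, mul_zero, zero_div] at m
    rw [incr, inner_sub_right, hB.inner_pt hT m (hmem i hi.le), hB.inner_pt hT m (hmem (i + 1) hi),
      bifCov_zero_left hH (hmem i hi.le).1, bifCov_zero_left hH (hmem (i + 1) hi).1, sub_zero]
  have h1 : hB.pt hT (t * i / n) = hB.pt hT 0 + ∑ j ∈ Finset.range i, hB.incr hT t n j := by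
    unfold incr
    rw [Finset.sum_range_sub (fun i : ℕ => hB.pt hT (t * i / n))]
    simp
  rw [h1, inner_add_left, inner_add_left, h0, zero_add, sum_inner, real_inner_smul_left]
  refine le_trans ?_ (hB.sum_abs_inner_incr_le hH hK hHK hT ht hi)
  calc _ ≤ ∑ j ∈ Finset.range i, |⟪hB.incr hT t n j, hB.incr hT t n i⟫_ℝ|
        + |⟪hB.incr hT t n i, hB.incr hT t n i⟫_ℝ| := by
        refine (abs_add_le _ _).trans (add_le_add (Finset.abs_sum_le_sum_abs _ _) ?_)
        rw [abs_mul, abs_of_nonneg hθ.1]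
        exact mul_le_of_le_one_left (abs_nonneg _) hθ.2
    _ = ∑ j ∈ Finset.range (i + 1), |⟪hB.incr hT t n i, hB.incr hT t n j⟫_ℝ| := by
        rw [Finset.sum_range_succ]
        simp_rw [real_inner_comm]
    _ ≤ _ := Finset.sum_le_sum_of_subset_of_nonneg
        (Finset.range_subset_range.2 hi) fun _ _ _ => abs_nonneg _

theorem coe_stepSum (hB : IsBifractionalBM H K T B P) (hT : 0 ≤ T) (t : ℝ) (n : ℕ) (x : ℕ → ℝ) :
    ((hB.stepSum hT hB.smulHom t n x : StepSpace hB.posSemidef) : CanonicalHilbert hB.posSemidef)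
      = ∑ i ∈ Finset.range n, x i • (hB.incr hT t n i : CanonicalHilbert hB.posSemidef) := by
  have h := map_sum (UniformSpace.Completion.toComplL (𝕜 := ℝ) (E := StepSpace hB.posSemidef))
    (fun i => x i • hB.incr hT t n i) (Finset.range n)
  refine h.trans (Finset.sum_congr rfl fun i _ => ?_)
  rw [map_smul]; rfl

theorem wiener_pt (hB : IsBifractionalBM H K T B P) (hT : 0 ≤ T) {s : ℝ} (hs : s ∈ Icc 0 T) :
    hB.wiener (hB.pt hT s : CanonicalHilbert hB.posSemidef) =ᵐ[P] B s := by
  rw [pt, projIcc_of_mem hT hs]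
  exact hB.wiener_ind ⟨s, hs⟩

theorem norm_pt_sq (hB : IsBifractionalBM H K T B P) (hHK : 1 ≤ 2 * H * K)
    (hT : 0 ≤ T) {s : ℝ} (hs : s ∈ Icc 0 T) : ‖hB.pt hT s‖ ^ 2 = s ^ (2 * H * K) := by
  rw [← real_inner_self_eq_norm_sq, hB.inner_pt hT hs hs, bifCov_self hs.1 hHK]

/-- Expansion of `E[F f(B_t)]` over one interval of the partition. -/
theorem exists_expansion (hB : IsBifractionalBM H K T B P) (hH : 0 < H)
    (hK : K ∈ Ioc (0 : ℝ) 1) (hHK : 1 ≤ 2 * H * K) (hT : 0 ≤ T) {t : ℝ} (ht : t ∈ Icc 0 T)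
    (F : SmoothFunctional (CanonicalHilbert hB.posSemidef)) {f f₁ f₂ : ℝ → ℝ}
    (hf : ∀ x, HasDerivAt f (f₁ x) x) (hf₁ : ∀ x, HasDerivAt f₁ (f₂ x) x)
    (hf₂ : Continuous f₂) {M : ℝ} (hM : ∀ x, |f x| ≤ M) (hM₁ : ∀ x, |f₁ x| ≤ M)
    (hM₂ : ∀ x, |f₂ x| ≤ M) {n i : ℕ} (hi : i < n) :
    ∃ θ ∈ Icc (0 : ℝ) 1, ∃ κ : ℝ, |κ| ≤ normConst H K T * (t / n) ∧
      ∫ ω, F.val hB.wiener ω * f (B (t * (i + 1 : ℕ) / n) ω) ∂P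
        - ∫ ω, F.val hB.wiener ω * f (B (t * i / n) ω) ∂P
      = (∫ ω, F.val hB.wiener ω * f₂ (B (t * i / n) ω) ∂P)
          * (((t * (i + 1 : ℕ) / n) ^ (2 * H * K) - (t * i / n) ^ (2 * H * K)) / 2)
        + ∫ ω, ⟪F.D hB.wiener ω, (hB.incr hT t n i : CanonicalHilbert hB.posSemidef)⟫_ℝ
          * f₁ (B (t * i / n) ω + θ * (B (t * (i + 1 : ℕ) / n) ω - B (t * i / n) ω)) ∂P
        + (∫ ω, F.val hB.wiener ω
            * f₂ (B (t * i / n) ω + θ * (B (t * (i + 1 : ℕ) / n) ω - B (t * i / n) ω)) ∂P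
          - ∫ ω, F.val hB.wiener ω * f₂ (B (t * i / n) ω) ∂P) * κ := by
  have hn : 0 < n := by omega
  have hmem : ∀ k ≤ n, t * (k : ℕ) / n ∈ Icc 0 T := fun k hk =>
    ⟨(node_mem ht.1 hn hk).1, (node_mem ht.1 hn hk).2.trans ht.2⟩
  have m1 := hmem i hi.le
  have m2 := hmem (i + 1) hi
  set a : CanonicalHilbert hB.posSemidef := ↑(hB.pt hT (t * i / n)) with ha
  set d : CanonicalHilbert hB.posSemidef := ↑(hB.incr hT t n i) with hd
  have had : a + d = ↑(hB.pt hT (t * (i + 1 : ℕ) / n)) := by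
    rw [ha, hd, ← UniformSpace.Completion.coe_add, incr, add_sub_cancel]
  obtain ⟨θ, hθ, h⟩ := hB.isIsonormal_wiener.exists_integral_val_mul_sub_eq F hf hf₁ hf₂ hM hM₁ hM₂
    a d
  have hθ' : θ ∈ Icc (0 : ℝ) 1 := Ioo_subset_Icc_self hθ
  have ea : hB.wiener a =ᵐ[P] B (t * i / n) := hB.wiener_pt hT m1
  have eb : hB.wiener (a + d) =ᵐ[P] B (t * (i + 1 : ℕ) / n) := by
    rw [had]; exact hB.wiener_pt hT m2
  have eθ : hB.wiener (a + θ • d) =ᵐ[P]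
      fun ω => B (t * i / n) ω + θ * (B (t * (i + 1 : ℕ) / n) ω - B (t * i / n) ω) := by
    -- The case θ = 1 identifies W d with the increment of B.
    have e1 := IsIsonormal.coeFn_add_smul hB.wiener a d 1
    rw [one_smul] at e1
    filter_upwards [IsIsonormal.coeFn_add_smul hB.wiener a d θ, ea, eb, e1] with ω h1 h2 h3 h4
    rw [h1, ← h2, ← h3, h4]; ring
  refine ⟨θ, hθ', ⟪a + θ • d, d⟫_ℝ, ?_, ?_⟩
  · rw [ha, hd, ← UniformSpace.Completion.coe_smul, ← UniformSpace.Completion.coe_add,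
      UniformSpace.Completion.inner_coe]
    exact hB.abs_inner_pt_add_smul_incr_le hH hK hHK hT ht hi hθ'
  · have na : ‖a‖ ^ 2 = (t * i / n) ^ (2 * H * K) := by
      rw [ha, UniformSpace.Completion.norm_coe, hB.norm_pt_sq hHK hT m1]
    have nb : ‖a + d‖ ^ 2 = (t * (i + 1 : ℕ) / n) ^ (2 * H * K) := by
      rw [had, UniformSpace.Completion.norm_coe, hB.norm_pt_sq hHK hT m2]
    rw [na, nb] at h
    have c1 : ∀ g : ℝ → ℝ, ∫ ω, F.val hB.wiener ω * g (hB.wiener a ω) ∂P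
        = ∫ ω, F.val hB.wiener ω * g (B (t * i / n) ω) ∂P := fun g =>
      integral_congr_ae (ea.mono fun ω hω => by simp only [hω])
    have c2 : ∀ g : ℝ → ℝ, ∫ ω, F.val hB.wiener ω * g (hB.wiener (a + d) ω) ∂P
        = ∫ ω, F.val hB.wiener ω * g (B (t * (i + 1 : ℕ) / n) ω) ∂P := fun g =>
      integral_congr_ae (eb.mono fun ω hω => by simp only [hω])
    have c3 : ∀ g : ℝ → ℝ, ∀ G : Ω → ℝ, ∫ ω, G ω * g (hB.wiener (a + θ • d) ω) ∂P
        = ∫ ω, G ω * g (B (t * i / n) ω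
          + θ * (B (t * (i + 1 : ℕ) / n) ω - B (t * i / n) ω)) ∂P := fun g G =>
      integral_congr_ae (eθ.mono fun ω hω => by simp only [hω])
    rw [c1, c1, c2, c3 f₂, c3 f₁] at h
    linarith

end IsBifractionalBM

/-! ### The integrand, the correction term, and duality for bounded functions -/

namespace IsBifractionalBM

variable {Ω : Type*} [MeasurableSpace Ω] {H K T : ℝ} {B : ℝ → Ω → ℝ} {P : Measure Ω}

/-- The remainder `f(B_t) - f(0) - HK ∫₀ᵗ f''(B_s) s^{2HK-1} ds` in Itô's formula. -/
noncomputable def itoDiv (H K : ℝ) (B : ℝ → Ω → ℝ) (f f₂ : ℝ → ℝ) (t : ℝ) (ω : Ω) : ℝ :=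
  f (B t ω) - f 0 - H * K * ∫ s in (0 : ℝ)..t, f₂ (B s ω) * s ^ (2 * H * K - 1)

/-- The random element `g(B) 1_{(0,t]}` of the canonical Hilbert space. -/
noncomputable def compElem (hB : IsBifractionalBM H K T B P) (hT : 0 ≤ T) (t : ℝ) (g : ℝ → ℝ)
    (ω : Ω) : CanonicalHilbert hB.posSemidef :=
  hB.pathElem hT t fun s => g (B s ω)

/-- Riemann–Stieltjes sums of `HK ∫₀ᵗ g(B_s) s^{2HK-1} ds`. -/
noncomputable def corrSum (H K : ℝ) (B : ℝ → Ω → ℝ) (g : ℝ → ℝ) (t : ℝ) (n : ℕ) (ω : Ω) : ℝ :=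
  ∑ i ∈ Finset.range n, g (B (t * i / n) ω)
    * (((t * (i + 1 : ℕ) / n) ^ (2 * H * K) - (t * i / n) ^ (2 * H * K)) / 2)

theorem ae_continuousOn_comp (hB : IsBifractionalBM H K T B P) {t : ℝ} (ht : t ∈ Icc 0 T)
    {g : ℝ → ℝ} (hg : Continuous g) :
    ∀ᵐ ω ∂P, ContinuousOn (fun s => g (B s ω)) (Icc 0 t) :=
  hB.continuous.mono fun _ hω =>
    hg.comp_continuousOn (hω.mono (Icc_subset_Icc le_rfl ht.2))

theorem ae_tendsto_corrSum (hB : IsBifractionalBM H K T B P) (hHK : 1 ≤ 2 * H * K) {t : ℝ}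
    (ht : t ∈ Icc 0 T) {g : ℝ → ℝ} (hg : Continuous g) :
    ∀ᵐ ω ∂P, Tendsto (fun n => corrSum H K B g t n ω) atTop
      (𝓝 (H * K * ∫ s in (0 : ℝ)..t, g (B s ω) * s ^ (2 * H * K - 1))) := by
  filter_upwards [hB.ae_continuousOn_comp ht hg] with ω hω
  have h := (tendsto_sum_mul_rpow_sub ht.1 hHK hω).div_const 2
  rw [show ∀ x : ℝ, 2 * H * K * x / 2 = H * K * x from fun x => by ring] at h
  refine h.congr fun n => ?_
  rw [corrSum, Finset.sum_div]
  exact Finset.sum_congr rfl fun i _ => by ring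

theorem node_mem_T {t : ℝ} (ht : t ∈ Icc 0 T) {n i : ℕ} (hn : 0 < n) (hi : i ≤ n) :
    t * i / n ∈ Icc 0 T :=
  ⟨(node_mem ht.1 hn hi).1, (node_mem ht.1 hn hi).2.trans ht.2⟩

theorem measurable_sigma (hB : IsBifractionalBM H K T B P) {s : ℝ} (hs : s ∈ Icc 0 T) :
    Measurable[hB.sigma] (B s) :=
  (comap_measurable (B s)).mono (le_iSup (fun t : Icc (0 : ℝ) T =>
    MeasurableSpace.comap (B t) inferInstance) ⟨s, hs⟩) le_rfl

theorem sigma_le (hB : IsBifractionalBM H K T B P) : hB.sigma ≤ ‹MeasurableSpace Ω› :=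
  iSup_le fun t => (hB.measurable t t.2).comap_le

theorem measurable_corrSum (hB : IsBifractionalBM H K T B P) {t : ℝ} (ht : t ∈ Icc 0 T)
    {g : ℝ → ℝ} (hg : Continuous g) (n : ℕ) : Measurable[hB.sigma] (corrSum H K B g t n) := by
  unfold corrSum
  refine Finset.measurable_fun_sum _ fun i hi => ?_
  have hi := Finset.mem_range.1 hi
  exact (hg.measurable.comp (hB.measurable_sigma
    (node_mem_T ht (by omega : 0 < n) hi.le))).mul_const _

/-- The correction term is almost surely the limit of sums measurable with respect to the σ-algebra
of B; their limsup is everywhere defined and provides the required version. -/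
theorem aestronglyMeasurable_sigma_itoDiv (hB : IsBifractionalBM H K T B P) (hHK : 1 ≤ 2 * H * K)
    {t : ℝ} (ht : t ∈ Icc 0 T) {f f₂ : ℝ → ℝ} (hf : Continuous f) (hf₂ : Continuous f₂) :
    AEStronglyMeasurable[hB.sigma] (itoDiv H K B f f₂ t) P := by
  refine AEStronglyMeasurable.sub ?_ ?_
  · have : Measurable[hB.sigma] fun ω => f (B t ω) - f 0 :=
      (hf.measurable.comp (hB.measurable_sigma ht)).sub_const _
    exact this.stronglyMeasurable.aestronglyMeasurable
  · have h : Measurable[hB.sigma] fun ω => limsup (fun n => corrSum H K B f₂ t n ω) atTop :=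
      Measurable.limsup fun n => hB.measurable_corrSum ht hf₂ n
    exact ⟨_, h.stronglyMeasurable,
      (hB.ae_tendsto_corrSum hHK ht hf₂).mono fun ω hω => hω.limsup_eq.symm⟩

theorem stronglyMeasurable_stepSum (hB : IsBifractionalBM H K T B P) (hT : 0 ≤ T) (t : ℝ) (n : ℕ)
    {x : ℕ → Ω → ℝ} (hx : ∀ i < n, Measurable (x i)) :
    StronglyMeasurable fun ω => ((hB.stepSum hT hB.smulHom t n fun i => x i ω :
      StepSpace hB.posSemidef) : CanonicalHilbert hB.posSemidef) := by
  simp_rw [hB.coe_stepSum]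
  exact Finset.stronglyMeasurable_fun_sum _ fun i hi =>
    (hx i (Finset.mem_range.1 hi)).stronglyMeasurable.smul_const _

theorem stronglyMeasurable_pathSum (hB : IsBifractionalBM H K T B P) (hT : 0 ≤ T) {t : ℝ}
    (ht : t ∈ Icc 0 T) {g : ℝ → ℝ} (hg : Continuous g) (n : ℕ) :
    StronglyMeasurable fun ω => ((hB.pathSum hT hB.smulHom t n fun s => g (B s ω) :
      StepSpace hB.posSemidef) : CanonicalHilbert hB.posSemidef) :=
  hB.stronglyMeasurable_stepSum hT t n (x := fun i ω => g (B (t * i / n) ω)) fun i hi =>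
    hg.measurable.comp (hB.measurable _ (node_mem_T ht (by omega) hi.le))

theorem ae_tendsto_compElem (hB : IsBifractionalBM H K T B P) (hH : 0 < H)
    (hK : K ∈ Ioc (0 : ℝ) 1) (hHK : 1 ≤ 2 * H * K) (hT : 0 ≤ T) {t : ℝ} (ht : t ∈ Icc 0 T)
    {g : ℝ → ℝ} (hg : Continuous g) :
    ∀ᵐ ω ∂P, Tendsto (fun n => ((hB.pathSum hT hB.smulHom t n fun s => g (B s ω) :
      StepSpace hB.posSemidef) : CanonicalHilbert hB.posSemidef)) atTop
      (𝓝 (hB.compElem hT t g ω)) :=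
  (hB.ae_continuousOn_comp ht hg).mono fun _ hω => hB.tendsto_pathSum hH hK hHK hT ht hω

theorem aestronglyMeasurable_compElem (hB : IsBifractionalBM H K T B P) (hH : 0 < H)
    (hK : K ∈ Ioc (0 : ℝ) 1) (hHK : 1 ≤ 2 * H * K) (hT : 0 ≤ T) {t : ℝ} (ht : t ∈ Icc 0 T)
    {g : ℝ → ℝ} (hg : Continuous g) : AEStronglyMeasurable (hB.compElem hT t g) P :=
  aestronglyMeasurable_of_tendsto_ae atTop
    (fun n => (hB.stronglyMeasurable_pathSum hT ht hg n).aestronglyMeasurable)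
    (hB.ae_tendsto_compElem hH hK hHK hT ht hg)

/-- The coefficients need not be values of the path; it suffices that they are uniformly close to
them. This absorbs the intermediate points of the mean value theorem and, later, mollified
functions. -/
theorem tendsto_stepSum_of_close (hB : IsBifractionalBM H K T B P) (hH : 0 < H)
    (hK : K ∈ Ioc (0 : ℝ) 1) (hHK : 1 ≤ 2 * H * K) (hT : 0 ≤ T) {t : ℝ} (ht : t ∈ Icc 0 T)
    {φ : ℝ → ℝ} (hφ : ContinuousOn φ (Icc 0 t)) {x : ℕ → ℕ → ℝ}
    (hx : ∀ ε > 0, ∀ᶠ n in atTop, ∀ i < n, |x n i - φ (t * i / n)| ≤ ε) :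
    Tendsto (fun n => ((hB.stepSum hT hB.smulHom t n (x n) : StepSpace hB.posSemidef) :
      CanonicalHilbert hB.posSemidef)) atTop (𝓝 (hB.pathElem hT t φ)) := by
  have h0 : Tendsto (fun n => hB.stepSum hT hB.smulHom t n (x n)
      - hB.pathSum hT hB.smulHom t n φ) atTop (𝓝 0) := by
    rw [Metric.tendsto_atTop']
    intro ε hε
    set C := normConst H K T * t with hC
    have hC0 : 0 ≤ C := mul_nonneg (normConst_nonneg hHK hT) ht.1
    obtain ⟨N, hN⟩ := eventually_atTop.1 (hx (ε / (C + 1)) (by positivity))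
    refine ⟨N, fun n hn => ?_⟩
    rw [dist_zero_right]
    have e : hB.stepSum hT hB.smulHom t n (x n) - hB.pathSum hT hB.smulHom t n φ
        = hB.stepSum hT hB.smulHom t n (fun i => x n i - φ (t * i / n)) := by
      simp only [pathSum, stepSum, map_sub, AddMonoidHom.sub_apply, Finset.sum_sub_distrib]
    rw [e]
    have h1 := hB.norm_stepSum_sq_le_of_le hH hK hHK hT ht hB.inner_smulHom
      (x := fun i => x n i - φ (t * i / n)) (hN n hn.le)
    refine lt_of_pow_lt_pow_left₀ 2 hε.le (h1.trans_lt ?_)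
    rw [← hC, div_pow, mul_div_assoc', div_lt_iff₀ (by positivity)]
    nlinarith [sq_nonneg C, pow_pos hε 2]
  have h1 := ((UniformSpace.Completion.continuous_coe _).tendsto _).comp h0
  have h2 := h1.add (hB.tendsto_pathSum hH hK hHK hT ht hφ)
  rw [UniformSpace.Completion.coe_zero, zero_add] at h2
  refine h2.congr fun n => ?_
  rw [Function.comp_apply, ← UniformSpace.Completion.coe_add, sub_add_cancel]

theorem sum_rpow_node (hHK : 1 ≤ 2 * H * K) (t : ℝ) {n : ℕ} (hn : 0 < n) :
    ∑ i ∈ Finset.range n, ((t * (i + 1 : ℕ) / n) ^ (2 * H * K) - (t * i / n) ^ (2 * H * K))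
      = t ^ (2 * H * K) := by
  have hn' : (n : ℝ) ≠ 0 := by exact_mod_cast hn.ne'
  rw [Finset.sum_range_sub (fun i : ℕ => (t * i / n) ^ (2 * H * K)), mul_div_cancel_right₀ _ hn']
  simp [Real.zero_rpow (by linarith : 2 * H * K ≠ 0)]

theorem rpow_node_nonneg (hHK : 1 ≤ 2 * H * K) {t : ℝ} (ht : 0 ≤ t) (n i : ℕ) :
    0 ≤ (t * (i + 1 : ℕ) / n) ^ (2 * H * K) - (t * i / n) ^ (2 * H * K) := by
  rw [sub_nonneg]
  refine Real.rpow_le_rpow (by positivity) ?_ (by linarith)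
  push_cast; gcongr; linarith

theorem abs_corrSum_le {Ω : Type*} {B : ℝ → Ω → ℝ} (hHK : 1 ≤ 2 * H * K) {t : ℝ} (ht : 0 ≤ t)
    {g : ℝ → ℝ} {M : ℝ}
    (hM : ∀ x, |g x| ≤ M) (n : ℕ) (ω : Ω) :
    |corrSum H K B g t n ω| ≤ M * (t ^ (2 * H * K) / 2) := by
  have hM0 : 0 ≤ M := (abs_nonneg _).trans (hM 0)
  rcases Nat.eq_zero_or_pos n with rfl | hn
  · simp only [corrSum, Finset.range_zero, Finset.sum_empty, abs_zero]
    have := Real.rpow_nonneg ht (2 * H * K)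
    positivity
  rw [← sum_rpow_node hHK t hn, Finset.sum_div, Finset.mul_sum]
  refine (Finset.abs_sum_le_sum_abs _ _).trans (Finset.sum_le_sum fun i _ => ?_)
  have := rpow_node_nonneg hHK ht n i
  rw [abs_mul, abs_of_nonneg (by linarith :
    0 ≤ ((t * (i + 1 : ℕ) / n) ^ (2 * H * K) - (t * i / n) ^ (2 * H * K)) / 2)]
  exact mul_le_mul_of_nonneg_right (hM _) (by linarith)

/-- Duality between `f'(B) 1_{(0,t]}` and the remainder in Itô's formula, for bounded `f`, `f'`,
`f''`. -/
theorem integral_val_mul_itoDiv_of_bounded (hB : IsBifractionalBM H K T B P) (hH : 0 < H)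
    (hK : K ∈ Ioc (0 : ℝ) 1) (hHK : 1 ≤ 2 * H * K) (hT : 0 ≤ T) {t : ℝ} (ht : t ∈ Icc 0 T)
    (F : SmoothFunctional (CanonicalHilbert hB.posSemidef)) {f f₁ f₂ : ℝ → ℝ}
    (hf : ∀ x, HasDerivAt f (f₁ x) x) (hf₁ : ∀ x, HasDerivAt f₁ (f₂ x) x)
    (hf₂ : Continuous f₂) {M : ℝ} (hM : ∀ x, |f x| ≤ M) (hM₁ : ∀ x, |f₁ x| ≤ M)
    (hM₂ : ∀ x, |f₂ x| ≤ M) :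
    ∫ ω, F.val hB.wiener ω * itoDiv H K B f f₂ t ω ∂P
      = ∫ ω, ⟪F.D hB.wiener ω, hB.compElem hT t f₁ ω⟫_ℝ ∂P := by
  have := hB.gaussian.isProbabilityMeasure
  obtain ⟨C₀, hC₀, hC₀'⟩ := F.exists_abs_g_le
  obtain ⟨C₂, hC₂, hC₂'⟩ := F.exists_norm_D_le hB.wiener
  have hM0 : 0 ≤ M := (abs_nonneg _).trans (hM 0)
  have hfc : Continuous f := continuous_iff_continuousAt.2 fun x => (hf x).continuousAt
  have hf₁c : Continuous f₁ := continuous_iff_continuousAt.2 fun x => (hf₁ x).continuousAt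
  -- For i ≥ n the values θ = κ = 0 serve as placeholders, so that `choose` yields total functions.
  have hex : ∀ n i : ℕ, ∃ θ κ : ℝ, θ ∈ Icc (0 : ℝ) 1 ∧ (i < n →
      |κ| ≤ normConst H K T * (t / n) ∧
      ∫ ω, F.val hB.wiener ω * f (B (t * (i + 1 : ℕ) / n) ω) ∂P
        - ∫ ω, F.val hB.wiener ω * f (B (t * i / n) ω) ∂P
      = (∫ ω, F.val hB.wiener ω * f₂ (B (t * i / n) ω) ∂P)
          * (((t * (i + 1 : ℕ) / n) ^ (2 * H * K) - (t * i / n) ^ (2 * H * K)) / 2)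
        + ∫ ω, ⟪F.D hB.wiener ω, (hB.incr hT t n i : CanonicalHilbert hB.posSemidef)⟫_ℝ
          * f₁ (B (t * i / n) ω + θ * (B (t * (i + 1 : ℕ) / n) ω - B (t * i / n) ω)) ∂P
        + (∫ ω, F.val hB.wiener ω
            * f₂ (B (t * i / n) ω + θ * (B (t * (i + 1 : ℕ) / n) ω - B (t * i / n) ω)) ∂P
          - ∫ ω, F.val hB.wiener ω * f₂ (B (t * i / n) ω) ∂P) * κ) := fun n i => by
    by_cases hi : i < n
    · obtain ⟨θ, hθ, κ, hκ, h⟩ := hB.exists_expansion hH hK hHK hT ht F hf hf₁ hf₂ hM hM₁ hM₂ hi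
      exact ⟨θ, κ, hθ, fun _ => ⟨hκ, h⟩⟩
    · exact ⟨0, 0, ⟨le_rfl, zero_le_one⟩, fun h => absurd h hi⟩
  choose θ κ hθ hexp using hex
  set b : ℕ → ℕ → Ω → ℝ := fun n i ω =>
    B (t * i / n) ω + θ n i * (B (t * (i + 1 : ℕ) / n) ω - B (t * i / n) ω) with hb
  set R : ℕ → Ω → ℝ := fun n ω =>
    ∑ i ∈ Finset.range n, (f₂ (b n i ω) - f₂ (B (t * i / n) ω)) * κ n i with hR
  set S : ℕ → Ω → CanonicalHilbert hB.posSemidef := fun n ω =>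
    ((hB.stepSum hT hB.smulHom t n fun i => f₁ (b n i ω) : StepSpace hB.posSemidef) :
      CanonicalHilbert hB.posSemidef) with hS
  set C := normConst H K T * t with hC
  have hC0 : 0 ≤ C := mul_nonneg (normConst_nonneg hHK hT) ht.1
  have hFm := F.measurable_val hB.wiener
  have hFD := F.stronglyMeasurable_D hB.wiener
  have hBm : ∀ n i : ℕ, i < n → Measurable (B (t * i / n)) := fun n i hi =>
    hB.measurable _ (node_mem_T ht (by omega) hi.le)
  have hBm' : ∀ n i : ℕ, i < n → Measurable (B (t * (i + 1 : ℕ) / n)) := fun n i hi =>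
    hB.measurable _ (node_mem_T ht (by omega) hi)
  have hbm : ∀ n i, i < n → Measurable (b n i) := fun n i hi =>
    (hBm n i hi).add (((hBm' n i hi).sub (hBm n i hi)).const_mul _)
  have hintF : ∀ {X : Ω → ℝ} {c : ℝ}, Measurable X → (∀ ω, |X ω| ≤ c) →
      Integrable (fun ω => F.val hB.wiener ω * X ω) P := fun {X c} hX hc =>
    Integrable.of_bound (C := C₀ * c) (hFm.mul hX).aestronglyMeasurable (ae_of_all _ fun ω => by
      rw [norm_mul]; exact mul_le_mul (hC₀' _) (hc ω) (norm_nonneg _) hC₀)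
  have hSm : ∀ n, StronglyMeasurable (S n) := fun n =>
    hB.stronglyMeasurable_stepSum hT t n fun i hi => hf₁c.measurable.comp (hbm n i hi)
  have hRm : ∀ n, Measurable (R n) := fun n => Finset.measurable_fun_sum _ fun i hi =>
    ((hf₂.measurable.comp (hbm n i (Finset.mem_range.1 hi))).sub
      (hf₂.measurable.comp (hBm n i (Finset.mem_range.1 hi)))).mul_const _
  have hJm : ∀ n, Measurable (corrSum H K B f₂ t n) := fun n =>
    (hB.measurable_corrSum ht hf₂ n).mono hB.sigma_le le_rfl
  -- There are n terms, each at most ε times `normConst` times t/n, so the total is at most ε C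
  -- uniformly in n.
  have hRb : ∀ n ω ε, (∀ i < n, |f₂ (b n i ω) - f₂ (B (t * i / n) ω)| ≤ ε) → 0 ≤ ε →
      |R n ω| ≤ ε * C := fun n ω ε h hε => by
    rcases Nat.eq_zero_or_pos n with rfl | hn
    · simp only [hR, Finset.range_zero, Finset.sum_empty, abs_zero]; positivity
    have hn' : (n : ℝ) ≠ 0 := by exact_mod_cast hn.ne'
    refine (Finset.abs_sum_le_sum_abs _ _).trans
      ((Finset.sum_le_card_nsmul _ _ (ε * (normConst H K T * (t / n))) fun i hi => ?_).trans
      (le_of_eq ?_))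
    · have hi := Finset.mem_range.1 hi
      rw [abs_mul]
      exact mul_le_mul (h i hi) (hexp n i hi).1 (abs_nonneg _) hε
    · rw [Finset.card_range, nsmul_eq_mul, hC]; field_simp
  have hRb' : ∀ n ω, |R n ω| ≤ 2 * M * C := fun n ω => hRb n ω _ (fun i _ =>
    (abs_sub _ _).trans (by linarith [hM₂ (b n i ω), hM₂ (B (t * i / n) ω)])) (by positivity)
  have hSb : ∀ n ω, ‖S n ω‖ ≤ √(C * M ^ 2) := fun n ω => by
    rw [hS, UniformSpace.Completion.norm_coe]
    refine Real.le_sqrt_of_sq_le ?_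
    exact hB.norm_stepSum_sq_le_of_le hH hK hHK hT ht hB.inner_smulHom fun i _ => hM₁ _
  -- The expectations E[F f(B_{tᵢ})] telescope over the partition; the expansion of each step is
  -- regrouped into the correction sum, the remainder `R` and the pairing of DF with the step
  -- function `S`.
  have hsum : ∀ n, 0 < n → ∫ ω, F.val hB.wiener ω * f (B t ω) ∂P
      - ∫ ω, F.val hB.wiener ω * f (B 0 ω) ∂P
      = ∫ ω, F.val hB.wiener ω * (corrSum H K B f₂ t n ω + R n ω) ∂P
        + ∫ ω, ⟪F.D hB.wiener ω, S n ω⟫_ℝ ∂P := fun n hn => by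
    have hn' : (n : ℝ) ≠ 0 := by exact_mod_cast hn.ne'
    have e0 := Finset.sum_range_sub
      (fun i : ℕ => ∫ ω, F.val hB.wiener ω * f (B (t * i / n) ω) ∂P) n
    simp only [mul_div_cancel_right₀ t hn', Nat.cast_zero, mul_zero, zero_div] at e0
    rw [← e0, Finset.sum_congr rfl fun i hi => (hexp n i (Finset.mem_range.1 hi)).2]
    have i1 : ∀ i ∈ Finset.range n, Integrable (fun ω => F.val hB.wiener ω
        * f₂ (B (t * i / n) ω)) P := fun i hi =>
      hintF (hf₂.measurable.comp (hBm n i (Finset.mem_range.1 hi))) fun _ => hM₂ _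
    have i2 : ∀ i ∈ Finset.range n, Integrable (fun ω => F.val hB.wiener ω
        * f₂ (b n i ω)) P := fun i hi =>
      hintF (hf₂.measurable.comp (hbm n i (Finset.mem_range.1 hi))) fun _ => hM₂ _
    have i3 : ∀ i ∈ Finset.range n, Integrable (fun ω =>
        ⟪F.D hB.wiener ω, (hB.incr hT t n i : CanonicalHilbert hB.posSemidef)⟫_ℝ
          * f₁ (b n i ω)) P := fun i hi => by
      refine Integrable.of_bound
        (C := C₂ * ‖(hB.incr hT t n i : CanonicalHilbert hB.posSemidef)‖ * M)
        ((hFD.inner stronglyMeasurable_const).aestronglyMeasurable.mul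
        (hf₁c.measurable.comp (hbm n i (Finset.mem_range.1 hi))).aestronglyMeasurable)
        (ae_of_all _ fun ω => ?_)
      rw [norm_mul]
      refine mul_le_mul ((norm_inner_le_norm _ _).trans ?_) (hM₁ _) (norm_nonneg _)
        (by positivity)
      gcongr; exact hC₂' _
    have e1 : ∫ ω, F.val hB.wiener ω * (corrSum H K B f₂ t n ω + R n ω) ∂P
        = ∑ i ∈ Finset.range n, ((∫ ω, F.val hB.wiener ω * f₂ (B (t * i / n) ω) ∂P)
          * (((t * (i + 1 : ℕ) / n) ^ (2 * H * K) - (t * i / n) ^ (2 * H * K)) / 2)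
          + (∫ ω, F.val hB.wiener ω * f₂ (b n i ω) ∂P
          - ∫ ω, F.val hB.wiener ω * f₂ (B (t * i / n) ω) ∂P) * κ n i) := by
      have : ∀ ω, F.val hB.wiener ω * (corrSum H K B f₂ t n ω + R n ω)
          = ∑ i ∈ Finset.range n, (F.val hB.wiener ω * f₂ (B (t * i / n) ω)
            * (((t * (i + 1 : ℕ) / n) ^ (2 * H * K) - (t * i / n) ^ (2 * H * K)) / 2)
            + (F.val hB.wiener ω * f₂ (b n i ω) - F.val hB.wiener ω * f₂ (B (t * i / n) ω))
            * κ n i) := fun ω => by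
        rw [corrSum, hR, ← Finset.sum_add_distrib, Finset.mul_sum]
        exact Finset.sum_congr rfl fun i _ => by ring
      simp_rw [this]
      rw [integral_finsetSum]
      · refine Finset.sum_congr rfl fun i hi => ?_
        have i4 : Integrable (fun ω => F.val hB.wiener ω * f₂ (b n i ω)
          - F.val hB.wiener ω * f₂ (B (t * i / n) ω)) P := (i2 i hi).sub (i1 i hi)
        rw [integral_add ((i1 i hi).mul_const _) (i4.mul_const _),
          integral_mul_const, integral_mul_const, integral_sub (i2 i hi) (i1 i hi)]
      · exact fun i hi => ((i1 i hi).mul_const _).add (((i2 i hi).sub (i1 i hi)).mul_const _)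
    have e2 : ∫ ω, ⟪F.D hB.wiener ω, S n ω⟫_ℝ ∂P = ∑ i ∈ Finset.range n,
        ∫ ω, ⟪F.D hB.wiener ω, (hB.incr hT t n i : CanonicalHilbert hB.posSemidef)⟫_ℝ
          * f₁ (b n i ω) ∂P := by
      rw [← integral_finsetSum _ i3]
      refine integral_congr_ae (ae_of_all _ fun ω => ?_)
      simp only [hS, hB.coe_stepSum, inner_sum, real_inner_smul_right]
      exact Finset.sum_congr rfl fun i _ => mul_comm _ _
    rw [e1, e2, ← Finset.sum_add_distrib]
    exact Finset.sum_congr rfl fun i _ => by ring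
  set J : Ω → ℝ := fun ω => H * K * ∫ s in (0 : ℝ)..t, f₂ (B s ω) * s ^ (2 * H * K - 1) with hJ
  -- The points `b n i` lie on the segment between neighbouring values of the path. Uniform
  -- continuity makes them close to the left value whatever the choice of θ.
  have hpath : ∀ {g : ℝ → ℝ}, Continuous g → ∀ᵐ ω ∂P, ∀ ε > 0, ∀ᶠ n in atTop, ∀ i < n,
      |g (b n i ω) - g (B (t * i / n) ω)| ≤ ε := fun {g} hg => by
    filter_upwards [hB.continuous] with ω hω ε hε
    filter_upwards [eventually_abs_comp_sub_le ht.1 (b := fun s => B s ω)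
      (hω.mono (Icc_subset_Icc le_rfl ht.2)) hg hε] with n hn i hi
    exact hn.2 (θ n i) (hθ n i) i hi
  have hR0 : ∀ᵐ ω ∂P, Tendsto (fun n => R n ω) atTop (𝓝 0) := by
    filter_upwards [hpath hf₂] with ω hω
    rw [Metric.tendsto_atTop']
    intro ε hε
    obtain ⟨N, hN⟩ := eventually_atTop.1 (hω (ε / (C + 1)) (by positivity))
    refine ⟨N, fun n hn => ?_⟩
    rw [Real.dist_eq, sub_zero]
    refine (hRb n ω _ (hN n hn.le) (by positivity)).trans_lt ?_
    rw [div_mul_eq_mul_div, div_lt_iff₀ (by positivity)]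
    nlinarith
  have hlimJ := hB.ae_tendsto_corrSum hHK ht hf₂
  have hJb : ∀ᵐ ω ∂P, |J ω| ≤ M * (t ^ (2 * H * K) / 2) := hlimJ.mono fun ω hω =>
    le_of_tendsto hω.abs (Eventually.of_forall fun n => abs_corrSum_le hHK ht.1 hM₂ n ω)
  have hJm' : AEStronglyMeasurable J P :=
    aestronglyMeasurable_of_tendsto_ae atTop (fun n => (hJm n).aestronglyMeasurable) hlimJ
  have lim1 : Tendsto (fun n => ∫ ω, F.val hB.wiener ω * (corrSum H K B f₂ t n ω + R n ω) ∂P)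
      atTop (𝓝 (∫ ω, F.val hB.wiener ω * J ω ∂P)) := by
    refine tendsto_integral_of_dominated_convergence
      (fun _ => C₀ * (M * (t ^ (2 * H * K) / 2) + 2 * M * C))
      (fun n => (hFm.mul ((hJm n).add (hRm n))).aestronglyMeasurable) (integrable_const _)
      (fun n => ae_of_all _ fun ω => ?_) ?_
    · rw [norm_mul]
      exact mul_le_mul (hC₀' _) ((norm_add_le _ _).trans
        (add_le_add (abs_corrSum_le hHK ht.1 hM₂ n ω) (hRb' n ω))) (norm_nonneg _) hC₀
    · filter_upwards [hlimJ, hR0] with ω h1 h2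
      have := (h1.add h2).const_mul (F.val hB.wiener ω)
      rwa [add_zero] at this
  have lim2 : Tendsto (fun n => ∫ ω, ⟪F.D hB.wiener ω, S n ω⟫_ℝ ∂P) atTop
      (𝓝 (∫ ω, ⟪F.D hB.wiener ω, hB.compElem hT t f₁ ω⟫_ℝ ∂P)) := by
    refine tendsto_integral_of_dominated_convergence (fun _ => C₂ * √(C * M ^ 2))
      (fun n => (hFD.inner (hSm n)).aestronglyMeasurable) (integrable_const _)
      (fun n => ae_of_all _ fun ω => ?_) ?_
    · refine (norm_inner_le_norm _ _).trans ?_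
      exact mul_le_mul (hC₂' _) (hSb n ω) (norm_nonneg _) hC₂
    · filter_upwards [hpath hf₁c, hB.ae_continuousOn_comp ht hf₁c] with ω h1 h2
      exact tendsto_const_nhds.inner (hB.tendsto_stepSum_of_close hH hK hHK hT ht h2 h1)
  have hlim := tendsto_nhds_unique (tendsto_const_nhds.congr' ((eventually_gt_atTop 0).mono hsum))
    (lim1.add lim2)
  -- The lower end of the telescoped sum is f(0), because B starts at zero almost surely.
  have hstart : ∫ ω, F.val hB.wiener ω * f (B 0 ω) ∂P = ∫ ω, F.val hB.wiener ω * f 0 ∂P :=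
    integral_congr_ae (hB.start.mono fun ω hω => by simp only [hω])
  rw [hstart] at hlim
  have iJ : Integrable (fun ω => F.val hB.wiener ω * J ω) P :=
    Integrable.of_bound (C := C₀ * (M * (t ^ (2 * H * K) / 2)))
      (hFm.aestronglyMeasurable.mul hJm') (hJb.mono fun ω hω => by
        rw [norm_mul]; exact mul_le_mul (hC₀' _) hω (norm_nonneg _) hC₀)
  have iT : Integrable (fun ω => F.val hB.wiener ω * f (B t ω)) P :=
    hintF (hfc.measurable.comp (hB.measurable t ht)) fun _ => hM _
  have i0 := hintF (X := fun _ => f 0) measurable_const fun _ => hM _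
  have : ∀ ω, F.val hB.wiener ω * itoDiv H K B f f₂ t ω = F.val hB.wiener ω * f (B t ω)
      - F.val hB.wiener ω * f 0 - F.val hB.wiener ω * J ω := fun ω => by
    rw [itoDiv, hJ]; ring
  simp_rw [this]
  have iT0 : Integrable (fun ω => F.val hB.wiener ω * f (B t ω) - F.val hB.wiener ω * f 0) P :=
    iT.sub i0
  rw [integral_sub iT0 iJ, integral_sub iT i0, hlim]
  ring

end IsBifractionalBM

/-! ## Truncation -/

/-- A smooth bump function equal to one on `[-1,1]` and supported in `[-2,2]`. -/
noncomputable def unitBump : ContDiffBump (0 : ℝ) := ⟨1, 2, one_pos, one_lt_two⟩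

/-- The function `h` multiplied by a cut-off at scale `N + 1`. -/
noncomputable def cutoff (N : ℕ) (h : ℝ → ℝ) (x : ℝ) : ℝ := unitBump (x / (N + 1)) * h x

/-- The derivative of `cutoff N h`, if `h'` is the derivative of `h`. -/
noncomputable def cutoffDeriv (N : ℕ) (h h' : ℝ → ℝ) (x : ℝ) : ℝ :=
  deriv unitBump (x / (N + 1)) / (N + 1) * h x + unitBump (x / (N + 1)) * h' x

/-- The primitive of `cutoff N h` with value `a` at zero. -/
noncomputable def cutoffPrim (N : ℕ) (a : ℝ) (h : ℝ → ℝ) (x : ℝ) : ℝ :=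
  a + ∫ y in (0 : ℝ)..x, cutoff N h y

theorem hasDerivAt_unitBump (x : ℝ) : HasDerivAt unitBump (deriv unitBump x) x :=
  ((unitBump.contDiff (n := 1)).differentiable (by simp)).differentiableAt.hasDerivAt

theorem continuous_deriv_unitBump : Continuous (deriv unitBump) :=
  (unitBump.contDiff (n := 1)).continuous_deriv (by simp)

theorem exists_abs_deriv_unitBump_le : ∃ D, 0 ≤ D ∧ ∀ x, |deriv unitBump x| ≤ D := by
  obtain ⟨D, hD⟩ := continuous_deriv_unitBump.bounded_above_of_compact_support
    unitBump.hasCompactSupport.deriv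
  exact ⟨D, (norm_nonneg _).trans (hD 0), hD⟩

theorem unitBump_eq_one {N : ℕ} {x : ℝ} (hx : |x| < N + 1) : unitBump (x / (N + 1)) = 1 := by
  refine unitBump.one_of_mem_closedBall ?_
  have : (0 : ℝ) < N + 1 := by positivity
  simp only [Metric.mem_closedBall, dist_zero_right, Real.norm_eq_abs, abs_div, abs_of_pos this]
  exact ((div_lt_one this).2 hx).le

theorem deriv_unitBump_eq_zero {N : ℕ} {x : ℝ} (hx : |x| < N + 1) :
    deriv unitBump (x / (N + 1)) = 0 := by
  have : (0 : ℝ) < N + 1 := by positivity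
  have h : unitBump =ᶠ[𝓝 (x / (N + 1))] fun _ => (1 : ℝ) := by
    refine unitBump.eventuallyEq_one_of_mem_ball ?_
    simp only [Metric.mem_ball, dist_zero_right, Real.norm_eq_abs, abs_div, abs_of_pos this]
    exact (div_lt_one this).2 hx
  rw [h.deriv_eq, deriv_const]

theorem cutoff_eq {N : ℕ} {h : ℝ → ℝ} {x : ℝ} (hx : |x| < N + 1) : cutoff N h x = h x := by
  rw [cutoff, unitBump_eq_one hx, one_mul]

theorem cutoffDeriv_eq {N : ℕ} {h h' : ℝ → ℝ} {x : ℝ} (hx : |x| < N + 1) :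
    cutoffDeriv N h h' x = h' x := by
  rw [cutoffDeriv, unitBump_eq_one hx, deriv_unitBump_eq_zero hx]; ring

theorem hasDerivAt_cutoff (N : ℕ) {h h' : ℝ → ℝ} (hh : ∀ x, HasDerivAt h (h' x) x) (x : ℝ) :
    HasDerivAt (cutoff N h) (cutoffDeriv N h h' x) x := by
  have h1 := (hasDerivAt_unitBump (x / (N + 1))).comp x ((hasDerivAt_id x).div_const ((N : ℝ) + 1))
  refine (h1.mul (hh x)).congr_deriv ?_
  simp only [cutoffDeriv, Function.comp_apply, id]; ring

theorem continuous_cutoff (N : ℕ) {h : ℝ → ℝ} (hh : Continuous h) : Continuous (cutoff N h) :=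
  (unitBump.continuous.comp (continuous_id.div_const _)).mul hh

theorem continuous_cutoffDeriv (N : ℕ) {h h' : ℝ → ℝ} (hh : Continuous h) (hh' : Continuous h') :
    Continuous (cutoffDeriv N h h') :=
  ((((continuous_deriv_unitBump).comp (continuous_id.div_const _)).div_const _).mul hh).add
    ((unitBump.continuous.comp (continuous_id.div_const _)).mul hh')

theorem hasCompactSupport_cutoff (N : ℕ) (h : ℝ → ℝ) : HasCompactSupport (cutoff N h) := by
  have h1 : HasCompactSupport fun x : ℝ => unitBump (x / (N + 1)) := by
    have hN : ((N : ℝ) + 1)⁻¹ ≠ 0 := by positivity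
    have := unitBump.hasCompactSupport.comp_homeomorph (Homeomorph.mulRight₀ _ hN)
    simpa [Function.comp_def, div_eq_mul_inv] using this
  exact h1.mul_right

theorem hasCompactSupport_cutoffDeriv (N : ℕ) {h h' : ℝ → ℝ}
    (hh : ∀ x, HasDerivAt h (h' x) x) : HasCompactSupport (cutoffDeriv N h h') := by
  have := (hasCompactSupport_cutoff N h).deriv
  rwa [show deriv (cutoff N h) = cutoffDeriv N h h' from
    funext fun x => (hasDerivAt_cutoff N hh x).deriv] at this

theorem hasDerivAt_cutoffPrim (N : ℕ) (a : ℝ) {h : ℝ → ℝ} (hh : Continuous h) (x : ℝ) :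
    HasDerivAt (cutoffPrim N a h) (cutoff N h x) x :=
  ((continuous_cutoff N hh).integral_hasStrictDerivAt 0 x).hasDerivAt.const_add a

theorem cutoffPrim_zero (N : ℕ) (a : ℝ) (h : ℝ → ℝ) : cutoffPrim N a h 0 = a := by
  simp [cutoffPrim]

theorem exists_cutoff_bound (N : ℕ) (a : ℝ) {h h' : ℝ → ℝ} (hh : ∀ x, HasDerivAt h (h' x) x)
    (hh' : Continuous h') : ∃ M, (∀ x, |cutoffPrim N a h x| ≤ M) ∧ (∀ x, |cutoff N h x| ≤ M) ∧
      ∀ x, |cutoffDeriv N h h' x| ≤ M := by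
  have hc : Continuous h := continuous_iff_continuousAt.2 fun x => (hh x).continuousAt
  obtain ⟨M₁, h1⟩ := (continuous_cutoff N hc).bounded_above_of_compact_support
    (hasCompactSupport_cutoff N h)
  obtain ⟨M₂, h2⟩ := (continuous_cutoffDeriv N hc hh').bounded_above_of_compact_support
    (hasCompactSupport_cutoffDeriv N hh)
  have hi : Integrable (cutoff N h) :=
    (continuous_cutoff N hc).integrable_of_hasCompactSupport (hasCompactSupport_cutoff N h)
  -- The primitive of a compactly supported function is bounded by |a| plus its L¹ norm.
  refine ⟨max (|a| + ∫ y, ‖cutoff N h y‖) (max M₁ M₂), fun x => ?_,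
    fun x => (h1 x).trans (by simp), fun x => (h2 x).trans (by simp)⟩
  refine le_max_of_le_left ((abs_add_le _ _).trans (add_le_add le_rfl ?_))
  exact (intervalIntegral.norm_integral_le_integral_norm_uIoc).trans
    (setIntegral_le_integral hi.norm (ae_of_all _ fun _ => norm_nonneg _))

/-- A function with vanishing value at zero is controlled by an exponential bound of its
derivative. -/
theorem abs_le_of_abs_deriv_le_exp {k k' : ℝ → ℝ} (hk : ∀ x, HasDerivAt k (k' x) x)
    (h0 : k 0 = 0) {ε w : ℝ} (hw : 0 ≤ w) (hb : ∀ x, |k' x| ≤ ε * Real.exp (w * |x|)) (x : ℝ) :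
    |k x| ≤ ε * Real.exp ((w + 1) * |x|) := by
  have hε : 0 ≤ ε := by simpa using (abs_nonneg _).trans (hb 0)
  have h := (convex_Icc (-|x|) |x|).norm_image_sub_le_of_norm_hasDerivWithin_le
    (f := k) (f' := k') (C := ε * Real.exp (w * |x|)) (x := 0) (y := x)
    (fun y _ => (hk y).hasDerivWithinAt) (fun y hy => (hb y).trans ?_) (by simp)
    ⟨neg_abs_le x, le_abs_self x⟩
  · rw [h0, sub_zero, sub_zero, Real.norm_eq_abs, Real.norm_eq_abs] at h
    refine h.trans ?_
    -- The factor |x| from the mean value inequality is absorbed by e^{|x|}; this is the extra unit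
    -- in the exponent.
    rw [add_mul, one_mul, Real.exp_add, mul_assoc]
    gcongr
    linarith [Real.add_one_le_exp |x|]
  · have := abs_le.2 hy
    gcongr

theorem cutoffPrim_eq {N : ℕ} {f h : ℝ → ℝ} (hf : ∀ x, HasDerivAt f (h x) x) (hh : Continuous h)
    {x : ℝ} (hx : |x| < N + 1) : cutoffPrim N (f 0) h x = f x := by
  have h1 : ∫ y in (0 : ℝ)..x, cutoff N h y = ∫ y in (0 : ℝ)..x, h y := by
    refine intervalIntegral.integral_congr fun y hy => cutoff_eq (lt_of_le_of_lt ?_ hx)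
    have := abs_sub_left_of_mem_uIcc hy
    simpa using this
  rw [cutoffPrim, h1, intervalIntegral.integral_eq_sub_of_hasDerivAt (fun y _ => hf y)
    (hh.intervalIntegrable _ _)]
  ring

/-- The truncations approximate with respect to exponential weights. -/
theorem exists_cutoff_approx {h h' : ℝ → ℝ} {C c : ℝ}
    (hC : ∀ x, |h x| ≤ C * Real.exp (c * |x|)) (hC' : ∀ x, |h' x| ≤ C * Real.exp (c * |x|)) :
    ∃ ε : ℕ → ℝ, Tendsto ε atTop (𝓝 0) ∧ (∀ N, 0 ≤ ε N) ∧ ∀ N x,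
      |cutoff N h x - h x| ≤ ε N * Real.exp ((c + 1) * |x|) ∧
      |cutoffDeriv N h h' x - h' x| ≤ ε N * Real.exp ((c + 1) * |x|) := by
  obtain ⟨D, hD0, hD⟩ := exists_abs_deriv_unitBump_le
  have hC0 : 0 ≤ C := by simpa using (abs_nonneg _).trans (hC 0)
  -- The errors vanish for |x| < N + 1. Elsewhere they are at most C (D + 2) e^{c|x|}, and N ≤ |x|
  -- there allows one unit of exponential weight to be exchanged for the factor e^{-N}.
  refine ⟨fun N => C * (D + 2) * Real.exp (-N), ?_, fun N => by positivity, fun N x => ?_⟩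
  · have : Tendsto (fun N : ℕ => Real.exp (-(N : ℝ))) atTop (𝓝 0) :=
      Real.tendsto_exp_neg_atTop_nhds_zero.comp tendsto_natCast_atTop_atTop
    simpa using this.const_mul (C * (D + 2))
  by_cases hx : |x| < N + 1
  · rw [cutoff_eq hx, cutoffDeriv_eq hx, sub_self, sub_self, abs_zero]
    have : 0 ≤ C * (D + 2) * Real.exp (-N) * Real.exp ((c + 1) * |x|) := by positivity
    exact ⟨this, this⟩
  have hx' : (N : ℝ) + 1 ≤ |x| := not_lt.1 hx
  have hexp : C * (D + 2) * Real.exp (c * |x|)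
      ≤ C * (D + 2) * Real.exp (-N) * Real.exp ((c + 1) * |x|) := by
    rw [mul_assoc (C * (D + 2)), ← Real.exp_add]
    gcongr
    linarith
  have hb : |unitBump (x / (N + 1)) - 1| ≤ 1 := by
    rw [abs_le]; constructor
    · linarith [unitBump.nonneg (x := x / (N + 1))]
    · linarith [unitBump.le_one (x := x / (N + 1))]
  have hE : 0 ≤ C * Real.exp (c * |x|) := by positivity
  constructor
  · refine le_trans ?_ hexp
    have e : cutoff N h x - h x = (unitBump (x / (N + 1)) - 1) * h x := by rw [cutoff]; ring
    rw [e, abs_mul]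
    calc _ ≤ 1 * (C * Real.exp (c * |x|)) := mul_le_mul hb (hC x) (abs_nonneg _) zero_le_one
      _ ≤ _ := by nlinarith
  · refine le_trans ?_ hexp
    have e : cutoffDeriv N h h' x - h' x = deriv unitBump (x / (N + 1)) / (N + 1) * h x
        + (unitBump (x / (N + 1)) - 1) * h' x := by rw [cutoffDeriv]; ring
    have hd : |deriv unitBump (x / (N + 1)) / (N + 1)| ≤ D := by
      rw [abs_div, abs_of_pos (by positivity : (0 : ℝ) < N + 1)]
      exact (div_le_self (abs_nonneg _) (by linarith [(Nat.cast_nonneg N : (0 : ℝ) ≤ N)])).trans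
        (hD _)
    rw [e]
    refine (abs_add_le _ _).trans ?_
    rw [abs_mul, abs_mul]
    calc _ ≤ D * (C * Real.exp (c * |x|)) + 1 * (C * Real.exp (c * |x|)) :=
        add_le_add (mul_le_mul hd (hC x) (abs_nonneg _) hD0)
          (mul_le_mul hb (hC' x) (abs_nonneg _) zero_le_one)
      _ ≤ _ := by nlinarith

/-! ## Criterion for the divergence -/

section Divergence

variable {Ω : Type*} {E : Type*} [NormedAddCommGroup E] [InnerProductSpace ℝ E]

theorem SmoothFunctional.memLp_val {mΩ : MeasurableSpace Ω} {P : Measure Ω} [IsFiniteMeasure P]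
    (W : E →L[ℝ] Lp ℝ 2 P) (F : SmoothFunctional E) (p : ℝ≥0∞) : MemLp (F.val W) p P := by
  obtain ⟨C, -, hC⟩ := F.exists_abs_g_le
  exact MemLp.of_bound (F.measurable_val W).aestronglyMeasurable C (ae_of_all _ fun _ => hC _)

theorem abs_integral_mul_le {mΩ : MeasurableSpace Ω} {P : Measure Ω} {X Y : Ω → ℝ}
    (hX : MemLp X 2 P) (hY : MemLp Y 2 P) :
    |∫ ω, X ω * Y ω ∂P| ≤ (eLpNorm Y 2 P).toReal * (eLpNorm X 2 P).toReal := by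
  have h := abs_real_inner_le_norm (hX.toLp X) (hY.toLp Y)
  rw [MeasureTheory.L2.inner_def, Lp.norm_toLp, Lp.norm_toLp, mul_comm] at h
  refine le_trans (le_of_eq ?_) h
  congr 1
  refine integral_congr_ae ?_
  filter_upwards [hX.coeFn_toLp, hY.coeFn_toLp] with ω h1 h2
  rw [h1, h2]; simp [mul_comm]

/-- The duality formula and the Cauchy–Schwarz inequality give the bound defining Dom(δ), with
constant ‖Y‖_{L²}. -/
theorem isDivergence_of_duality (m : MeasurableSpace Ω) {mΩ : MeasurableSpace Ω} {P : Measure Ω}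
    [IsFiniteMeasure P] {W : E →L[ℝ] Lp ℝ 2 P} {u : Ω → E} {Y : Ω → ℝ} (hu : MemLp u 2 P)
    (hY : MemLp Y 2 P) (hYm : AEStronglyMeasurable[m] Y P)
    (h : ∀ F : SmoothFunctional E, ∫ ω, F.val W ω * Y ω ∂P = ∫ ω, ⟪F.D W ω, u ω⟫_ℝ ∂P) :
    IsDivergence m W u Y := by
  refine ⟨⟨hu, (eLpNorm Y 2 P).toReal, fun F => ?_⟩, hY, hYm, h⟩
  rw [← h F]
  exact abs_integral_mul_le (F.memLp_val W 2) hY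

/-- Convergence in L² of the dominating differences implies convergence in L¹ on a probability
space. It is applied with multiplication by F and with pairing against DF, both bounded operations.
-/
theorem tendsto_integral_of_norm_sub_le {mΩ : MeasurableSpace Ω} {P : Measure Ω}
    [IsProbabilityMeasure P] {X : Type*} [NormedAddCommGroup X] {a : ℕ → Ω → X} {b : Ω → X}
    {a' : ℕ → Ω → ℝ} {b' : Ω → ℝ} {C : ℝ} (hb' : Integrable b' P)
    (ha' : ∀ n, Integrable (a' n) P) (hab : ∀ n, AEStronglyMeasurable (a n - b) P)
    (hle : ∀ n ω, ‖a' n ω - b' ω‖ ≤ C * ‖a n ω - b ω‖)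
    (hlim : Tendsto (fun n => eLpNorm (a n - b) 2 P) atTop (𝓝 0)) :
    Tendsto (fun n => ∫ ω, a' n ω ∂P) atTop (𝓝 (∫ ω, b' ω ∂P)) := by
  refine tendsto_integral_of_L1' _ hb'.1 (Eventually.of_forall ha') ?_
  have h0 : Tendsto (fun n => ENNReal.ofReal C * eLpNorm (a n - b) 2 P) atTop (𝓝 0) := by
    simpa using ENNReal.Tendsto.const_mul hlim (Or.inr ENNReal.ofReal_ne_top)
  refine tendsto_of_tendsto_of_tendsto_of_le_of_le tendsto_const_nhds h0 (fun _ => zero_le)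
    fun n => ?_
  refine (eLpNorm_le_mul_eLpNorm_of_ae_le_mul (g := a n - b)
    (ae_of_all _ fun ω => hle n ω) 1).trans ?_
  gcongr
  exact eLpNorm_le_eLpNorm_of_exponent_le (by norm_num) (hab n)

/-- The divergence is closed. -/
theorem duality_of_tendsto {mΩ : MeasurableSpace Ω} {P : Measure Ω}
    [IsProbabilityMeasure P] {W : E →L[ℝ] Lp ℝ 2 P} {u : Ω → E} {Y : Ω → ℝ} {v : ℕ → Ω → E}
    {Z : ℕ → Ω → ℝ} (hu : MemLp u 2 P) (hY : MemLp Y 2 P) (hv : ∀ n, MemLp (v n) 2 P)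
    (hZ : ∀ n, MemLp (Z n) 2 P)
    (hvu : Tendsto (fun n => eLpNorm (v n - u) 2 P) atTop (𝓝 0))
    (hZY : Tendsto (fun n => eLpNorm (Z n - Y) 2 P) atTop (𝓝 0)) (F : SmoothFunctional E)
    (h : ∀ n, ∫ ω, F.val W ω * Z n ω ∂P = ∫ ω, ⟪F.D W ω, v n ω⟫_ℝ ∂P) :
    ∫ ω, F.val W ω * Y ω ∂P = ∫ ω, ⟪F.D W ω, u ω⟫_ℝ ∂P := by
  obtain ⟨C₀, hC₀, hC₀'⟩ := F.exists_abs_g_le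
  obtain ⟨C₂, hC₂, hC₂'⟩ := F.exists_norm_D_le W
  have hFm := (F.measurable_val W).aestronglyMeasurable (μ := P)
  have hFD := (F.stronglyMeasurable_D W).aestronglyMeasurable (μ := P)
  have hint1 : ∀ {X : Ω → ℝ}, MemLp X 2 P → Integrable (fun ω => F.val W ω * X ω) P := fun hX =>
    (hX.integrable (by norm_num)).bdd_mul hFm (ae_of_all _ fun ω => hC₀' _)
  have hint2 : ∀ {X : Ω → E}, MemLp X 2 P → Integrable (fun ω => ⟪F.D W ω, X ω⟫_ℝ) P :=
    fun hX => by
    refine ((hX.integrable (by norm_num)).norm.const_mul C₂).mono' (hFD.inner hX.1)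
      (ae_of_all _ fun ω => (norm_inner_le_norm _ _).trans ?_)
    exact mul_le_mul_of_nonneg_right (hC₂' ω) (norm_nonneg _)
  have l1 : Tendsto (fun n => ∫ ω, F.val W ω * Z n ω ∂P) atTop
      (𝓝 (∫ ω, F.val W ω * Y ω ∂P)) := by
    refine tendsto_integral_of_norm_sub_le (C := C₀) (hint1 hY) (fun n => hint1 (hZ n))
      (fun n => (hZ n).1.sub hY.1) (fun n ω => ?_) hZY
    rw [← mul_sub, norm_mul]
    exact mul_le_mul_of_nonneg_right (hC₀' _) (norm_nonneg _)
  have l2 : Tendsto (fun n => ∫ ω, ⟪F.D W ω, v n ω⟫_ℝ ∂P) atTop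
      (𝓝 (∫ ω, ⟪F.D W ω, u ω⟫_ℝ ∂P)) := by
    refine tendsto_integral_of_norm_sub_le (C := C₂) (hint2 hu) (fun n => hint2 (hv n))
      (fun n => (hv n).1.sub hu.1) (fun n ω => ?_) hvu
    rw [← inner_sub_right]
    exact (norm_inner_le_norm _ _).trans (mul_le_mul_of_nonneg_right (hC₂' _) (norm_nonneg _))
  exact tendsto_nhds_unique l1 (l2.congr fun n => (h n).symm)

end Divergence

/-! ### L² estimates under exponential growth -/

theorem eLpNorm_two_le_of_integral_sq_le {Ω : Type*} [MeasurableSpace Ω] {P : Measure Ω}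
    {V : Type*} [NormedAddCommGroup V] {X : Ω → V} (hX : AEStronglyMeasurable X P)
    (hi : Integrable (fun ω => ‖X ω‖ ^ 2) P) {c : ℝ} (hc : 0 ≤ c)
    (h : ∫ ω, ‖X ω‖ ^ 2 ∂P ≤ c ^ 2) : eLpNorm X 2 P ≤ ENNReal.ofReal c := by
  have hm : MemLp X 2 P := (memLp_two_iff_integrable_sq_norm hX).2 hi
  rw [hm.eLpNorm_eq_integral_rpow_norm (by norm_num) (by norm_num)]
  refine ENNReal.ofReal_le_ofReal ?_
  simp only [ENNReal.toReal_ofNat, Real.rpow_ofNat]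
  rw [← Real.sqrt_sq hc, Real.sqrt_eq_rpow]
  simp only [one_div]
  gcongr

namespace IsBifractionalBM

variable {Ω : Type*} [MeasurableSpace Ω] {H K T : ℝ} {B : ℝ → Ω → ℝ} {P : Measure Ω}

/-- A bound for the `L²` norm of `exp (w |B_s|)`, uniform over `s ∈ [0,T]`. -/
noncomputable def expConst (H K T w : ℝ) : ℝ := √(2 * Real.exp (2 * w ^ 2 * T ^ (2 * H * K)))

theorem expConst_nonneg (w : ℝ) : 0 ≤ expConst H K T w := Real.sqrt_nonneg _

theorem map_eq_gaussianReal (hB : IsBifractionalBM H K T B P) (hT : 0 ≤ T) {s : ℝ}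
    (hs : s ∈ Icc 0 T) : P.map (B s) = gaussianReal 0 (‖hB.pt hT s‖₊ ^ 2) := by
  rw [← Measure.map_congr (hB.wiener_pt hT hs), hB.isIsonormal_wiener.map_eq]
  congr 2
  ext
  simp

theorem integral_exp_mul (hB : IsBifractionalBM H K T B P) (hHK : 1 ≤ 2 * H * K) (hT : 0 ≤ T)
    {s : ℝ} (hs : s ∈ Icc 0 T) (a : ℝ) :
    Integrable (fun ω => Real.exp (a * B s ω)) P ∧
      ∫ ω, Real.exp (a * B s ω) ∂P ≤ Real.exp (a ^ 2 / 2 * T ^ (2 * H * K)) := by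
  have hlaw := hB.map_eq_gaussianReal hT hs
  have hm := (hB.measurable s hs).aemeasurable (μ := P)
  constructor
  · have h := integrable_exp_mul_gaussianReal (μ := 0) (v := ‖hB.pt hT s‖₊ ^ 2) a
    rw [← hlaw] at h
    exact h.comp_aemeasurable hm
  · have h := mgf_gaussianReal hlaw a
    rw [mgf] at h
    rw [h]
    refine Real.exp_le_exp.2 ?_
    have h2 : ((‖hB.pt hT s‖₊ ^ 2 : NNReal) : ℝ) ≤ T ^ (2 * H * K) := by
      push_cast
      rw [hB.norm_pt_sq hHK hT hs]
      exact Real.rpow_le_rpow hs.1 hs.2 (by linarith)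
    nlinarith [mul_le_mul_of_nonneg_right h2 (sq_nonneg a)]

/-- Since e^{2w|x|} is at most the sum of e^{2wx} and e^{-2wx}, two Gaussian exponential moments
suffice, and the variance s^{2HK} ≤ T^{2HK} makes the bound uniform in s. -/
theorem integral_sq_comp_le (hB : IsBifractionalBM H K T B P) (hHK : 1 ≤ 2 * H * K) (hT : 0 ≤ T)
    {s : ℝ} (hs : s ∈ Icc 0 T) {g : ℝ → ℝ} (hg : Continuous g) {ε w : ℝ}
    (hgb : ∀ x, |g x| ≤ ε * Real.exp (w * |x|)) :
    Integrable (fun ω => ‖g (B s ω)‖ ^ 2) P ∧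
      ∫ ω, ‖g (B s ω)‖ ^ 2 ∂P ≤ (ε * expConst H K T w) ^ 2 := by
  obtain ⟨i1, b1⟩ := hB.integral_exp_mul hHK hT hs (2 * w)
  obtain ⟨i2, b2⟩ := hB.integral_exp_mul hHK hT hs (-(2 * w))
  have hdom : ∀ x, ‖g x‖ ^ 2 ≤ ε ^ 2 * (Real.exp (2 * w * x) + Real.exp (-(2 * w) * x)) :=
    fun x => by
    have h1 : ‖g x‖ ^ 2 ≤ (ε * Real.exp (w * |x|)) ^ 2 :=
      pow_le_pow_left₀ (norm_nonneg _) (hgb x) 2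
    refine h1.trans ?_
    rw [mul_pow, ← Real.exp_nat_mul]
    refine mul_le_mul_of_nonneg_left ?_ (sq_nonneg _)
    rcases abs_choice x with h | h <;> rw [h]
    · refine le_add_of_le_of_nonneg (Real.exp_le_exp.2 (by push_cast; linarith))
        (Real.exp_nonneg _)
    · refine le_add_of_nonneg_of_le (Real.exp_nonneg _) (Real.exp_le_exp.2 ?_)
      push_cast; linarith
  have hi := (i1.add i2).const_mul (ε ^ 2)
  have hint : Integrable (fun ω => ‖g (B s ω)‖ ^ 2) P := by
    refine hi.mono'
      ((hg.measurable.comp (hB.measurable s hs)).norm.pow_const 2).aestronglyMeasurable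
      (ae_of_all _ fun ω => ?_)
    rw [Real.norm_of_nonneg (by positivity)]
    exact hdom _
  refine ⟨hint, (integral_mono hint hi fun ω => hdom _).trans ?_⟩
  rw [integral_const_mul]
  simp only [Pi.add_apply]
  rw [integral_add i1 i2, mul_pow, expConst, Real.sq_sqrt (by positivity)]
  refine mul_le_mul_of_nonneg_left ?_ (sq_nonneg _)
  rw [show (2 * w) ^ 2 / 2 = 2 * w ^ 2 by ring] at b1
  rw [show (-(2 * w)) ^ 2 / 2 = 2 * w ^ 2 by ring] at b2
  linarith

theorem eLpNorm_comp_le (hB : IsBifractionalBM H K T B P) (hHK : 1 ≤ 2 * H * K) (hT : 0 ≤ T)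
    {s : ℝ} (hs : s ∈ Icc 0 T) {g : ℝ → ℝ} (hg : Continuous g) {ε w : ℝ} (hε : 0 ≤ ε)
    (hgb : ∀ x, |g x| ≤ ε * Real.exp (w * |x|)) :
    eLpNorm (fun ω => g (B s ω)) 2 P ≤ ENNReal.ofReal (ε * expConst H K T w) := by
  obtain ⟨h1, h2⟩ := hB.integral_sq_comp_le hHK hT hs hg hgb
  exact eLpNorm_two_le_of_integral_sq_le
    (hg.measurable.comp (hB.measurable s hs)).aestronglyMeasurable h1
    (mul_nonneg hε (expConst_nonneg w)) h2

/-- Fatou's lemma reduces to step sums; there Schur's bound and the uniform second moment of g(B_s)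
apply. -/
theorem eLpNorm_compElem_le (hB : IsBifractionalBM H K T B P) (hH : 0 < H)
    (hK : K ∈ Ioc (0 : ℝ) 1) (hHK : 1 ≤ 2 * H * K) (hT : 0 ≤ T) {t : ℝ} (ht : t ∈ Icc 0 T)
    {g : ℝ → ℝ} (hg : Continuous g) {ε w : ℝ} (hε : 0 ≤ ε)
    (hgb : ∀ x, |g x| ≤ ε * Real.exp (w * |x|)) :
    eLpNorm (hB.compElem hT t g) 2 P
      ≤ ENNReal.ofReal (√(normConst H K T * t) * (ε * expConst H K T w)) := by
  have hC0 : 0 ≤ normConst H K T * t := mul_nonneg (normConst_nonneg hHK hT) ht.1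
  have hA := mul_nonneg hε (expConst_nonneg (H := H) (K := K) (T := T) w)
  have hm := hB.stronglyMeasurable_pathSum hT ht hg
  refine (Lp.eLpNorm_lim_le_liminf_eLpNorm (fun n => (hm n).aestronglyMeasurable) _
    (hB.ae_tendsto_compElem hH hK hHK hT ht hg)).trans ?_
  -- The bound is uniform over positive n, so an eventual lower bound `b` need only be tested at one
  -- such n.
  refine liminf_le_of_le ⟨0, by simp⟩ fun b hb => ?_
  obtain ⟨n, hb, hn⟩ := (hb.and (eventually_gt_atTop 0)).exists
  refine hb.trans ?_
  have hn' : (0 : ℝ) < n := by exact_mod_cast hn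
  have hint : ∀ i ∈ Finset.range n, Integrable (fun ω => ‖g (B (t * i / n) ω)‖ ^ 2) P :=
    fun i hi => (hB.integral_sq_comp_le hHK hT (node_mem_T ht hn (Finset.mem_range.1 hi).le) hg
      hgb).1
  have hi := (integrable_finsetSum _ hint).const_mul (normConst H K T * (t / n))
  have hle : ∀ ω, ‖((hB.pathSum hT hB.smulHom t n fun s => g (B s ω) :
      StepSpace hB.posSemidef) : CanonicalHilbert hB.posSemidef)‖ ^ 2
      ≤ normConst H K T * (t / n) * ∑ i ∈ Finset.range n, ‖g (B (t * i / n) ω)‖ ^ 2 := fun ω => by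
    rw [UniformSpace.Completion.norm_coe]
    exact hB.norm_stepSum_sq_le hH hK hHK hT ht hB.inner_smulHom n _
  have hint2 : Integrable (fun ω => ‖((hB.pathSum hT hB.smulHom t n fun s => g (B s ω) :
      StepSpace hB.posSemidef) : CanonicalHilbert hB.posSemidef)‖ ^ 2) P := by
    refine hi.mono' ((hm n).norm.pow 2).aestronglyMeasurable (ae_of_all _ fun ω => ?_)
    rw [Real.norm_of_nonneg (by positivity)]
    exact hle ω
  refine eLpNorm_two_le_of_integral_sq_le (hm n).aestronglyMeasurable hint2 (by positivity)
    ((integral_mono hint2 hi hle).trans ?_)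
  rw [integral_const_mul, integral_finsetSum _ hint, mul_pow, Real.sq_sqrt hC0]
  have h1 : ∑ i ∈ Finset.range n, ∫ ω, ‖g (B (t * i / n) ω)‖ ^ 2 ∂P
      ≤ n * (ε * expConst H K T w) ^ 2 := by
    refine (Finset.sum_le_card_nsmul _ _ _ fun i hi =>
      (hB.integral_sq_comp_le hHK hT (node_mem_T ht hn (Finset.mem_range.1 hi).le) hg
        hgb).2).trans (by simp)
  calc _ ≤ normConst H K T * (t / n) * (n * (ε * expConst H K T w) ^ 2) :=
        mul_le_mul_of_nonneg_left h1 (mul_nonneg (normConst_nonneg hHK hT)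
          (div_nonneg ht.1 hn'.le))
    _ = _ := by field_simp

/-- The correction term `HK ∫₀ᵗ g(B_s) s^{2HK-1} ds`. -/
noncomputable def corr (H K : ℝ) (B : ℝ → Ω → ℝ) (g : ℝ → ℝ) (t : ℝ) (ω : Ω) : ℝ :=
  H * K * ∫ s in (0 : ℝ)..t, g (B s ω) * s ^ (2 * H * K - 1)

/-- Fatou's lemma and the triangle inequality for the Stieltjes sums: the weights are nonnegative
and add up to t^{2HK}/2. -/
theorem eLpNorm_corr_le (hB : IsBifractionalBM H K T B P) (hHK : 1 ≤ 2 * H * K) (hT : 0 ≤ T)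
    {t : ℝ} (ht : t ∈ Icc 0 T) {g : ℝ → ℝ} (hg : Continuous g) {ε w : ℝ} (hε : 0 ≤ ε)
    (hgb : ∀ x, |g x| ≤ ε * Real.exp (w * |x|)) :
    eLpNorm (corr H K B g t) 2 P
      ≤ ENNReal.ofReal (t ^ (2 * H * K) / 2 * (ε * expConst H K T w)) := by
  have hA := mul_nonneg hε (expConst_nonneg (H := H) (K := K) (T := T) w)
  have hm : ∀ n, AEStronglyMeasurable (corrSum H K B g t n) P := fun n =>
    ((hB.measurable_corrSum ht hg n).mono hB.sigma_le le_rfl).aestronglyMeasurable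
  refine (Lp.eLpNorm_lim_le_liminf_eLpNorm hm _ (hB.ae_tendsto_corrSum hHK ht hg)).trans ?_
  refine liminf_le_of_le ⟨0, by simp⟩ fun b hb => ?_
  obtain ⟨n, hb, hn⟩ := (hb.and (eventually_gt_atTop 0)).exists
  refine hb.trans ?_
  have hterm : ∀ i ∈ Finset.range n, AEStronglyMeasurable (fun ω => g (B (t * i / n) ω)
      * (((t * (i + 1 : ℕ) / n) ^ (2 * H * K) - (t * i / n) ^ (2 * H * K)) / 2)) P := fun i hi =>
    ((hg.measurable.comp (hB.measurable _ (node_mem_T ht hn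
      (Finset.mem_range.1 hi).le))).mul_const _).aestronglyMeasurable
  have e : corrSum H K B g t n = ∑ i ∈ Finset.range n, fun ω => g (B (t * i / n) ω)
      * (((t * (i + 1 : ℕ) / n) ^ (2 * H * K) - (t * i / n) ^ (2 * H * K)) / 2) := by
    ext ω; rw [Finset.sum_apply]; rfl
  rw [e]
  refine (eLpNorm_sum_le hterm (by norm_num)).trans ?_
  rw [← sum_rpow_node hHK t hn, Finset.sum_div, Finset.sum_mul, ENNReal.ofReal_sum_of_nonneg]
  · refine Finset.sum_le_sum fun i hi => ?_
    have hw0 : 0 ≤ ((t * (i + 1 : ℕ) / n) ^ (2 * H * K) - (t * i / n) ^ (2 * H * K)) / 2 := by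
      linarith [rpow_node_nonneg hHK ht.1 n i]
    rw [ENNReal.ofReal_mul hw0]
    have h2 : (fun ω => g (B (t * i / n) ω)
        * (((t * (i + 1 : ℕ) / n) ^ (2 * H * K) - (t * i / n) ^ (2 * H * K)) / 2))
        = (((t * (i + 1 : ℕ) / n) ^ (2 * H * K) - (t * i / n) ^ (2 * H * K)) / 2)
          • fun ω => g (B (t * i / n) ω) := by
      ext ω; simp [mul_comm]
    rw [h2, eLpNorm_const_smul, ← ofReal_norm, Real.norm_of_nonneg hw0]
    gcongr
    exact hB.eLpNorm_comp_le hHK hT (node_mem_T ht hn (Finset.mem_range.1 hi).le) hg hε hgb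
  · intro i _
    have := rpow_node_nonneg hHK ht.1 n i
    exact mul_nonneg (by linarith) hA

/-- The element is defined by `limUnder`, so linearity is available only where the step sums
converge, that is, almost surely. -/
theorem compElem_sub (hB : IsBifractionalBM H K T B P) (hH : 0 < H)
    (hK : K ∈ Ioc (0 : ℝ) 1) (hHK : 1 ≤ 2 * H * K) (hT : 0 ≤ T) {t : ℝ} (ht : t ∈ Icc 0 T)
    {g h : ℝ → ℝ} (hg : Continuous g) (hh : Continuous h) :
    hB.compElem hT t g - hB.compElem hT t h =ᵐ[P] hB.compElem hT t fun x => g x - h x := by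
  filter_upwards [hB.ae_tendsto_compElem hH hK hHK hT ht hg,
    hB.ae_tendsto_compElem hH hK hHK hT ht hh,
    hB.ae_tendsto_compElem (g := fun x => g x - h x) hH hK hHK hT ht (hg.sub hh)] with ω h1 h2 h3
  refine tendsto_nhds_unique (h1.sub h2) (h3.congr fun n => ?_)
  rw [← UniformSpace.Completion.coe_sub]
  congr 1
  simp only [pathSum, stepSum, map_sub, AddMonoidHom.sub_apply, Finset.sum_sub_distrib]

theorem corr_sub (hB : IsBifractionalBM H K T B P) (hHK : 1 ≤ 2 * H * K) {t : ℝ}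
    (ht : t ∈ Icc 0 T) {g h : ℝ → ℝ} (hg : Continuous g) (hh : Continuous h) :
    corr H K B g t - corr H K B h t =ᵐ[P] corr H K B (fun x => g x - h x) t := by
  filter_upwards [hB.ae_tendsto_corrSum hHK ht hg, hB.ae_tendsto_corrSum hHK ht hh,
    hB.ae_tendsto_corrSum (g := fun x => g x - h x) hHK ht (hg.sub hh)] with ω h1 h2 h3
  refine tendsto_nhds_unique (h1.sub h2) (h3.congr fun n => ?_)
  simp only [corrSum, sub_mul, Finset.sum_sub_distrib]

theorem aestronglyMeasurable_corr (hB : IsBifractionalBM H K T B P) (hHK : 1 ≤ 2 * H * K)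
    {t : ℝ} (ht : t ∈ Icc 0 T) {g : ℝ → ℝ} (hg : Continuous g) :
    AEStronglyMeasurable (corr H K B g t) P :=
  aestronglyMeasurable_of_tendsto_ae atTop (fun n =>
    ((hB.measurable_corrSum ht hg n).mono hB.sigma_le le_rfl).aestronglyMeasurable)
    (hB.ae_tendsto_corrSum hHK ht hg)

theorem memLp_compElem (hB : IsBifractionalBM H K T B P) (hH : 0 < H)
    (hK : K ∈ Ioc (0 : ℝ) 1) (hHK : 1 ≤ 2 * H * K) (hT : 0 ≤ T) {t : ℝ} (ht : t ∈ Icc 0 T)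
    {g : ℝ → ℝ} (hg : Continuous g) {ε w : ℝ} (hε : 0 ≤ ε)
    (hgb : ∀ x, |g x| ≤ ε * Real.exp (w * |x|)) :
    MemLp (hB.compElem hT t g) 2 P :=
  ⟨hB.aestronglyMeasurable_compElem hH hK hHK hT ht hg,
    (hB.eLpNorm_compElem_le hH hK hHK hT ht hg hε hgb).trans_lt ENNReal.ofReal_lt_top⟩

theorem memLp_itoDiv (hB : IsBifractionalBM H K T B P) (hHK : 1 ≤ 2 * H * K) (hT : 0 ≤ T)
    {t : ℝ} (ht : t ∈ Icc 0 T) {f f₂ : ℝ → ℝ} (hf : Continuous f) (hf₂ : Continuous f₂)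
    {ε w : ℝ} (hε : 0 ≤ ε) (hfb : ∀ x, |f x| ≤ ε * Real.exp (w * |x|))
    (hfb₂ : ∀ x, |f₂ x| ≤ ε * Real.exp (w * |x|)) : MemLp (itoDiv H K B f f₂ t) 2 P := by
  have := hB.gaussian.isProbabilityMeasure
  have h1 : MemLp (fun ω => f (B t ω)) 2 P :=
    ⟨(hf.measurable.comp (hB.measurable t ht)).aestronglyMeasurable,
      (hB.eLpNorm_comp_le hHK hT ht hf hε hfb).trans_lt ENNReal.ofReal_lt_top⟩
  have h2 : MemLp (corr H K B f₂ t) 2 P := ⟨hB.aestronglyMeasurable_corr hHK ht hf₂,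
    (hB.eLpNorm_corr_le hHK hT ht hf₂ hε hfb₂).trans_lt ENNReal.ofReal_lt_top⟩
  exact (h1.sub (memLp_const (f 0))).sub h2

theorem eLpNorm_itoDiv_sub_le (hB : IsBifractionalBM H K T B P) (hHK : 1 ≤ 2 * H * K) (hT : 0 ≤ T)
    {t : ℝ} (ht : t ∈ Icc 0 T) {f f₂ g g₂ : ℝ → ℝ} (hf : Continuous f) (hf₂ : Continuous f₂)
    (hg : Continuous g) (hg₂ : Continuous g₂) (h0 : f 0 = g 0)
    {ε w : ℝ} (hε : 0 ≤ ε) (hb : ∀ x, |f x - g x| ≤ ε * Real.exp (w * |x|))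
    (hb₂ : ∀ x, |f₂ x - g₂ x| ≤ ε * Real.exp (w * |x|)) :
    eLpNorm (itoDiv H K B f f₂ t - itoDiv H K B g g₂ t) 2 P
      ≤ ENNReal.ofReal (ε * (expConst H K T w * (1 + t ^ (2 * H * K) / 2))) := by
  have h1 : itoDiv H K B f f₂ t - itoDiv H K B g g₂ t
      =ᵐ[P] (fun ω => f (B t ω) - g (B t ω)) - corr H K B (fun x => f₂ x - g₂ x) t := by
    filter_upwards [hB.corr_sub hHK ht hf₂ hg₂] with ω hω
    rw [Pi.sub_apply, Pi.sub_apply, ← hω, Pi.sub_apply]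
    simp only [itoDiv, corr, h0]; ring
  rw [eLpNorm_congr_ae h1]
  refine (eLpNorm_sub_le ((hf.sub hg).measurable.comp
    (hB.measurable t ht)).aestronglyMeasurable
    (hB.aestronglyMeasurable_corr hHK ht (hf₂.sub hg₂)) (by norm_num)).trans ?_
  refine (add_le_add (hB.eLpNorm_comp_le hHK hT ht (hf.sub hg) hε hb)
    (hB.eLpNorm_corr_le hHK hT ht (hf₂.sub hg₂) hε hb₂)).trans (le_of_eq ?_)
  have hA := expConst_nonneg (H := H) (K := K) (T := T) w
  have := Real.rpow_nonneg ht.1 (2 * H * K)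
  rw [← ENNReal.ofReal_add (by positivity) (by positivity)]
  congr 1; ring

/-- Under exponential growth, the remainder in Itô's formula is the divergence of
`f'(B) 1_{(0,t]}`. -/
theorem isDivergence_compElem (hB : IsBifractionalBM H K T B P) (hH : 0 < H)
    (hK : K ∈ Ioc (0 : ℝ) 1) (hHK : 1 ≤ 2 * H * K) (hT : 0 ≤ T) {t : ℝ} (ht : t ∈ Icc 0 T)
    {f f₁ f₂ : ℝ → ℝ} (hf : ∀ x, HasDerivAt f (f₁ x) x) (hf₁ : ∀ x, HasDerivAt f₁ (f₂ x) x)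
    (hf₂ : Continuous f₂) {C c : ℝ} (hb₁ : ∀ x, |f₁ x| ≤ C * Real.exp (c * |x|))
    (hb₂ : ∀ x, |f₂ x| ≤ C * Real.exp (c * |x|)) :
    IsDivergence hB.sigma hB.wiener (hB.compElem hT t f₁) (itoDiv H K B f f₂ t) := by
  have := hB.gaussian.isProbabilityMeasure
  have hC : 0 ≤ C := by simpa using (abs_nonneg _).trans (hb₁ 0)
  have hfc : Continuous f := continuous_iff_continuousAt.2 fun x => (hf x).continuousAt
  have hf₁c : Continuous f₁ := continuous_iff_continuousAt.2 fun x => (hf₁ x).continuousAt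
  -- A nonnegative rate makes the weight at least one, as is needed to absorb the constant |f 0| and
  -- to integrate the derivative bound.
  set d := |c| with hd
  have hd0 : 0 ≤ d := abs_nonneg c
  have hmono : ∀ {a : ℝ} {v w : ℝ} (x : ℝ), 0 ≤ a → v ≤ w →
      a * Real.exp (v * |x|) ≤ a * Real.exp (w * |x|) := fun x ha hvw => by gcongr
  have hb₁' : ∀ x, |f₁ x| ≤ C * Real.exp (d * |x|) := fun x =>
    (hb₁ x).trans (hmono x hC (le_abs_self c))
  have hb₂' : ∀ x, |f₂ x| ≤ C * Real.exp (d * |x|) := fun x =>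
    (hb₂ x).trans (hmono x hC (le_abs_self c))
  -- Truncation costs one unit of the exponential rate, and passing from f₁ to its primitive costs
  -- another.
  set w := d + 2 with hw
  have hw0 : 0 ≤ w := by linarith
  have hfb : ∀ x, |f x| ≤ (|f 0| + C) * Real.exp (w * |x|) := fun x => by
    have h1 := abs_le_of_abs_deriv_le_exp (k := fun y => f y - f 0) (k' := f₁)
      (fun y => (hf y).sub_const _) (sub_self _) hd0 hb₁' x
    have h2 : |f x| ≤ |f 0| + |f x - f 0| := by
      have := abs_add_le (f 0) (f x - f 0)
      rwa [add_sub_cancel] at this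
    have h3 : |f 0| ≤ |f 0| * Real.exp (w * |x|) :=
      le_mul_of_one_le_right (abs_nonneg _) (Real.one_le_exp (by positivity))
    have h4 := hmono (v := d + 1) (w := w) x hC (by linarith)
    linarith
  have hfb₂ : ∀ x, |f₂ x| ≤ (|f 0| + C) * Real.exp (w * |x|) := fun x => by
    refine (hb₂' x).trans ((hmono x hC (by linarith : d ≤ w)).trans ?_)
    gcongr
    linarith [abs_nonneg (f 0)]
  have hu := hB.memLp_compElem hH hK hHK hT ht hf₁c hC hb₁'
  have hY := hB.memLp_itoDiv hHK hT ht hfc hf₂ (by positivity) hfb hfb₂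
  refine isDivergence_of_duality _ hu hY
    (hB.aestronglyMeasurable_sigma_itoDiv hHK ht hfc hf₂) fun F => ?_
  obtain ⟨ε, hε, hε0, happ⟩ := exists_cutoff_approx (h := f₁) (h' := f₂) hb₁' hb₂'
  choose M hM hM₁ hM₂ using fun N => exists_cutoff_bound N (f 0) hf₁ hf₂
  have hgc : ∀ N, Continuous (cutoff N f₁) := fun N => continuous_cutoff N hf₁c
  have hgd : ∀ N, Continuous (cutoffDeriv N f₁ f₂) := fun N => continuous_cutoffDeriv N hf₁c hf₂
  have hgp : ∀ N, Continuous (cutoffPrim N (f 0) f₁) := fun N =>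
    continuous_iff_continuousAt.2 fun x => (hasDerivAt_cutoffPrim N (f 0) hf₁c x).continuousAt
  have hM0 : ∀ N, 0 ≤ M N := fun N => (abs_nonneg _).trans (hM N 0)
  have hbd : ∀ (g : ℝ → ℝ) (a : ℝ), (∀ x, |g x| ≤ a) → ∀ x, |g x| ≤ a * Real.exp (0 * |x|) :=
    fun g a h x => by simpa using h x
  -- The derivative f₁ is truncated, rather than f. The primitive restarted at f 0 is then bounded
  -- together with its first two derivatives and stays close to f in the weighted norm.
  refine duality_of_tendsto (v := fun N => hB.compElem hT t (cutoff N f₁))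
    (Z := fun N => itoDiv H K B (cutoffPrim N (f 0) f₁) (cutoffDeriv N f₁ f₂) t) hu hY
    (fun N => hB.memLp_compElem hH hK hHK hT ht (hgc N) (hM0 N) (hbd _ _ (hM₁ N)))
    (fun N => hB.memLp_itoDiv hHK hT ht (hgp N) (hgd N) (hM0 N) (hbd _ _ (hM N))
      (hbd _ _ (hM₂ N))) ?_ ?_ F fun N => ?_
  · have hlim : Tendsto (fun N => ENNReal.ofReal (√(normConst H K T * t)
        * (ε N * expConst H K T (d + 1)))) atTop (𝓝 0) := by
      have := ENNReal.tendsto_ofReal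
        ((hε.mul_const (expConst H K T (d + 1))).const_mul (√(normConst H K T * t)))
      simpa using this
    refine tendsto_of_tendsto_of_tendsto_of_le_of_le tendsto_const_nhds hlim (fun _ => zero_le)
      fun N => ?_
    simp only
    rw [eLpNorm_congr_ae (hB.compElem_sub hH hK hHK hT ht (hgc N) hf₁c)]
    exact hB.eLpNorm_compElem_le hH hK hHK hT ht ((hgc N).sub hf₁c) (hε0 N)
      fun x => (happ N x).1
  · have hlim : Tendsto (fun N => ENNReal.ofReal (ε N * (expConst H K T w
        * (1 + t ^ (2 * H * K) / 2)))) atTop (𝓝 0) := by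
      have := ENNReal.tendsto_ofReal
        (hε.mul_const (expConst H K T w * (1 + t ^ (2 * H * K) / 2)))
      simpa using this
    refine tendsto_of_tendsto_of_tendsto_of_le_of_le tendsto_const_nhds hlim (fun _ => zero_le)
      fun N => ?_
    refine hB.eLpNorm_itoDiv_sub_le hHK hT ht (hgp N) (hgd N) hfc hf₂ (cutoffPrim_zero _ _ _)
      (hε0 N) (fun x => ?_) fun x => ((happ N x).2).trans (hmono x (hε0 N) (by linarith))
    have := abs_le_of_abs_deriv_le_exp (k := fun y => cutoffPrim N (f 0) f₁ y - f y)
      (fun y => (hasDerivAt_cutoffPrim N (f 0) hf₁c y).sub (hf y))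
      (by rw [cutoffPrim_zero, sub_self]) (by linarith) (fun y => (happ N y).1) x
    refine this.trans (le_of_eq ?_)
    rw [hw]; ring_nf
  · exact hB.integral_val_mul_itoDiv_of_bounded hH hK hHK hT ht F
      (hasDerivAt_cutoffPrim N (f 0) hf₁c) (hasDerivAt_cutoff N hf₁) (hgd N) (hM N) (hM₁ N)
      (hM₂ N)

end IsBifractionalBM

/-! ### Mollification and membership in 𝔻^{1,2} -/

theorem tendstoUniformly_normed_convolution {h : ℝ → ℝ} (hc : Continuous h)
    (hs : HasCompactSupport h) {φ : ℕ → ContDiffBump (0 : ℝ)}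
    (hφ : Tendsto (fun k => (φ k).rOut) atTop (𝓝 0)) :
    TendstoUniformly (fun k => convolution ((φ k).normed volume) h
      (ContinuousLinearMap.lsmul ℝ ℝ) volume) h atTop := by
  have hu : UniformContinuous h := hs.uniformContinuous_of_continuous hc
  rw [Metric.uniformContinuous_iff] at hu
  rw [Metric.tendstoUniformly_iff]
  intro ε hε
  obtain ⟨δ, hδ, h1⟩ := hu (ε / 2) (by positivity)
  filter_upwards [hφ.eventually_lt_const hδ] with k hk x
  rw [dist_comm]
  refine (ContDiffBump.dist_normed_convolution_le hc.aestronglyMeasurable fun y hy =>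
    (h1 ?_).le).trans_lt (half_lt_self hε)
  exact (Metric.mem_ball.1 hy).trans hk

theorem abs_normed_convolution_le {h : ℝ → ℝ} (hc : Continuous h) {M : ℝ} (hM : ∀ x, |h x| ≤ M)
    (φ : ContDiffBump (0 : ℝ)) (x : ℝ) :
    |convolution (φ.normed volume) h (ContinuousLinearMap.lsmul ℝ ℝ) volume x| ≤ M := by
  have := dist_convolution_le (x₀ := x) (z₀ := 0) ((abs_nonneg _).trans (hM 0))
    φ.support_normed_eq.subset φ.nonneg_normed (φ.integral_normed (μ := volume))
    hc.aestronglyMeasurable fun y _ => by simpa using hM y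
  simpa using this

/-- A compactly supported `C¹` function is a uniform limit, together with its derivative, of
smooth functions with compact support. -/
theorem exists_contDiff_approx {h h' : ℝ → ℝ} (hh : ∀ x, HasDerivAt h (h' x) x)
    (hc' : Continuous h') (hs : HasCompactSupport h) {M : ℝ} (hM : ∀ x, |h x| ≤ M)
    (hM' : ∀ x, |h' x| ≤ M) :
    ∃ g : ℕ → ℝ → ℝ, (∀ k, ContDiff ℝ (⊤ : ℕ∞) (g k)) ∧ (∀ k, HasCompactSupport (g k)) ∧
      TendstoUniformly g h atTop ∧ TendstoUniformly (fun k => deriv (g k)) h' atTop ∧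
      (∀ k x, |g k x| ≤ M) ∧ ∀ k x, |deriv (g k) x| ≤ M := by
  have hc : Continuous h := continuous_iff_continuousAt.2 fun x => (hh x).continuousAt
  have hd : deriv h = h' := funext fun x => (hh x).deriv
  have hs' : HasCompactSupport h' := hd ▸ hs.deriv
  have hC1 : ContDiff ℝ 1 h := contDiff_one_iff_deriv.2
    ⟨fun x => (hh x).differentiableAt, hd ▸ hc'⟩
  let φ : ℕ → ContDiffBump (0 : ℝ) := fun k =>
    ⟨1 / (k + 1) / 2, 1 / (k + 1), by positivity, half_lt_self (by positivity)⟩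
  have hφ : Tendsto (fun k => (φ k).rOut) atTop (𝓝 0) := tendsto_one_div_add_atTop_nhds_zero_nat
  let L : ℝ →L[ℝ] ℝ →L[ℝ] ℝ := ContinuousLinearMap.lsmul ℝ ℝ
  have hderiv : ∀ k, deriv (convolution ((φ k).normed volume) h L volume)
      = convolution ((φ k).normed volume) h' L volume := fun k => by
    ext x
    rw [← hd]
    exact (hs.hasDerivAt_convolution_right L (φ k).continuous_normed.locallyIntegrable hC1 x).deriv
  refine ⟨fun k => convolution ((φ k).normed volume) h L volume, fun k => ?_, fun k => ?_,
    tendstoUniformly_normed_convolution hc hs hφ, ?_, fun k x => ?_, fun k x => ?_⟩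
  · exact (φ k).hasCompactSupport_normed.contDiff_convolution_left L (φ k).contDiff_normed
      hc.locallyIntegrable
  · exact (φ k).hasCompactSupport_normed.convolution L hs
  · simp only [hderiv]
    exact tendstoUniformly_normed_convolution hc' hs' hφ
  · exact abs_normed_convolution_le hc hM (φ k) x
  · simp only [hderiv]
    exact abs_normed_convolution_le hc' hM' (φ k) x

/-- The smooth functional `g(W(x))`. -/
noncomputable def SmoothFunctional.ofComp {E : Type*} {g : ℝ → ℝ} (hg : ContDiff ℝ (⊤ : ℕ∞) g)
    (hs : HasCompactSupport g) (x : E) : SmoothFunctional E where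
  n := 1
  g := g ∘ ContinuousLinearMap.proj (R := ℝ) (φ := fun _ : Fin 1 => ℝ) 0
  h := fun _ => x
  smooth := hg.comp (ContinuousLinearMap.contDiff _)
  bounded := fun k => by
    obtain ⟨C, hC⟩ := (hg.continuous_iteratedFDeriv (m := k)
      (by exact_mod_cast le_top)).bounded_above_of_compact_support (hs.iteratedFDeriv k)
    refine ⟨C * ∏ _i : Fin k, ‖ContinuousLinearMap.proj (R := ℝ) (φ := fun _ : Fin 1 => ℝ) 0‖,
      fun y => ?_⟩
    rw [ContinuousLinearMap.iteratedFDeriv_comp_right _ hg _ (by exact_mod_cast le_top)]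
    refine (ContinuousMultilinearMap.norm_compContinuousLinearMap_le _ _).trans ?_
    gcongr
    exact hC _

section

variable {Ω : Type*} [MeasurableSpace Ω] {P : Measure Ω}
  {E : Type*} [NormedAddCommGroup E] [InnerProductSpace ℝ E]

theorem SmoothFunctional.D_ofComp (W : E →L[ℝ] Lp ℝ 2 P) {g : ℝ → ℝ}
    (hg : ContDiff ℝ (⊤ : ℕ∞) g) (hs : HasCompactSupport g) (x : E) (ω : Ω) :
    (SmoothFunctional.ofComp hg hs x).D W ω = deriv g (W x ω) • x := by
  have h1 : HasFDerivAt (g ∘ ContinuousLinearMap.proj (R := ℝ) (φ := fun _ : Fin 1 => ℝ) 0)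
      (deriv g (W x ω) • ContinuousLinearMap.proj (R := ℝ) (φ := fun _ : Fin 1 => ℝ) 0)
      (fun _ => W x ω) :=
    HasDerivAt.comp_hasFDerivAt (h₂ := g) (h₂' := deriv g (W x ω)) (fun _ : Fin 1 => W x ω)
      ((hg.differentiable (by simp)).differentiableAt.hasDerivAt)
      (ContinuousLinearMap.hasFDerivAt _)
  unfold SmoothFunctional.D SmoothFunctional.ofComp
  simp only [Finset.univ_unique, Finset.sum_singleton]
  rw [h1.fderiv]
  simp

/-- Dominated convergence. The filter is arbitrary but countably generated, so the statement also
applies to pairs of indices, for the Cauchy condition on derivatives. -/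
theorem tendsto_eLpNorm_two_of_bounded [IsFiniteMeasure P] {V ι : Type*} [NormedAddCommGroup V]
    {l : Filter ι} [l.IsCountablyGenerated] {X : ι → Ω → V}
    (hm : ∀ i, AEStronglyMeasurable (X i) P) {C : ℝ} (hC : ∀ i, ∀ᵐ ω ∂P, ‖X i ω‖ ≤ C)
    (h : ∀ᵐ ω ∂P, Tendsto (fun i => X i ω) l (𝓝 0)) :
    Tendsto (fun i => eLpNorm (X i) 2 P) l (𝓝 0) := by
  have hC2 : ∀ i, ∀ᵐ ω ∂P, ‖‖X i ω‖ ^ 2‖ ≤ C ^ 2 := fun i => by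
    filter_upwards [hC i] with ω hω
    rw [Real.norm_of_nonneg (by positivity)]
    gcongr
  have h1 : Tendsto (fun i => ∫ ω, ‖X i ω‖ ^ 2 ∂P) l (𝓝 (∫ _, (0 : ℝ) ∂P)) := by
    refine tendsto_integral_filter_of_dominated_convergence (fun _ => C ^ 2)
      (Eventually.of_forall fun i => (hm i).norm.pow 2) (Eventually.of_forall hC2)
      (integrable_const _) ?_
    filter_upwards [h] with ω hω
    simpa using hω.norm.pow 2
  have h2 : Tendsto (fun i => ENNReal.ofReal √(∫ ω, ‖X i ω‖ ^ 2 ∂P)) l (𝓝 0) := by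
    have := ENNReal.tendsto_ofReal ((Real.continuous_sqrt.tendsto _).comp h1)
    simpa using this
  refine tendsto_of_tendsto_of_tendsto_of_le_of_le tendsto_const_nhds h2 (fun _ => zero_le)
    fun i => ?_
  refine eLpNorm_two_le_of_integral_sq_le (hm i)
    ((integrable_const (C ^ 2)).mono' ((hm i).norm.pow 2) (hC2 i)) (Real.sqrt_nonneg _) ?_
  rw [Real.sq_sqrt (integral_nonneg fun ω => by positivity)]

end

namespace IsBifractionalBM

variable {Ω : Type*} [MeasurableSpace Ω] {H K T : ℝ} {B : ℝ → Ω → ℝ} {P : Measure Ω}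

/-- The smooth random vector `∑ⱼ g(W(1_{[0,tⱼ]})) 1_{(tⱼ, tⱼ₊₁]}`. -/
noncomputable def stepVector (hB : IsBifractionalBM H K T B P) (hT : 0 ≤ T) (t : ℝ) (n : ℕ)
    {g : ℝ → ℝ} (hg : ContDiff ℝ (⊤ : ℕ∞) g) (hs : HasCompactSupport g) :
    SmoothVector (CanonicalHilbert hB.posSemidef) where
  m := n
  F := fun j => SmoothFunctional.ofComp hg hs (hB.pt hT (t * (j : ℕ) / n))
  h := fun j => hB.incr hT t n j

theorem val_stepVector (hB : IsBifractionalBM H K T B P) (hT : 0 ≤ T) {t : ℝ} (ht : t ∈ Icc 0 T)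
    (n : ℕ) {g : ℝ → ℝ} (hg : ContDiff ℝ (⊤ : ℕ∞) g) (hs : HasCompactSupport g) :
    (hB.stepVector hT t n hg hs).val hB.wiener =ᵐ[P] fun ω =>
      ((hB.pathSum hT hB.smulHom t n fun s => g (B s ω) : StepSpace hB.posSemidef) :
        CanonicalHilbert hB.posSemidef) := by
  have h : ∀ᵐ ω ∂P, ∀ j : Fin n, hB.wiener (hB.pt hT (t * (j : ℕ) / n)) ω = B (t * (j : ℕ) / n) ω :=
    ae_all_iff.2 fun j => hB.wiener_pt hT (node_mem_T ht (by have := j.2; omega) j.2.le)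
  filter_upwards [h] with ω hω
  rw [pathSum, hB.coe_stepSum, ← Fin.sum_univ_eq_sum_range
    (fun i => g (B (t * i / n) ω) • (hB.incr hT t n i : CanonicalHilbert hB.posSemidef))]
  exact Finset.sum_congr rfl fun j _ => by
    rw [← hω j]; rfl

theorem D_stepVector (hB : IsBifractionalBM H K T B P) (hT : 0 ≤ T) {t : ℝ} (ht : t ∈ Icc 0 T)
    (n : ℕ) {g : ℝ → ℝ} (hg : ContDiff ℝ (⊤ : ℕ∞) g) (hs : HasCompactSupport g) :
    (hB.stepVector hT t n hg hs).D hB.wiener =ᵐ[P] fun ω =>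
      hB.pathSum hT hB.tmulHom t n fun s =>
        deriv g (B s ω) • (hB.pt hT s : CanonicalHilbert hB.posSemidef) := by
  have h : ∀ᵐ ω ∂P, ∀ j : Fin n, hB.wiener (hB.pt hT (t * (j : ℕ) / n)) ω = B (t * (j : ℕ) / n) ω :=
    ae_all_iff.2 fun j => hB.wiener_pt hT (node_mem_T ht (by have := j.2; omega) j.2.le)
  filter_upwards [h] with ω hω
  rw [pathSum, stepSum, ← Fin.sum_univ_eq_sum_range
    (fun i => hB.tmulHom (deriv g (B (t * i / n) ω)
      • (hB.pt hT (t * i / n) : CanonicalHilbert hB.posSemidef)) (hB.incr hT t n i))]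
  refine Finset.sum_congr rfl fun j _ => ?_
  rw [← hω j]
  exact congrArg (· ⊗ₜ[ℝ] (hB.incr hT t n j : CanonicalHilbert hB.posSemidef))
    (SmoothFunctional.D_ofComp hB.wiener hg hs _ ω)

theorem aestronglyMeasurable_D_stepVector (hB : IsBifractionalBM H K T B P) (hT : 0 ≤ T) {t : ℝ}
    (ht : t ∈ Icc 0 T) (n : ℕ) {g : ℝ → ℝ} (hg : ContDiff ℝ (⊤ : ℕ∞) g)
    (hs : HasCompactSupport g) :
    AEStronglyMeasurable ((hB.stepVector hT t n hg hs).D hB.wiener) P := by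
  have h : StronglyMeasurable fun ω => ∑ i ∈ Finset.range n, deriv g (B (t * i / n) ω)
      • ((hB.pt hT (t * i / n) : CanonicalHilbert hB.posSemidef)
        ⊗ₜ[ℝ] (hB.incr hT t n i : CanonicalHilbert hB.posSemidef)) :=
    Finset.stronglyMeasurable_fun_sum _ fun i hi => by
      have hi := Finset.mem_range.1 hi
      exact ((hg.continuous_deriv (by simp)).measurable.comp
        (hB.measurable _ (node_mem_T ht (by omega) hi.le))).stronglyMeasurable.smul_const _
  refine (h.aestronglyMeasurable (μ := P)).congr ?_
  filter_upwards [hB.D_stepVector hT ht n hg hs] with ω hω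
  rw [hω, pathSum, stepSum]
  exact Finset.sum_congr rfl fun i _ => (TensorProduct.smul_tmul' _ _ _)

theorem norm_pt_le (hB : IsBifractionalBM H K T B P) (hHK : 1 ≤ 2 * H * K) (hT : 0 ≤ T) {s : ℝ}
    (hs : s ∈ Icc 0 T) : ‖hB.pt hT s‖ ≤ √(T ^ (2 * H * K)) := by
  refine Real.le_sqrt_of_sq_le ?_
  rw [hB.norm_pt_sq hHK hT hs]
  exact Real.rpow_le_rpow hs.1 hs.2 (by linarith)

/-- If `h` is `C¹` with compact support, then `h(B) 1_{(0,t]}` belongs to `𝔻^{1,2}`. -/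
theorem memD12_compElem (hB : IsBifractionalBM H K T B P) (hH : 0 < H)
    (hK : K ∈ Ioc (0 : ℝ) 1) (hHK : 1 ≤ 2 * H * K) (hT : 0 ≤ T) {t : ℝ} (ht : t ∈ Icc 0 T)
    {h h' : ℝ → ℝ} (hh : ∀ x, HasDerivAt h (h' x) x) (hc' : Continuous h')
    (hs : HasCompactSupport h) {M : ℝ} (hM : ∀ x, |h x| ≤ M) (hM' : ∀ x, |h' x| ≤ M) :
    MemD12 hB.wiener (hB.compElem hT t h) := by
  have := hB.gaussian.isProbabilityMeasure
  have hc : Continuous h := continuous_iff_continuousAt.2 fun x => (hh x).continuousAt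
  have hM0 : 0 ≤ M := (abs_nonneg _).trans (hM 0)
  have hmem : MemLp (hB.compElem hT t h) 2 P :=
    hB.memLp_compElem (w := 0) hH hK hHK hT ht hc hM0 fun x => by simpa using hM x
  obtain ⟨g, hg, hgs, hgh, hgd, hgM, hgM'⟩ := exists_contDiff_approx hh hc' hs hM hM'
  set A := normConst H K T * t
  have hA : 0 ≤ A := mul_nonneg (normConst_nonneg hHK hT) ht.1
  -- A diagonal choice: the partition into k intervals is combined with the k-th mollified function.
  set V := fun k => hB.stepVector hT t k (hg k) (hgs k)
  have hval := fun k => hB.val_stepVector hT ht k (hg k) (hgs k)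
  have hD := fun k => hB.D_stepVector hT ht k (hg k) (hgs k)
  have hnode : ∀ {n i : ℕ}, i < n → t * i / n ∈ Icc 0 T := fun {n i} hi =>
    node_mem_T ht (by omega) hi.le
  have hbv : ∀ (k : ℕ) {f : ℝ → ℝ} (ω : Ω), (∀ x, |f x| ≤ M) →
      ‖((hB.pathSum hT hB.smulHom t k fun s => f (B s ω) : StepSpace hB.posSemidef) :
        CanonicalHilbert hB.posSemidef)‖ ≤ √(A * M ^ 2) := fun k f ω hf => by
    rw [UniformSpace.Completion.norm_coe]
    exact Real.le_sqrt_of_sq_le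
      (hB.norm_stepSum_sq_le_of_le hH hK hHK hT ht hB.inner_smulHom fun i _ => hf _)
  refine ⟨hmem, V, ?_, ?_⟩
  · refine tendsto_eLpNorm_two_of_bounded (C := √(A * M ^ 2) + √(A * M ^ 2)) (fun k => ?_)
      (fun k => ?_) ?_
    · exact (((hB.stronglyMeasurable_pathSum hT ht (hg k).continuous k).aestronglyMeasurable).congr
        (hval k).symm).sub hmem.1
    · filter_upwards [hval k, hB.ae_tendsto_compElem hH hK hHK hT ht hc] with ω h1 h2
      refine (norm_sub_le _ _).trans (add_le_add ?_ ?_)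
      · rw [h1]; exact hbv k ω (hgM k)
      · exact le_of_tendsto' h2.norm fun n => hbv n ω hM
    · filter_upwards [ae_all_iff.2 hval, hB.ae_continuousOn_comp ht hc] with ω h1 h2
      simp only [V, h1]
      rw [← tendsto_sub_nhds_zero_iff.symm]
      refine hB.tendsto_stepSum_of_close hH hK hHK hT ht h2
        (x := fun k i => g k (B (t * i / k) ω)) fun ε hε => ?_
      filter_upwards [Metric.tendstoUniformly_iff.1 hgh ε hε] with k hk i _
      have := (hk (B (t * i / k) ω)).le
      rwa [dist_comm, Real.dist_eq] at this
  · set c := √(T ^ (2 * H * K))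
    refine tendsto_eLpNorm_two_of_bounded (C := √(A * (M * c) ^ 2) + √(A * (M * c) ^ 2))
      (fun p => ?_) (fun p => ?_) ?_
    · exact (hB.aestronglyMeasurable_D_stepVector hT ht p.1 (hg p.1) (hgs p.1)).sub
        (hB.aestronglyMeasurable_D_stepVector hT ht p.2 (hg p.2) (hgs p.2))
    · have hb : ∀ k ω, ‖hB.pathSum hT hB.tmulHom t k fun s =>
          deriv (g k) (B s ω) • (hB.pt hT s : CanonicalHilbert hB.posSemidef)‖
          ≤ √(A * (M * c) ^ 2) := fun k ω =>
        Real.le_sqrt_of_sq_le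
          (hB.norm_stepSum_sq_le_of_le hH hK hHK hT ht hB.inner_tmulHom fun i hi => by
            rw [norm_smul, UniformSpace.Completion.norm_coe]
            exact mul_le_mul (hgM' k _) (hB.norm_pt_le hHK hT (hnode hi)) (norm_nonneg _) hM0)
      filter_upwards [hD p.1, hD p.2] with ω h1 h2
      refine (norm_sub_le _ _).trans (add_le_add ?_ ?_)
      · rw [h1]; exact hb _ ω
      · rw [h2]; exact hb _ ω
    · filter_upwards [ae_all_iff.2 hD, hB.ae_continuousOn_comp ht hc'] with ω h1 h2
      simp only [V, h1]
      -- The derivatives converge pathwise only in the Cauchy sense, since the algebraic tensor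
      -- product is not assumed complete. The step bound is applied to the path s ↦ g_k'(B_s)
      -- 1_{[0,s]} with values in the canonical space, which converges uniformly to h'(B_s)
      -- 1_{[0,s]}.
      have hcau : CauchySeq fun k => hB.pathSum hT hB.tmulHom t k fun s =>
          deriv (g k) (B s ω) • (hB.pt hT s : CanonicalHilbert hB.posSemidef) := by
        refine hB.cauchySeq_pathSum hH hK hHK hT ht hB.inner_tmulHom
          (φ := fun k s => deriv (g k) (B s ω) • (hB.pt hT s : CanonicalHilbert hB.posSemidef))
          (ψ := fun s => h' (B s ω) • (hB.pt hT s : CanonicalHilbert hB.posSemidef)) ?_ ?_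
        · rw [Metric.tendstoUniformlyOn_iff]
          intro ε hε
          filter_upwards [Metric.tendstoUniformly_iff.1 hgd (ε / (c + 1)) (by positivity)]
            with k hk s hs
          rw [dist_eq_norm, ← sub_smul, norm_smul, UniformSpace.Completion.norm_coe]
          have h3 := hB.norm_pt_le hHK hT ⟨hs.1, hs.2.trans ht.2⟩
          have h4 := hk (B s ω)
          rw [Real.dist_eq, lt_div_iff₀ (by positivity)] at h4
          refine lt_of_le_of_lt (mul_le_mul_of_nonneg_left ?_ (norm_nonneg _)) h4
          linarith
        · refine h2.smul ?_
          exact (UniformSpace.Completion.continuous_coe _).comp_continuousOn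
            ((hB.continuousOn_pt hH hK.1 hT).mono (Icc_subset_Icc le_rfl ht.2))
      have := cauchySeq_iff_tendsto_dist_atTop_0.1 hcau
      rw [prod_atTop_atTop_eq, tendsto_zero_iff_norm_tendsto_zero]
      simpa only [dist_eq_norm] using this

/-! ### Localization -/

/-- The events bound |B| on a countable dense set of times only, which makes them measurable;
continuity of almost every path extends the bound to [0,T] and shows that the events exhaust Ω up to
a null set. -/
theorem exists_localization (hB : IsBifractionalBM H K T B P) :
    ∃ A : ℕ → Set Ω, (∀ n, MeasurableSet (A n)) ∧ Monotone A ∧ (∀ᵐ ω ∂P, ∃ n, ω ∈ A n) ∧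
      ∀ n, ∀ᵐ ω ∂P, ω ∈ A n → ∀ s ∈ Icc 0 T, |B s ω| ≤ n := by
  obtain ⟨D, hDc, hDd⟩ := TopologicalSpace.exists_countable_dense (Icc (0 : ℝ) T)
  refine ⟨fun n => ⋂ s ∈ D, {ω | |B s ω| ≤ n}, fun n => ?_, fun n m hnm => ?_, ?_, fun n => ?_⟩
  · exact MeasurableSet.biInter hDc fun s _ =>
      measurableSet_le (hB.measurable s s.2).abs measurable_const
  · refine iInter₂_mono fun s _ ω hω => ?_
    exact (show |B s ω| ≤ n from hω).trans (Nat.cast_le.2 hnm)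
  · filter_upwards [hB.continuous] with ω hω
    obtain ⟨C, hC⟩ := isCompact_Icc.exists_bound_of_continuousOn hω
    obtain ⟨n, hn⟩ := exists_nat_ge C
    exact ⟨n, mem_iInter₂.2 fun s _ => (hC s s.2).trans hn⟩
  · filter_upwards [hB.continuous] with ω hω hA s hs
    have hc : Continuous fun s : Icc (0 : ℝ) T => |B s ω| :=
      (continuousOn_iff_continuous_domRestrict.1 hω).abs
    have hcl : IsClosed {s : Icc (0 : ℝ) T | |B s ω| ≤ n} := isClosed_le hc continuous_const
    have : closure D ⊆ {s : Icc (0 : ℝ) T | |B s ω| ≤ n} :=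
      closure_minimal (fun s hs => mem_iInter₂.1 hA s hs) hcl
    exact this (hDd.closure_eq ▸ mem_univ (⟨s, hs⟩ : Icc (0 : ℝ) T))

/-- In Itô's formula the remainder is the localized divergence of `f'(B) 1_{(0,t]}`. -/
theorem isLocalDivergence_compElem (hB : IsBifractionalBM H K T B P) (hH : 0 < H)
    (hK : K ∈ Ioc (0 : ℝ) 1) (hHK : 1 ≤ 2 * H * K) (hT : 0 ≤ T) {t : ℝ} (ht : t ∈ Icc 0 T)
    {f f₁ f₂ : ℝ → ℝ} (hf : ∀ x, HasDerivAt f (f₁ x) x) (hf₁ : ∀ x, HasDerivAt f₁ (f₂ x) x)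
    (hf₂ : Continuous f₂) :
    IsLocalDivergence hB.sigma hB.wiener (hB.compElem hT t f₁) (itoDiv H K B f f₂ t) := by
  have hf₁c : Continuous f₁ := continuous_iff_continuousAt.2 fun x => (hf₁ x).continuousAt
  obtain ⟨A, hAm, hAmono, hAex, hAle⟩ := hB.exists_localization
  refine ⟨A, fun N => hB.compElem hT t (cutoff N f₁),
    fun N => itoDiv H K B (cutoffPrim N (f 0) f₁) (cutoffDeriv N f₁ f₂) t, hAm, hAmono, hAex,
    fun N => ?_⟩
  obtain ⟨M, -, hM₁, hM₂⟩ := exists_cutoff_bound N (f 0) hf₁ hf₂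
  refine ⟨hB.memD12_compElem hH hK hHK hT ht (hasDerivAt_cutoff N hf₁)
    (continuous_cutoffDeriv N hf₁c hf₂) (hasCompactSupport_cutoff N f₁) hM₁ hM₂,
    hB.isDivergence_compElem (C := M) (c := 0) hH hK hHK hT ht
      (hasDerivAt_cutoffPrim N (f 0) hf₁c) (hasDerivAt_cutoff N hf₁)
      (continuous_cutoffDeriv N hf₁c hf₂) (fun x => by simpa using hM₁ x)
      fun x => by simpa using hM₂ x, ?_⟩
  filter_upwards [hAle N, hB.ae_tendsto_compElem hH hK hHK hT ht hf₁c,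
    hB.ae_tendsto_compElem hH hK hHK hT ht (continuous_cutoff N hf₁c)] with ω hω h1 h2 hA
  -- The cut-off at level N equals one for |x| < N + 1, so on the event |B| ≤ N even its derivative
  -- vanishes along the path.
  have hlt : ∀ s ∈ Icc 0 T, |B s ω| < N + 1 := fun s hs =>
    (hω hA s hs).trans_lt (lt_add_one _)
  constructor
  -- Both elements are limits of step sums with identical coefficients on this event.
  · refine tendsto_nhds_unique h1 (h2.congr fun n => ?_)
    simp only [pathSum, stepSum]
    congr 1
    refine Finset.sum_congr rfl fun i hi => ?_
    have hi := Finset.mem_range.1 hi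
    rw [cutoff_eq (hlt _ (node_mem_T ht (by omega) hi.le))]
  · simp only [itoDiv]
    rw [cutoffPrim_eq hf hf₁c (hlt t ht), cutoffPrim_zero]
    congr 2
    refine intervalIntegral.integral_congr fun s hs => ?_
    rw [uIcc_of_le ht.1] at hs
    simp only [cutoffDeriv_eq (hlt s ⟨hs.1, hs.2.trans ht.2⟩)]

end IsBifractionalBM

/-! ### Itô's formula -/

theorem mainTheorem1 {Ω : Type*} [MeasurableSpace Ω] (P : Measure Ω) [IsProbabilityMeasure P]
    (H K T : ℝ) (hH : H ∈ Ioo (0 : ℝ) 1) (hK : K ∈ Ioc (0 : ℝ) 1) (hHK : 1 ≤ 2 * H * K)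
    (hT : 0 < T) (B : ℝ → Ω → ℝ) (hB : IsBifractionalBM H K T B P)
    (f : ℝ → ℝ) (hf : ContDiff ℝ 2 f) (t : ℝ) (ht : t ∈ Icc 0 T) :
    ∃ I : Ω → ℝ,
      hB.HasLocalSkorohodIntegral
        (fun ω => (Ioc 0 t).indicator fun s => deriv f (B s ω)) I ∧
      ((∃ C c : ℝ, ∀ x, |deriv f x| ≤ C * Real.exp (c * |x|) ∧
          |deriv (deriv f) x| ≤ C * Real.exp (c * |x|)) →
        hB.HasSkorohodIntegral
          (fun ω => (Ioc 0 t).indicator fun s => deriv f (B s ω)) I) ∧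
      ∀ᵐ ω ∂P, f (B t ω) =
        f 0 + I ω + H * K * ∫ s in (0 : ℝ)..t, deriv (deriv f) (B s ω) * s ^ (2 * H * K - 1) := by
  have hf1 : ContDiff ℝ 1 (deriv f) := hf.deriv' (n := 1)
  have hd1 : ∀ x, HasDerivAt f (deriv f x) x := fun x =>
    ((hf.differentiable (by simp)) x).hasDerivAt
  have hd2 : ∀ x, HasDerivAt (deriv f) (deriv (deriv f) x) x := fun x =>
    ((hf1.differentiable (by simp)) x).hasDerivAt
  have hc2 : Continuous (deriv (deriv f)) := hf1.continuous_deriv (by simp)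
  have hrep : ∀ᵐ ω ∂P, Represents (hB.compElem hT.le t (deriv f) ω)
      ((Ioc 0 t).indicator fun s => deriv f (B s ω)) :=
    (hB.ae_continuousOn_comp ht hf1.continuous).mono fun ω hω =>
      hB.represents_pathElem hH.1 hK hHK hT.le ht hω
  -- With this choice of I the formula is an algebraic identity for every ω; the content is that I
  -- is the divergence, with the same integrand in the localized and in the strict sense.
  refine ⟨IsBifractionalBM.itoDiv H K B f (deriv (deriv f)) t,
    ⟨_, hrep, hB.isLocalDivergence_compElem hH.1 hK hHK hT.le ht hd1 hd2 hc2⟩, ?_,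
    ae_of_all _ fun ω => by rw [IsBifractionalBM.itoDiv]; ring⟩
  rintro ⟨C, c, hb⟩
  exact ⟨_, hrep, hB.isDivergence_compElem hH.1 hK hHK hT.le ht hd1 hd2 hc2
    (fun x => (hb x).1) fun x => (hb x).2⟩
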